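/- Let $F(x,n)=(2x-x^2)\,n-n^2$ and write $N[f]=\int_0^\infty f(x)\,dx$. A function $n=n(t,x)$ on $(0,\infty)\times(0,\infty)$ is called an entropy solution of $$\partial_t n+\partial_x F(x,n)=0,\qquad F(x,n)\to 0\ \text{ as } x\to\infty,$$ if for every $T>0$: (1) $n\in L^1([0,T]\times[0,\infty))\cap L^1([0,T];L^2([0,\infty)))$, $n^2\in L^1_{\mathrm{loc}}((0,T)\times(0,\infty))$, and $\int_0^T\!\int_0^\infty \big(n\,\partial_t\varphi+F(x,n)\,\partial_x\varphi\big)\,dx\,dt=0$ for all $\varphi\in C_c^\infty((0,T)\times(0,\infty))$; (2) for every $k\in\mathbb R$ and every non-negative $\varphi\in C_c^\infty((0,T)\times(0,\infty))$, $$\int_0^T\!\int_0^\infty\Big(|n-k|\,\partial_t\varphi+\operatorname{sgn}(n-k)\,[F(x,n)-F(x,k)]\,\partial_x\varphi-\operatorname{sgn}(n-k)\,\partial_xF(x,k)\,\varphi\Big)\,dx\,dt\ \ge 0;$$ (3) $\lim_{R\to\infty}\int_0^T|F(R,n(t,R))|\,dt=0$ (essential limit in $R$). It has initial data $n_0$ if,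 for every $R>0$, $\int_0^R|n(t,x)-n_0(x)|\,dx\to0$ as $t\to0^+$ (essential limit in $t$). **Proposition.** Let $n$ be a non-negative entropy solution with initial data $n_0\in L^1(0,\infty)$ of compact support in $[0,\infty)$. Then $n$ agrees almost everywhere with a function in $C([0,\infty);L^1(0,\infty))$ whose value at $t=0$ is $n_0$, so that $n(T,\cdot)\in L^1(0,\infty)$ is defined for every $T\ge0$; $n$ has a boundary trace $n(\cdot,0)$ at $x=0$, in the sense that $\int_0^T|n(t,x)-n(t,0)|\,dt\to0$ as $x\to0^+$ (essential limit in $x$) for every $T>0$; and for every $T\ge0$ the function $n(\cdot,0)^2$ is integrable on $(0,T)$ and $$N[n(T,\cdot)]+\int_0^T n(t,0)^2\,dt=N[n_0].$$ -/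

import Mathlib

open MeasureTheory Set Filter Topology
open scoped ContDiff

noncomputable section

/-- The flux `F(x, n) = (2x - x²) n - n²`. -/
def flux (x n : ℝ) : ℝ := (2 * x - x ^ 2) * n - n ^ 2

/-- The total photon number `N[f] = ∫₀^∞ f(x) dx`. -/
def photonNumber (f : ℝ → ℝ) : ℝ := ∫ x in Ioi (0 : ℝ), f x

/-- Test functions `φ(t, x)` of class `C_c^∞((0, T) × (0, ∞))`. -/
structure IsTestFunction (T : ℝ) (φ : ℝ × ℝ → ℝ) : Prop where
  smooth : ContDiff ℝ ∞ φ
  compactSupport : HasCompactSupport φ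
  support_subset : tsupport φ ⊆ Ioo 0 T ×ˢ Ioi 0

/-- The partial derivative `∂_t φ` at `p = (t, x)`. -/
def dt (φ : ℝ × ℝ → ℝ) (p : ℝ × ℝ) : ℝ := fderiv ℝ φ p (1, 0)

/-- The partial derivative `∂_x φ` at `p = (t, x)`. -/
def dx (φ : ℝ × ℝ → ℝ) (p : ℝ × ℝ) : ℝ := fderiv ℝ φ p (0, 1)

/-- Entropy solutions `n(t, x)` on `(0, T) × (0, ∞)` of `∂_t n + ∂_x F(x, n) = 0` with
`F(x, n) → 0` as `x → ∞`. The function `n` stands for its almost-everywhere class in `(t, x)`;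
accordingly the limit `R → ∞` is an essential limit (a null set of `R` is ignored). -/
structure IsEntropySolutionOn (T : ℝ) (n : ℝ → ℝ → ℝ) : Prop where
  /-- The function `n` belongs to `L¹([0, T] × [0, ∞))`. -/
  integrable : IntegrableOn (fun p : ℝ × ℝ => n p.1 p.2) (Ioo 0 T ×ˢ Ioi 0)
  /-- The function `n` belongs to `L¹([0, T]; L²([0, ∞)))`. -/
  integrable_L2 :
    ∫⁻ t in Ioo 0 T, eLpNorm (n t) 2 (volume.restrict (Ioi 0)) < (⊤ : ENNReal)
  /-- The quadratic term is locally integrable in the open domain, so that the integrals in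
  `weak` and `entropy` are integrals of integrable functions. -/
  sq_locallyIntegrable :
    LocallyIntegrableOn (fun p : ℝ × ℝ => n p.1 p.2 ^ 2) (Ioo 0 T ×ˢ Ioi 0)
  /-- The weak formulation. -/
  weak : ∀ φ : ℝ × ℝ → ℝ, IsTestFunction T φ →
    ∫ p in Ioo 0 T ×ˢ Ioi 0,
      (n p.1 p.2 * dt φ p + flux p.2 (n p.1 p.2) * dx φ p) = 0
  /-- The Kruzkov entropy inequalities. -/
  entropy : ∀ (k : ℝ) (φ : ℝ × ℝ → ℝ), IsTestFunction T φ → (∀ p, 0 ≤ φ p) →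
    0 ≤ ∫ p in Ioo 0 T ×ˢ Ioi 0,
      (|n p.1 p.2 - k| * dt φ p
        + Real.sign (n p.1 p.2 - k) * (flux p.2 (n p.1 p.2) - flux p.2 k) * dx φ p
        - Real.sign (n p.1 p.2 - k) * deriv (fun y => flux y k) p.2 * φ p)
  /-- No flux at infinity: `∫₀ᵀ |F(R, n(t, R))| dt → 0` as `R → ∞`. -/
  flux_infinity :
    Tendsto (fun R : ℝ => ∫⁻ t in Ioo 0 T, ‖flux R (n t R)‖ₑ) (atTop ⊓ ae volume) (𝓝 0)

/-- Time-global entropy solutions. -/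
def IsEntropySolution (n : ℝ → ℝ → ℝ) : Prop := ∀ T : ℝ, 0 < T → IsEntropySolutionOn T n

/-- The initial data `n₀` is attained in `L¹_loc([0, ∞))`: for every `R > 0`,
`∫₀ᴿ |n(t, x) - n₀(x)| dx → 0` as `t → 0⁺` outside a null set of times. -/
def HasInitialData (n : ℝ → ℝ → ℝ) (n₀ : ℝ → ℝ) : Prop :=
  ∀ R : ℝ, 0 < R →
    Tendsto (fun t : ℝ => ∫⁻ x in Ioo 0 R, ‖n t x - n₀ x‖ₑ) (𝓝[>] 0 ⊓ ae volume) (𝓝 0)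

/-- `γ(t)` is the boundary value `n(t, 0)`, in the sense of (strong) `L¹` traces: for every
`T > 0`, `∫₀ᵀ |n(t, x) - γ(t)| dt → 0` as `x → 0⁺` outside a null set of positions.
Such a `γ` is unique up to null sets. -/
structure IsTraceAtZero (n : ℝ → ℝ → ℝ) (γ : ℝ → ℝ) : Prop where
  measurable : AEStronglyMeasurable γ (volume.restrict (Ioi 0))
  tendsto : ∀ T : ℝ, 0 < T →
    Tendsto (fun x : ℝ => ∫⁻ t in Ioo 0 T, ‖n t x - γ t‖ₑ) (𝓝[>] 0 ⊓ ae volume) (𝓝 0)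

/-- `u` is the version of `n` in `C([0, ∞); L¹(0, ∞))`, which gives a meaning to `n(t, ·)` at
every time `t ≥ 0`. Such a `u` is unique on `[0, ∞)`. -/
structure IsContinuousVersion (n : ℝ → ℝ → ℝ)
    (u : ℝ → Lp ℝ 1 (volume.restrict (Ioi (0 : ℝ)))) : Prop where
  continuousOn : ContinuousOn u (Ici 0)
  ae_eq : ∀ᵐ t ∂(volume.restrict (Ioi (0 : ℝ))),
    (u t : ℝ → ℝ) =ᵐ[volume.restrict (Ioi 0)] n t

end

/-!
Let `u` be a measurable nonnegative representative of the solution. Near the boundary the flux is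
`drift x * u - u ^ 2` with `drift x → 0`, so that the boundary is one of outflow and the mass lost
through it up to time `T` should be `∫₀ᵀ u(t, 0)² dt`. What has to be shown is that `u` is
continuous in time with values in `L¹`, that `u(·, x)` converges strongly as `x → 0`, and that no
mass is lost at infinity. The tool is Kruzkov's doubling of variables, which for two nonnegative
solutions `u` and `v` gives the local inequality

  `∂ₜ|u - v| + ∂ₓ(drift x * |u - v| - |u ^ 2 - v ^ 2|) ≤ 0`

(`contraction_of_integrable`, `IsKruzkovSolution.contraction`). It is applied to `u` and its time
translates `v = u(· + h, ·)`, once in each variable.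

*In time.* Integrated over space, the inequality says that the `L¹` distance between `u(t + h)`
and `u(t)` is nonincreasing in `t` (`IsSolution.time_contraction`): at `x = 0` the flux
`drift x * |u - v| - |u ^ 2 - v ^ 2|` of the distance is bounded above by a term that vanishes, and
at infinity it vanishes by hypothesis. Since translations are continuous in `L¹`, the slices of
`u` are uniformly continuous in time away from `t = 0`, and extend to a continuous version `U`
(`IsSolution.exists_isVersion`). The weak formulation, with no flux at infinity, then gives the
balance law on `(x, ∞)` for almost every `x` (`IsVersion.ae_tail_sub_eq`), with a null set that
does not depend on the times (`IsVersion.ae_forall_tail_sub_eq`). Since little mass crosses a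
distant position, local convergence to the initial data becomes convergence in `L¹(0, ∞)`
(`IsVersion.tendsto_initial`), and the balance law holds from `t = 0` on
(`IsVersion.ae_isGoodPosition`). It also bounds `∫₀ᵀ u(t, x)² dt` uniformly for small `x`
(`IsGoodPosition.integral_sq_le`).

*In space.* Integrated over time, the same inequality bounds the `L¹` modulus of continuity in
time of `u(·, x)²`, for `x` close to `0`, by a multiple of `x` and a modulus of continuity of `u`
and `u²` away from the boundary (`IsVersion.ae_lintegral_sq_translate_le`). Hence `u(·, x)²` is
close in `L¹` to its averages over short time intervals, uniformly for small `x`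
(`IsVersion.eventually_lintegral_sub_average_le`). By the balance law these averages converge as
`x → 0` (`IsVersion.eventually_lintegral_average_sub_le`). Therefore `u(·, x)²` is Cauchy in
`L¹(0, T)` as `x → 0` (`IsVersion.exists_approx_sq`). The trace is the square root of its limit,
and the limit `x → 0` in the balance law is the mass balance (`IsVersion.exists_trace`).
-/

open scoped ENNReal

/-! ### Continuity of translations and mollifiers -/

/-- Translations act continuously on `L¹`. -/
theorem tendsto_lintegral_enorm_translate_sub {E : Type*} [NormedAddCommGroup E] [NormedSpace ℝ E]
    [FiniteDimensional ℝ E] [MeasurableSpace E] [BorelSpace E] (μ : Measure E)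
    [μ.IsAddHaarMeasure] {f : E → ℝ} (hf : Integrable f μ) :
    Tendsto (fun w => ∫⁻ p, ‖f (p + w) - f p‖ₑ ∂μ) (𝓝 0) (𝓝 0) := by
  let g : C(E, C(E, E)) :=
    (ContinuousMap.mk (fun a : E × E => a.2 + a.1) (by fun_prop)).curry
  have hgm : ∀ w, MeasurePreserving (g w) μ μ := fun w => measurePreserving_add_right μ w
  have hL := memLp_one_iff_integrable.2 hf
  have h0 : Tendsto (fun w => Lp.compMeasurePreserving (g w) (hgm w) (hL.toLp f)) (𝓝 0)
      (𝓝 (Lp.compMeasurePreserving (g 0) (hgm 0) (hL.toLp f))) :=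
    tendsto_const_nhds.compMeasurePreservingLp (g.continuous.tendsto 0) hgm (hgm 0) (by simp)
  rw [tendsto_iff_edist_tendsto_0] at h0
  refine h0.congr fun w => ?_
  rw [Lp.toLp_compMeasurePreserving, Lp.toLp_compMeasurePreserving, Lp.edist_toLp_toLp,
    eLpNorm_one_eq_lintegral_enorm]
  simp [g, ContinuousMap.curry]

/-- A family of mollifiers on `ℝ × ℝ` for which the kernel `w.2 * ∂ₓρ(w)`, the one through
which an `x`-dependent flux enters, has total mass `-1` and is bounded in `L¹` independently
of the scale `ε`. -/
theorem exists_mollifier : ∃ M : ℝ, ∀ ε : ℝ, 0 < ε → ∃ ρ : ℝ × ℝ → ℝ, ContDiff ℝ ∞ ρ ∧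
    (∀ w, 0 ≤ ρ w) ∧ tsupport ρ ⊆ Metric.closedBall 0 ε ∧ ∫ w, ρ w = 1 ∧
    ∫ w, w.2 * dx ρ w = -1 ∧ ∫ w, |w.2 * dx ρ w| ≤ M := by
  let B : ContDiffBump (0 : ℝ × ℝ) := ⟨1 / 2, 1, by norm_num, by norm_num⟩
  let r : ℝ × ℝ → ℝ := B.normed volume
  have hr : ContDiff ℝ ∞ r := B.contDiff_normed
  have hrc : HasCompactSupport r := B.hasCompactSupport_normed
  have hd : Continuous fun w : ℝ × ℝ => dx r w := by
    have := hr.continuous_fderiv (by simp)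
    exact this.clm_apply continuous_const
  have hdc : HasCompactSupport fun w : ℝ × ℝ => dx r w :=
    (hrc.fderiv ℝ).comp_left (g := fun L : (ℝ × ℝ) →L[ℝ] ℝ => L (0, 1)) (by simp)
  have hint1 : ∫ w, r w = 1 := B.integral_normed
  have hri : Integrable r := hr.continuous.integrable_of_hasCompactSupport hrc
  have hint2 : ∫ w : ℝ × ℝ, w.2 * dx r w = -1 := by
    have hs : ∀ w : ℝ × ℝ, fderiv ℝ (fun w : ℝ × ℝ => w.2) w (0, 1) = 1 := fun w => by
      rw [fderiv_snd]; rfl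
    have := integral_mul_fderiv_eq_neg_fderiv_mul_of_integrable (μ := (volume : Measure (ℝ × ℝ)))
      (f := fun w : ℝ × ℝ => w.2) (g := r) (v := (0, 1)) (by simpa [hs] using hri)
      ((continuous_snd.mul hd).integrable_of_hasCompactSupport hdc.mul_left)
      ((continuous_snd.mul hr.continuous).integrable_of_hasCompactSupport hrc.mul_left)
      (fun _ _ => differentiableAt_snd) (fun _ _ => (hr.differentiable (by simp)) _)
    simp only [hs, one_mul, hint1] at this
    exact this
  refine ⟨∫ w : ℝ × ℝ, |w.2 * dx r w|, fun ε hε => ?_⟩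
  have hfin : Module.finrank ℝ (ℝ × ℝ) = 2 := by simp
  have hdx : ∀ w : ℝ × ℝ, dx (fun w => (ε⁻¹) ^ 2 * r (ε⁻¹ • w)) w
      = (ε⁻¹) ^ 3 * dx r (ε⁻¹ • w) := by
    intro w
    have h1 : HasFDerivAt r (fderiv ℝ r (ε⁻¹ • w)) (ε⁻¹ • w) :=
      (hr.differentiable (by simp) _).hasFDerivAt
    have h2 : HasFDerivAt (fun w : ℝ × ℝ => ε⁻¹ • w)
        (ε⁻¹ • ContinuousLinearMap.id ℝ (ℝ × ℝ)) w :=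
      (ε⁻¹ • ContinuousLinearMap.id ℝ (ℝ × ℝ)).hasFDerivAt
    have h3 := (h1.comp w h2).const_mul ((ε⁻¹) ^ 2)
    rw [dx, HasFDerivAt.fderiv (by exact h3)]
    simp only [dx, smul_apply, ContinuousLinearMap.comp_apply,
      ContinuousLinearMap.id_apply, map_smul, smul_eq_mul]
    ring
  have hkey : ∀ w : ℝ × ℝ, w.2 * dx (fun w => (ε⁻¹) ^ 2 * r (ε⁻¹ • w)) w
      = (ε⁻¹) ^ 2 * ((ε⁻¹ • w).2 * dx r (ε⁻¹ • w)) := by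
    intro w; rw [hdx, Prod.smul_snd, smul_eq_mul]; ring
  have hscale : ∀ G : ℝ × ℝ → ℝ, ∫ w, (ε⁻¹) ^ 2 * G (ε⁻¹ • w) = ∫ w, G w := by
    intro G
    rw [integral_const_mul, Measure.integral_comp_smul, hfin, abs_of_pos (by positivity),
      smul_eq_mul, ← mul_assoc, mul_inv_cancel₀ (by positivity), one_mul]
  refine ⟨fun w => (ε⁻¹) ^ 2 * r (ε⁻¹ • w), ?_, fun w => ?_, ?_, ?_, ?_, ?_⟩
  · exact contDiff_const.mul (hr.comp (contDiff_const_smul _))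
  · exact mul_nonneg (by positivity) (B.nonneg_normed _)
  · refine closure_minimal (fun w hw => ?_) Metric.isClosed_closedBall
    have h1 : ε⁻¹ • w ∈ Function.support r := by
      intro h; exact hw (by simp [h])
    have h2 : Function.support r = Metric.ball 0 1 := B.support_normed_eq
    rw [h2, mem_ball_zero_iff, norm_smul, Real.norm_of_nonneg (by positivity)] at h1
    rw [mem_closedBall_zero_iff]
    rw [inv_mul_lt_iff₀ hε] at h1
    linarith
  · rw [hscale r, hint1]
  · simp_rw [hkey]
    rw [hscale (fun w => w.2 * dx r w), hint2]
  · simp_rw [hkey, abs_mul ((ε⁻¹) ^ 2), abs_of_nonneg (sq_nonneg ε⁻¹)]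
    rw [hscale (fun w => |w.2 * dx r w|)]

/-! ### Doubling of variables -/

/-- The coefficient of the linear part of the flux. -/
def drift (x : ℝ) : ℝ := 2 * x - x ^ 2

theorem continuous_drift : Continuous drift := by unfold drift; fun_prop

theorem flux_eq (x a : ℝ) : flux x a = drift x * a - a ^ 2 := rfl

/-- The integrand of the Kruzkov inequality, for a solution with value `a` at `p` and the
constant `k`. -/
noncomputable def kruzkovDensity (a k : ℝ) (φ : ℝ × ℝ → ℝ) (p : ℝ × ℝ) : ℝ :=
  |a - k| * dt φ p + Real.sign (a - k) * (flux p.2 a - flux p.2 k) * dx φ p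
    - Real.sign (a - k) * deriv (fun y => flux y k) p.2 * φ p

/-- The Kruzkov inequalities against the test functions supported in `S`. -/
def IsKruzkovOn (S : Set (ℝ × ℝ)) (u : ℝ × ℝ → ℝ) : Prop :=
  ∀ (k : ℝ) (φ : ℝ × ℝ → ℝ), ContDiff ℝ ∞ φ → HasCompactSupport φ → tsupport φ ⊆ S →
    (∀ p, 0 ≤ φ p) → 0 ≤ ∫ p, kruzkovDensity (u p) k φ p

/-- The integrand of the local contraction inequality between two solutions with the
values `a` and `c` at `p`. For nonnegative solutions the entropy flux between them is
`drift * |a - c| - |a ^ 2 - c ^ 2|`. -/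
noncomputable def contractionDensity (a c : ℝ) (φ : ℝ × ℝ → ℝ) (p : ℝ × ℝ) : ℝ :=
  |a - c| * dt φ p + (drift p.2 * |a - c| - |a ^ 2 - c ^ 2|) * dx φ p

theorem sign_mul_self_eq_abs (r : ℝ) : Real.sign r * r = |r| := by
  rcases lt_trichotomy r 0 with h | h | h
  · rw [Real.sign_of_neg h, abs_of_neg h]; ring
  · simp [h]
  · rw [Real.sign_of_pos h, abs_of_pos h]; ring

theorem abs_sign_le_one (r : ℝ) : |Real.sign r| ≤ 1 := by
  rcases Real.sign_apply_eq r with h | h | h <;> simp [h]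

theorem measurable_real_sign : Measurable Real.sign := by
  unfold Real.sign
  exact Measurable.ite measurableSet_Iio measurable_const
    (Measurable.ite measurableSet_Ioi measurable_const measurable_const)

theorem abs_sq_sub_sq {a k : ℝ} (ha : 0 ≤ a) (hk : 0 ≤ k) :
    |a ^ 2 - k ^ 2| = |a - k| * (a + k) := by
  rw [show a ^ 2 - k ^ 2 = (a - k) * (a + k) by ring, abs_mul, abs_of_nonneg (add_nonneg ha hk)]

theorem sign_mul_flux_sub {a k : ℝ} (ha : 0 ≤ a) (hk : 0 ≤ k) (x : ℝ) :
    Real.sign (a - k) * (flux x a - flux x k) = drift x * |a - k| - |a ^ 2 - k ^ 2| := by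
  rw [abs_sq_sub_sq ha hk, ← sign_mul_self_eq_abs]
  simp only [flux_eq]; ring

theorem deriv_flux (x k : ℝ) : deriv (fun y => flux y k) x = (2 - 2 * x) * k := by
  have h : HasDerivAt (fun y => flux y k) ((2 * 1 - 2 * x) * k) x := by
    have h1 : HasDerivAt (fun y : ℝ => 2 * y - y ^ 2) (2 * 1 - 2 * x) x := by
      have := ((hasDerivAt_id x).const_mul 2).sub (hasDerivAt_pow 2 x)
      exact this.congr_deriv (by simp)
    exact (h1.mul_const k).sub_const _
  rw [h.deriv]; ring

theorem kruzkovDensity_eq {a k : ℝ} (ha : 0 ≤ a) (hk : 0 ≤ k) (φ : ℝ × ℝ → ℝ) (p : ℝ × ℝ) :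
    kruzkovDensity a k φ p = |a - k| * dt φ p + (drift p.2 * |a - k| - |a ^ 2 - k ^ 2|) * dx φ p
      - Real.sign (a - k) * ((2 - 2 * p.2) * k) * φ p := by
  rw [kruzkovDensity, sign_mul_flux_sub ha hk, deriv_flux]

section calculus
variable {φ ρ : ℝ × ℝ → ℝ}

theorem ContDiff.continuous_dt (h : ContDiff ℝ ∞ φ) : Continuous (dt φ) :=
  (h.continuous_fderiv (by simp)).clm_apply continuous_const

theorem ContDiff.continuous_dx (h : ContDiff ℝ ∞ φ) : Continuous (dx φ) :=
  (h.continuous_fderiv (by simp)).clm_apply continuous_const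

theorem HasCompactSupport.dt (h : HasCompactSupport φ) : HasCompactSupport (dt φ) :=
  (h.fderiv ℝ).comp_left (g := fun L : (ℝ × ℝ) →L[ℝ] ℝ => L (1, 0)) (by simp)

theorem HasCompactSupport.dx (h : HasCompactSupport φ) : HasCompactSupport (dx φ) :=
  (h.fderiv ℝ).comp_left (g := fun L : (ℝ × ℝ) →L[ℝ] ℝ => L (0, 1)) (by simp)

theorem dt_eq_zero {p : ℝ × ℝ} (h : p ∉ tsupport φ) : dt φ p = 0 := by
  rw [dt, fderiv_of_notMem_tsupport (𝕜 := ℝ) h]; rfl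

theorem dx_eq_zero {p : ℝ × ℝ} (h : p ∉ tsupport φ) : dx φ p = 0 := by
  rw [dx, fderiv_of_notMem_tsupport (𝕜 := ℝ) h]; rfl

theorem hasFDerivAt_mul_sub (hφ : ContDiff ℝ ∞ φ) (hρ : ContDiff ℝ ∞ ρ) (p q : ℝ × ℝ) :
    HasFDerivAt (fun p => φ p * ρ (p - q))
      (φ p • fderiv ℝ ρ (p - q) + ρ (p - q) • fderiv ℝ φ p) p := by
  have h1 := (hφ.differentiable (by simp) p).hasFDerivAt
  have h2 : HasFDerivAt (fun p => ρ (p - q)) (fderiv ℝ ρ (p - q)) p := by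
    have h := (hρ.differentiable (by simp) (p - q)).hasFDerivAt
    have h' : HasFDerivAt (fun p : ℝ × ℝ => p - q) (ContinuousLinearMap.id ℝ (ℝ × ℝ)) p :=
      (hasFDerivAt_id p).sub_const q
    exact h.comp p h'
  exact h1.mul h2

theorem hasFDerivAt_const_mul_sub (hρ : ContDiff ℝ ∞ ρ) (c : ℝ) (p q : ℝ × ℝ) :
    HasFDerivAt (fun q => c * ρ (p - q)) (-(c • fderiv ℝ ρ (p - q))) q := by
  have h := (hρ.differentiable (by simp) (p - q)).hasFDerivAt
  have h' : HasFDerivAt (fun q : ℝ × ℝ => p - q) (-ContinuousLinearMap.id ℝ (ℝ × ℝ)) q :=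
    (hasFDerivAt_id q).const_sub p
  have h2 := (h.comp q h').const_mul c
  refine h2.congr_fderiv ?_
  ext <;> simp

end calculus

section product
set_option linter.unusedSectionVars false
variable {E : Type*} [NormedAddCommGroup E] [NormedSpace ℝ E] [FiniteDimensional ℝ E]
  [MeasurableSpace E] [BorelSpace E] {μ : Measure E} [μ.IsAddHaarMeasure]

theorem hasCompactSupport_mul_comp_sub {a k : E → ℝ} (ha : HasCompactSupport a)
    (hk : HasCompactSupport k) : HasCompactSupport fun z : E × E => a z.1 * k (z.1 - z.2) := by
  have hK : IsCompact ((fun z : E × E => (z.1, z.1 - z.2)) '' (tsupport a ×ˢ tsupport k)) :=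
    (ha.isCompact.prod hk.isCompact).image (by fun_prop)
  refine HasCompactSupport.intro hK fun z hz => ?_
  by_contra h
  refine hz ⟨(z.1, z.1 - z.2), ⟨subset_tsupport a ?_, subset_tsupport k ?_⟩, by simp⟩
  · exact left_ne_zero_of_mul h
  · exact right_ne_zero_of_mul h

theorem locallyIntegrable_comp_fst {A : E → ℝ} (hA : Integrable A μ) :
    LocallyIntegrable (fun z : E × E => A z.1) (μ.prod μ) := by
  rw [locallyIntegrable_iff]
  intro K hK
  have h2 : IsCompact (Prod.snd '' K) := hK.image continuous_snd
  have hsub : K ⊆ univ ×ˢ (Prod.snd '' K) := fun z hz => ⟨trivial, mem_image_of_mem _ hz⟩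
  refine IntegrableOn.mono_set ?_ hsub
  have : IsFiniteMeasure (μ.restrict (Prod.snd '' K)) :=
    ⟨by simpa using h2.measure_lt_top⟩
  rw [IntegrableOn, ← Measure.prod_restrict, Measure.restrict_univ]
  exact hA.comp_fst _

theorem locallyIntegrable_comp_snd {A : E → ℝ} (hA : Integrable A μ) :
    LocallyIntegrable (fun z : E × E => A z.2) (μ.prod μ) := by
  rw [locallyIntegrable_iff]
  intro K hK
  have h2 : IsCompact (Prod.fst '' K) := hK.image continuous_fst
  have hsub : K ⊆ (Prod.fst '' K) ×ˢ univ := fun z hz => ⟨mem_image_of_mem _ hz, trivial⟩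
  refine IntegrableOn.mono_set ?_ hsub
  have : IsFiniteMeasure (μ.restrict (Prod.fst '' K)) :=
    ⟨by simpa using h2.measure_lt_top⟩
  rw [IntegrableOn, ← Measure.prod_restrict, Measure.restrict_univ]
  exact hA.comp_snd _

theorem integrable_mul_of_abs_le {g h : E × E → ℝ} (hg : Continuous g)
    (hgc : HasCompactSupport g) (hm : Measurable h) {A B : E → ℝ} (hA : Integrable A μ)
    (hB : Integrable B μ) (hle : ∀ z, |h z| ≤ A z.1 + B z.2) :
    Integrable (fun z => h z * g z) (μ.prod μ) := by
  have hl : LocallyIntegrable h (μ.prod μ) :=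
    ((locallyIntegrable_comp_fst hA).add (locallyIntegrable_comp_snd hB)).mono
      hm.aestronglyMeasurable
      (Eventually.of_forall fun z => (hle z).trans (le_abs_self _))
  refine (hl.integrable_smul_left_of_hasCompactSupport hg hgc).congr
    (Eventually.of_forall fun z => ?_)
  simp [mul_comm]

/-- A kernel supported where translations move `W` by at most `δ` in `L¹`, as a mollifier at a
small scale is, sees the increments of `W` only up to `δ` times its mass. -/
theorem lintegral_kernel_mul_enorm_sub_le {κ : E → ENNReal} (hκ : Measurable κ) {W : E → ℝ}
    (hW : Measurable W) {δ : ENNReal}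
    (h : ∀ w, κ w ≠ 0 → ∫⁻ p, ‖W (p - w) - W p‖ₑ ∂μ ≤ δ) :
    ∫⁻ z, κ (z.1 - z.2) * ‖W z.2 - W z.1‖ₑ ∂(μ.prod μ) ≤ δ * ∫⁻ w, κ w ∂μ := by
  have hm : Measurable fun z : E × E => κ (z.1 - z.2) * ‖W z.2 - W z.1‖ₑ := by fun_prop
  rw [lintegral_prod _ hm.aemeasurable]
  have h1 : ∀ p, ∫⁻ q, κ (p - q) * ‖W q - W p‖ₑ ∂μ = ∫⁻ w, κ w * ‖W (p - w) - W p‖ₑ ∂μ := by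
    intro p
    rw [← lintegral_sub_left_eq_self _ p]
    simp
  simp_rw [h1]
  rw [lintegral_lintegral_swap (by fun_prop), ← lintegral_const_mul _ hκ]
  refine lintegral_mono fun w => ?_
  rw [lintegral_const_mul _ (by fun_prop), mul_comm]
  by_cases hw : κ w = 0
  · simp [hw]
  · gcongr; exact h w hw

theorem lintegral_kernel_mul_fst {κ A : E → ENNReal} (hκ : Measurable κ) (hA : Measurable A) :
    ∫⁻ z, κ (z.1 - z.2) * A z.1 ∂(μ.prod μ) = (∫⁻ w, κ w ∂μ) * ∫⁻ p, A p ∂μ := by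
  have hm : Measurable fun z : E × E => κ (z.1 - z.2) * A z.1 := by fun_prop
  rw [lintegral_prod _ hm.aemeasurable, ← lintegral_const_mul _ hA]
  refine lintegral_congr fun p => ?_
  rw [← lintegral_sub_left_eq_self κ p]
  have hm' : Measurable fun q => κ (p - q) := hκ.comp (by fun_prop)
  exact lintegral_mul_const (A p) hm'

end product

/-- The pointwise error of the doubled inequality. Here `a` and `c` stand for the two solutions at
`p`, `d` for the second one at `q`, `R` and `D` for the mollifier and its `x`-derivative at
`p - q`, and `w` for the space component of `p - q`. -/
theorem doubling_error_le {C ft fx g f a c d R D w ε s b : ℝ} (h1 : |ft| ≤ C)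
    (h2 : |b * fx| ≤ C) (h3 : |fx| ≤ C) (h4 : |g| ≤ C) (h5 : |f| ≤ C) (ha : 0 ≤ a) (hc : 0 ≤ c)
    (hR : 0 ≤ R) (hε : 0 ≤ ε) (hε1 : ε ≤ 1) (hw1 : |w * R| ≤ ε * R)
    (hw2 : |w * D| ≤ ε * |D|) (hs : |s| ≤ 1) :
    ‖-((|a - d| - |a - c|) * R * (ft + b * fx) - (|a ^ 2 - d ^ 2| - |a ^ 2 - c ^ 2|) * R * fx
      + (|a - d| - |a - c|) * g * (D + R) + f * |a - d| * (w * D)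
      + 2 * f * (s * a) * (w * R))‖ ≤
    6 * C * ((R + |D|) * |d - c| + (R + |D|) * |d ^ 2 - c ^ 2| + ε * ((R + |D|) * (a + c))) := by
  have hC : 0 ≤ C := (abs_nonneg _).trans h1
  have hX : |(|a - d| - |a - c|)| ≤ |d - c| := by
    refine (abs_abs_sub_abs_le_abs_sub _ _).trans (le_of_eq ?_)
    rw [abs_sub_comm d c]; congr 1; ring
  have hY : |(|a ^ 2 - d ^ 2| - |a ^ 2 - c ^ 2|)| ≤ |d ^ 2 - c ^ 2| := by
    refine (abs_abs_sub_abs_le_abs_sub _ _).trans (le_of_eq ?_)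
    rw [abs_sub_comm (d ^ 2)]; congr 1; ring
  have hZ : |a - d| ≤ a + c + |d - c| := by
    rw [abs_le]
    have := abs_le.1 (le_refl |d - c|)
    constructor <;> linarith
  have hD := abs_nonneg D
  set X := |d - c|
  set Y := |d ^ 2 - c ^ 2|
  have hX0 : 0 ≤ X := abs_nonneg _
  have hY0 : 0 ≤ Y := abs_nonneg _
  have t1 : |(|a - d| - |a - c|) * R * (ft + b * fx)| ≤ X * R * (C + C) := by
    rw [abs_mul, abs_mul, abs_of_nonneg hR]
    gcongr
    exact (abs_add_le _ _).trans (add_le_add h1 h2)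
  have t2 : |(|a ^ 2 - d ^ 2| - |a ^ 2 - c ^ 2|) * R * fx| ≤ Y * R * C := by
    rw [abs_mul, abs_mul, abs_of_nonneg hR]
    gcongr
  have t3 : |(|a - d| - |a - c|) * g * (D + R)| ≤ X * C * (|D| + R) := by
    rw [abs_mul, abs_mul]
    gcongr
    exact (abs_add_le _ _).trans (by rw [abs_of_nonneg hR])
  have t4 : |f * |a - d| * (w * D)| ≤ C * (a + c + X) * (ε * |D|) := by
    rw [abs_mul, abs_mul, abs_abs]
    gcongr
  have t5 : |2 * f * (s * a) * (w * R)| ≤ 2 * C * (1 * a) * (ε * R) := by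
    rw [abs_mul, abs_mul, abs_mul, abs_mul, abs_of_nonneg ha, abs_two]
    gcongr
  have hεX : ε * (C * X * |D|) ≤ 1 * (C * X * |D|) := by gcongr
  have p1 : 0 ≤ C * X * R := by positivity
  have p2 : 0 ≤ C * X * |D| := by positivity
  have p3 : 0 ≤ C * Y * R := by positivity
  have p4 : 0 ≤ C * Y * |D| := by positivity
  have p5 : 0 ≤ C * ε * a * R := by positivity
  have p6 : 0 ≤ C * ε * a * |D| := by positivity
  have p7 : 0 ≤ C * ε * c * R := by positivity
  have p8 : 0 ≤ C * ε * c * |D| := by positivity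
  rw [norm_neg, Real.norm_eq_abs]
  refine (abs_add_le _ _).trans ?_
  refine (add_le_add_left (abs_add_le _ _) _).trans ?_
  refine (add_le_add_left (add_le_add_left (abs_add_le _ _) _) _).trans ?_
  refine (add_le_add_left (add_le_add_left (add_le_add_left (abs_sub _ _) _) _) _).trans ?_
  nlinarith

theorem HasCompactSupport.fun_neg {X : Type*} [TopologicalSpace X] {f : X → ℝ}
    (hf : HasCompactSupport f) : HasCompactSupport fun x => -f x :=
  hf.comp_left (g := fun y : ℝ => -y) neg_zero

/-- Nonnegative functions in `L¹ ∩ L²`. -/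
structure IsNonnegL1L2 (u : ℝ × ℝ → ℝ) : Prop where
  measurable : Measurable u
  nonneg : ∀ p, 0 ≤ u p
  integrable : Integrable u
  integrable_sq : Integrable fun p => u p ^ 2

section doubled
variable {u v φ ρ : ℝ × ℝ → ℝ}

/-- The Kruzkov integrand for `u` in the variable `p`, with the constant `v q`, sorted into products
of a nonlinear factor in `(u p, v q)` and a smooth one. -/
theorem kruzkovDensity_mul_sub_left (hu0 : ∀ p, 0 ≤ u p) (hv0 : ∀ p, 0 ≤ v p)
    (hφ : ContDiff ℝ ∞ φ) (hρ : ContDiff ℝ ∞ ρ) (p q : ℝ × ℝ) :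
    kruzkovDensity (u p) (v q) (fun p => φ p * ρ (p - q)) p =
      |u p - v q| * (dt φ p * ρ (p - q)) + |u p - v q| * (φ p * dt ρ (p - q))
      + |u p - v q| * ((drift p.2 * dx φ p) * ρ (p - q))
      + |u p - v q| * ((drift p.2 * φ p) * dx ρ (p - q))
      + |u p ^ 2 - v q ^ 2| * (-(dx φ p * ρ (p - q)))
      + |u p ^ 2 - v q ^ 2| * (-(φ p * dx ρ (p - q)))
      + Real.sign (u p - v q) * v q * (-(((2 - 2 * p.2) * φ p) * ρ (p - q))) := by
  rw [kruzkovDensity_eq (hu0 p) (hv0 q), dt, dx, (hasFDerivAt_mul_sub hφ hρ p q).fderiv]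
  simp only [dt, dx, add_apply, smul_apply, smul_eq_mul]
  ring

/-- The Kruzkov integrand for `v` in the variable `q`, with the constant `u p`, sorted in the same
way. The test function depends on `q` through `ρ (p - q)` only. -/
theorem kruzkovDensity_mul_sub_right (hu0 : ∀ p, 0 ≤ u p) (hv0 : ∀ p, 0 ≤ v p)
    (hρ : ContDiff ℝ ∞ ρ) (p q : ℝ × ℝ) :
    kruzkovDensity (v q) (u p) (fun q => φ p * ρ (p - q)) q =
      |u p - v q| * (-(φ p * dt ρ (p - q)))
      + |u p - v q| * (-((φ p * dx ρ (p - q)) * drift q.2))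
      + |u p ^ 2 - v q ^ 2| * (φ p * dx ρ (p - q))
      + Real.sign (u p - v q) * u p * ((φ p * ρ (p - q)) * (2 - 2 * q.2)) := by
  rw [kruzkovDensity_eq (hv0 q) (hu0 p), dt, dx, (hasFDerivAt_const_mul_sub hρ _ p q).fderiv,
    abs_sub_comm (v q), abs_sub_comm (v q ^ 2), ← neg_sub (u p) (v q), Real.sign_neg]
  simp only [dt, dx, neg_apply, smul_apply, smul_eq_mul]
  ring

theorem abs_abs_sub_le_add {a c : ℝ} (ha : 0 ≤ a) (hc : 0 ≤ c) : |(|a - c|)| ≤ a + c := by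
  rw [abs_abs, abs_le]; constructor <;> linarith

theorem abs_sign_mul_le (a c : ℝ) {d : ℝ} (hd : 0 ≤ d) : |Real.sign (a - c) * d| ≤ d := by
  rw [abs_mul, abs_of_nonneg hd]
  exact mul_le_of_le_one_left hd (abs_sign_le_one _)

section integrability
variable {g : (ℝ × ℝ) × ℝ × ℝ → ℝ}

theorem IsNonnegL1L2.integrable_abs_sub_mul (hu : IsNonnegL1L2 u) (hv : IsNonnegL1L2 v)
    (hg : Continuous g) (hgc : HasCompactSupport g) :
    Integrable fun z : (ℝ × ℝ) × ℝ × ℝ => |u z.1 - v z.2| * g z := by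
  have := hu.measurable
  have := hv.measurable
  exact integrable_mul_of_abs_le hg hgc (by fun_prop) hu.integrable hv.integrable
    fun z => abs_abs_sub_le_add (hu.nonneg _) (hv.nonneg _)

theorem IsNonnegL1L2.integrable_abs_sq_sub_mul (hu : IsNonnegL1L2 u) (hv : IsNonnegL1L2 v)
    (hg : Continuous g) (hgc : HasCompactSupport g) :
    Integrable fun z : (ℝ × ℝ) × ℝ × ℝ => |u z.1 ^ 2 - v z.2 ^ 2| * g z := by
  have := hu.measurable
  have := hv.measurable
  exact integrable_mul_of_abs_le hg hgc (by fun_prop) hu.integrable_sq hv.integrable_sq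
    fun z => abs_abs_sub_le_add (sq_nonneg _) (sq_nonneg _)

theorem IsNonnegL1L2.measurable_sign_sub (hu : IsNonnegL1L2 u) (hv : IsNonnegL1L2 v) :
    Measurable fun z : (ℝ × ℝ) × ℝ × ℝ => Real.sign (u z.1 - v z.2) := by
  have := hu.measurable
  have := hv.measurable
  exact measurable_real_sign.comp (by fun_prop)

theorem IsNonnegL1L2.integrable_sign_mul_snd_mul (hu : IsNonnegL1L2 u) (hv : IsNonnegL1L2 v)
    (hg : Continuous g) (hgc : HasCompactSupport g) :
    Integrable fun z : (ℝ × ℝ) × ℝ × ℝ => Real.sign (u z.1 - v z.2) * v z.2 * g z :=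
  integrable_mul_of_abs_le hg hgc
    ((hu.measurable_sign_sub hv).mul (hv.measurable.comp measurable_snd)) hu.integrable
    hv.integrable fun z => (abs_sign_mul_le _ _ (hv.nonneg _)).trans
      (le_add_of_nonneg_left (hu.nonneg z.1))

theorem IsNonnegL1L2.integrable_sign_mul_fst_mul (hu : IsNonnegL1L2 u) (hv : IsNonnegL1L2 v)
    (hg : Continuous g) (hgc : HasCompactSupport g) :
    Integrable fun z : (ℝ × ℝ) × ℝ × ℝ => Real.sign (u z.1 - v z.2) * u z.1 * g z :=
  integrable_mul_of_abs_le hg hgc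
    ((hu.measurable_sign_sub hv).mul (hu.measurable.comp measurable_fst)) hu.integrable
    hv.integrable fun z => (abs_sign_mul_le _ _ (hu.nonneg _)).trans
      (le_add_of_nonneg_right (hv.nonneg z.2))

theorem IsNonnegL1L2.integrable_abs_sub_fst_mul (hu : IsNonnegL1L2 u) (hv : IsNonnegL1L2 v)
    (hg : Continuous g) (hgc : HasCompactSupport g) :
    Integrable fun z : (ℝ × ℝ) × ℝ × ℝ => |u z.1 - v z.1| * g z := by
  have := hu.measurable
  have := hv.measurable
  exact integrable_mul_of_abs_le hg hgc (by fun_prop) (hu.integrable.add hv.integrable)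
    (integrable_zero _ _ _)
    fun z => by simpa using abs_abs_sub_le_add (hu.nonneg z.1) (hv.nonneg z.1)

theorem IsNonnegL1L2.integrable_abs_sq_sub_fst_mul (hu : IsNonnegL1L2 u) (hv : IsNonnegL1L2 v)
    (hg : Continuous g) (hgc : HasCompactSupport g) :
    Integrable fun z : (ℝ × ℝ) × ℝ × ℝ => |u z.1 ^ 2 - v z.1 ^ 2| * g z := by
  have := hu.measurable
  have := hv.measurable
  exact integrable_mul_of_abs_le hg hgc (by fun_prop) (hu.integrable_sq.add hv.integrable_sq)
    (integrable_zero _ _ _)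
    fun z => by simpa using abs_abs_sub_le_add (sq_nonneg (u z.1)) (sq_nonneg (v z.1))

end integrability

theorem integrable_kruzkovDensity_left (hu : IsNonnegL1L2 u) (hv : IsNonnegL1L2 v)
    (hφ : ContDiff ℝ ∞ φ) (hφc : HasCompactSupport φ) (hρ : ContDiff ℝ ∞ ρ)
    (hρc : HasCompactSupport ρ) : Integrable fun z : (ℝ × ℝ) × ℝ × ℝ =>
      kruzkovDensity (u z.1) (v z.2) (fun p => φ p * ρ (p - z.2)) z.1 := by
  have hφt := hφ.continuous_dt
  have hφx := hφ.continuous_dx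
  have hφ' := hφ.continuous
  have hdr := continuous_drift
  have hρt := hρ.continuous_dt
  have hρx := hρ.continuous_dx
  have hρ' := hρ.continuous
  have hdφ : HasCompactSupport fun p : ℝ × ℝ => drift p.2 * dx φ p := hφc.dx.mul_left
  have hdφ' : HasCompactSupport fun p : ℝ × ℝ => drift p.2 * φ p := hφc.mul_left
  have hxφ : HasCompactSupport fun p : ℝ × ℝ => (2 - 2 * p.2) * φ p := hφc.mul_left
  have t1 := hu.integrable_abs_sub_mul hv (by fun_prop)
    (hasCompactSupport_mul_comp_sub hφc.dt hρc)
  have t2 := hu.integrable_abs_sub_mul hv (by fun_prop)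
    (hasCompactSupport_mul_comp_sub hφc hρc.dt)
  have t3 := hu.integrable_abs_sub_mul hv (by fun_prop) (hasCompactSupport_mul_comp_sub hdφ hρc)
  have t4 := hu.integrable_abs_sub_mul hv (by fun_prop)
    (hasCompactSupport_mul_comp_sub hdφ' hρc.dx)
  have t5 := hu.integrable_abs_sq_sub_mul hv (by fun_prop)
    (HasCompactSupport.fun_neg (hasCompactSupport_mul_comp_sub hφc.dx hρc))
  have t6 := hu.integrable_abs_sq_sub_mul hv (by fun_prop)
    (HasCompactSupport.fun_neg (hasCompactSupport_mul_comp_sub hφc hρc.dx))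
  have t7 := hu.integrable_sign_mul_snd_mul hv (by fun_prop)
    (HasCompactSupport.fun_neg (hasCompactSupport_mul_comp_sub hxφ hρc))
  refine ((((((t1.add t2).add t3).add t4).add t5).add t6).add t7).congr
    (Eventually.of_forall fun z => ?_)
  exact (kruzkovDensity_mul_sub_left hu.nonneg hv.nonneg hφ hρ z.1 z.2).symm

theorem integrable_kruzkovDensity_right (hu : IsNonnegL1L2 u) (hv : IsNonnegL1L2 v)
    (hφ : ContDiff ℝ ∞ φ) (hφc : HasCompactSupport φ) (hρ : ContDiff ℝ ∞ ρ)
    (hρc : HasCompactSupport ρ) : Integrable fun z : (ℝ × ℝ) × ℝ × ℝ =>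
      kruzkovDensity (v z.2) (u z.1) (fun q => φ z.1 * ρ (z.1 - q)) z.2 := by
  have hφ' := hφ.continuous
  have hdr := continuous_drift
  have hρt := hρ.continuous_dt
  have hρx := hρ.continuous_dx
  have hρ' := hρ.continuous
  have t1 := hu.integrable_abs_sub_mul hv (by fun_prop)
    (HasCompactSupport.fun_neg (hasCompactSupport_mul_comp_sub hφc hρc.dt))
  have t2 := hu.integrable_abs_sub_mul hv (by fun_prop)
    (HasCompactSupport.fun_neg (HasCompactSupport.mul_right
      (f' := fun z : (ℝ × ℝ) × ℝ × ℝ => drift z.2.2) (hasCompactSupport_mul_comp_sub hφc hρc.dx)))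
  have t3 := hu.integrable_abs_sq_sub_mul hv (by fun_prop)
    (hasCompactSupport_mul_comp_sub hφc hρc.dx)
  have t4 := hu.integrable_sign_mul_fst_mul hv (by fun_prop)
    (HasCompactSupport.mul_right (f' := fun z : (ℝ × ℝ) × ℝ × ℝ => 2 - 2 * z.2.2)
      (hasCompactSupport_mul_comp_sub hφc hρc))
  refine (((t1.add t2).add t3).add t4).congr (Eventually.of_forall fun z => ?_)
  exact (kruzkovDensity_mul_sub_right hu.nonneg hv.nonneg hρ z.1 z.2).symm

/-- The doubled integrand with `v q` replaced by `v p`. The first summand yields the contraction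
inequality; the last factor of the second one is a kernel of mean zero. -/
theorem doubled_limit_eq (p q : ℝ × ℝ) : ρ (p - q) * contractionDensity (u p) (v p) φ p
      + φ p * |u p - v p| * (2 - 2 * p.2) * ((p - q).2 * dx ρ (p - q) + ρ (p - q)) =
    |u p - v p| * (dt φ p * ρ (p - q))
      + |u p - v p| * ((drift p.2 * dx φ p) * ρ (p - q))
      + |u p ^ 2 - v p ^ 2| * (-(dx φ p * ρ (p - q)))
      + |u p - v p| * (((2 - 2 * p.2) * φ p) * ((p - q).2 * dx ρ (p - q) + ρ (p - q))) := by
  rw [contractionDensity]; ring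

theorem integrable_doubled_limit (hu : IsNonnegL1L2 u) (hv : IsNonnegL1L2 v)
    (hφ : ContDiff ℝ ∞ φ) (hφc : HasCompactSupport φ) (hρ : ContDiff ℝ ∞ ρ)
    (hρc : HasCompactSupport ρ) : Integrable fun z : (ℝ × ℝ) × ℝ × ℝ =>
      ρ (z.1 - z.2) * contractionDensity (u z.1) (v z.1) φ z.1
      + φ z.1 * |u z.1 - v z.1| * (2 - 2 * z.1.2) *
        ((z.1 - z.2).2 * dx ρ (z.1 - z.2) + ρ (z.1 - z.2)) := by
  have hφt := hφ.continuous_dt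
  have hφx := hφ.continuous_dx
  have hφ' := hφ.continuous
  have hdr := continuous_drift
  have hρx := hρ.continuous_dx
  have hρ' := hρ.continuous
  have hdφ : HasCompactSupport fun p : ℝ × ℝ => drift p.2 * dx φ p := hφc.dx.mul_left
  have hxφ : HasCompactSupport fun p : ℝ × ℝ => (2 - 2 * p.2) * φ p := hφc.mul_left
  have hκc : HasCompactSupport fun w : ℝ × ℝ => w.2 * dx ρ w + ρ w := hρc.dx.mul_left.add hρc
  have t1 := hu.integrable_abs_sub_fst_mul hv (by fun_prop)
    (hasCompactSupport_mul_comp_sub hφc.dt hρc)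
  have t2 := hu.integrable_abs_sub_fst_mul hv (by fun_prop)
    (hasCompactSupport_mul_comp_sub hdφ hρc)
  have t3 := hu.integrable_abs_sq_sub_fst_mul hv (by fun_prop)
    (HasCompactSupport.fun_neg (hasCompactSupport_mul_comp_sub hφc.dx hρc))
  have t4 := hu.integrable_abs_sub_fst_mul hv (by fun_prop)
    (hasCompactSupport_mul_comp_sub hxφ hκc)
  refine (((t1.add t2).add t3).add t4).congr (Eventually.of_forall fun z => ?_)
  exact (doubled_limit_eq z.1 z.2).symm

end doubled

/-- The doubling of variables for globally square integrable functions. The test function is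
`φ p * ρ (p - q)` for a mollifier `ρ`; once the two Kruzkov inequalities are added, the terms
with `∂ₜρ` cancel and those with `∂ₓρ` combine with the mollifier into a kernel of mean zero. -/
theorem contraction_of_integrable {u v : ℝ × ℝ → ℝ} (hu : IsNonnegL1L2 u) (hv : IsNonnegL1L2 v)
    {S : Set (ℝ × ℝ)} (hKu : IsKruzkovOn S u) (hKv : IsKruzkovOn S v) {φ : ℝ × ℝ → ℝ}
    (hφ : ContDiff ℝ ∞ φ) (hφc : HasCompactSupport φ) (hφ0 : ∀ p, 0 ≤ φ p) {r : ℝ} (hr : 0 < r)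
    (hrS : Metric.cthickening r (tsupport φ) ⊆ S) :
    0 ≤ ∫ p, contractionDensity (u p) (v p) φ p := by
  obtain ⟨M, hM⟩ := exists_mollifier
  have hum := hu.measurable
  have hvm := hv.measurable
  have hu0 := hu.nonneg
  have hv0 := hv.nonneg
  have hφt := hφ.continuous_dt
  have hφx := hφ.continuous_dx
  have hφ' := hφ.continuous
  have hdr := continuous_drift
  -- A common bound for the coefficients built from `φ`.
  obtain ⟨C, hC0, hC1, hC2, hC3, hC4, hC5⟩ : ∃ C : ℝ, 0 ≤ C ∧ (∀ p, |dt φ p| ≤ C) ∧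
      (∀ p : ℝ × ℝ, |drift p.2 * dx φ p| ≤ C) ∧ (∀ p, |dx φ p| ≤ C) ∧
      (∀ p : ℝ × ℝ, |(2 - 2 * p.2) * φ p| ≤ C) ∧ (∀ p, |φ p| ≤ C) := by
    obtain ⟨c1, h1⟩ := hφc.dt.exists_bound_of_continuous hφt
    obtain ⟨c2, h2⟩ := (hφc.dx.mul_left (f := fun p : ℝ × ℝ => drift p.2)
      ).exists_bound_of_continuous (by fun_prop)
    obtain ⟨c3, h3⟩ := hφc.dx.exists_bound_of_continuous hφx
    obtain ⟨c4, h4⟩ := (hφc.mul_left (f := fun p : ℝ × ℝ => (2 - 2 * p.2))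
      ).exists_bound_of_continuous (by fun_prop)
    obtain ⟨c5, h5⟩ := hφc.exists_bound_of_continuous hφ'
    have n1 := (norm_nonneg _).trans (h1 0)
    have n2 := (norm_nonneg _).trans (h2 0)
    have n3 := (norm_nonneg _).trans (h3 0)
    have n4 := (norm_nonneg _).trans (h4 0)
    have n5 := (norm_nonneg _).trans (h5 0)
    refine ⟨c1 + c2 + c3 + c4 + c5, by positivity, fun p => (h1 p).trans ?_,
      fun p => (h2 p).trans ?_, fun p => (h3 p).trans ?_, fun p => (h4 p).trans ?_,
      fun p => (h5 p).trans ?_⟩ <;> linarith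
  set L : ℝ := ∫ p, contractionDensity (u p) (v p) φ p with hL
  set I : ENNReal := ∫⁻ p, ‖u p + v p‖ₑ with hI
  have hIfin : I ≠ ⊤ := (hu.integrable.add hv.integrable).2.ne
  -- The doubled inequality at scale `ε`.
  have main : ∀ ε : ℝ, 0 < ε → ε ≤ r → ε ≤ 1 → ∀ δ : ENNReal,
      (∀ w : ℝ × ℝ, ‖w‖ ≤ ε → ∫⁻ p, ‖v (p - w) - v p‖ₑ ≤ δ) →
      (∀ w : ℝ × ℝ, ‖w‖ ≤ ε → ∫⁻ p, ‖v (p - w) ^ 2 - v p ^ 2‖ₑ ≤ δ) →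
      ENNReal.ofReal (-L) ≤ ENNReal.ofReal (6 * C * (1 + M)) * (2 * δ + ENNReal.ofReal ε * I) := by
    intro ε hε hεr hε1 δ hδ1 hδ2
    obtain ⟨ρ, hρ, hρ0, hρs, hρ1, hρ2, hρM⟩ := hM ε hε
    have hρc : HasCompactSupport ρ :=
      (isCompact_closedBall (0 : ℝ × ℝ) ε).of_isClosed_subset (isClosed_tsupport ρ) hρs
    have hρt := hρ.continuous_dt
    have hρx := hρ.continuous_dx
    have hρ' := hρ.continuous
    have hvan : ∀ w : ℝ × ℝ, ε < ‖w‖ → ρ w = 0 ∧ dx ρ w = 0 := by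
      intro w hw
      have : w ∉ tsupport ρ := fun h => by
        have := hρs h
        rw [mem_closedBall_zero_iff] at this
        linarith
      exact ⟨image_eq_zero_of_notMem_tsupport this, dx_eq_zero this⟩
    have hJ1 := integrable_kruzkovDensity_left hu hv hφ hφc hρ hρc
    have hJ2 := integrable_kruzkovDensity_right hu hv hφ hφc hρ hρc
    have hJ0 := integrable_doubled_limit hu hv hφ hφc hρ hρc
    have hJ1nn : 0 ≤ ∫ z : (ℝ × ℝ) × ℝ × ℝ,
        kruzkovDensity (u z.1) (v z.2) (fun p => φ p * ρ (p - z.2)) z.1 := by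
      rw [Measure.volume_eq_prod, integral_prod_symm _ hJ1]
      refine integral_nonneg fun q => hKu (v q) (fun p => φ p * ρ (p - q)) ?_ ?_ ?_ ?_
      · exact hφ.mul (hρ.comp (contDiff_id.sub contDiff_const))
      · exact hφc.mul_right
      · exact (tsupport_mul_subset_left).trans ((Metric.self_subset_cthickening _).trans hrS)
      · exact fun p => mul_nonneg (hφ0 p) (hρ0 _)
    have hJ2nn : 0 ≤ ∫ z : (ℝ × ℝ) × ℝ × ℝ,
        kruzkovDensity (v z.2) (u z.1) (fun q => φ z.1 * ρ (z.1 - q)) z.2 := by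
      rw [Measure.volume_eq_prod, integral_prod _ hJ2]
      have hcs : ∀ p, tsupport (fun q => φ p * ρ (p - q)) ⊆
          Metric.cthickening r (tsupport φ) ∩ Metric.closedBall p ε := by
        intro p
        refine closure_minimal (fun q hq => ?_)
          (Metric.isClosed_cthickening.inter Metric.isClosed_closedBall)
        have h1 : p ∈ tsupport φ := subset_tsupport _ (left_ne_zero_of_mul hq)
        have h2 : ‖p - q‖ ≤ ε := by
          by_contra! h
          exact right_ne_zero_of_mul hq (hvan _ h).1
        refine ⟨Metric.mem_cthickening_of_dist_le q p r _ h1 ?_, ?_⟩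
        · rw [dist_comm, dist_eq_norm]; exact h2.trans hεr
        · rw [Metric.mem_closedBall, dist_comm, dist_eq_norm]; exact h2
      refine integral_nonneg fun p => hKv (u p) (fun q => φ p * ρ (p - q)) ?_ ?_ ?_ ?_
      · exact contDiff_const.mul (hρ.comp (contDiff_const.sub contDiff_id))
      · exact (isCompact_closedBall p ε).of_isClosed_subset (isClosed_tsupport _)
          fun q hq => (hcs p hq).2
      · exact fun q hq => hrS (hcs p hq).1
      · exact fun q => mul_nonneg (hφ0 p) (hρ0 _)
    have hρi : Integrable ρ := hρ'.integrable_of_hasCompactSupport hρc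
    have hρ2i : Integrable fun w : ℝ × ℝ => w.2 * dx ρ w :=
      (continuous_snd.mul hρx).integrable_of_hasCompactSupport hρc.dx.mul_left
    have hL0 : ∫ z : (ℝ × ℝ) × ℝ × ℝ, (ρ (z.1 - z.2) * contractionDensity (u z.1) (v z.1) φ z.1
        + φ z.1 * |u z.1 - v z.1| * (2 - 2 * z.1.2) *
          ((z.1 - z.2).2 * dx ρ (z.1 - z.2) + ρ (z.1 - z.2))) = L := by
      rw [Measure.volume_eq_prod, integral_prod _ hJ0]
      refine integral_congr_ae (Eventually.of_forall fun p => ?_)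
      have h1 : ∀ a b : ℝ, ∫ q, (ρ (p - q) * a + b * ((p - q).2 * dx ρ (p - q) + ρ (p - q)))
          = a := by
        intro a b
        have hs : Integrable fun w : ℝ × ℝ => w.2 * dx ρ w + ρ w := hρ2i.add hρi
        rw [integral_sub_left_eq_self
          (fun w : ℝ × ℝ => ρ w * a + b * (w.2 * dx ρ w + ρ w)) volume p,
          integral_add (hρi.mul_const a) (hs.const_mul b), integral_mul_const,
          integral_const_mul, integral_add hρ2i hρi, hρ1, hρ2]
        ring
      exact h1 (contractionDensity (u p) (v p) φ p) (φ p * |u p - v p| * (2 - 2 * p.2))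
    -- The pointwise error.
    set κ : ℝ × ℝ → ℝ := fun w => ρ w + |w.2 * dx ρ w| with hκ
    have hκ0 : ∀ w, 0 ≤ κ w := fun w => add_nonneg (hρ0 w) (abs_nonneg _)
    have hκm : Measurable κ := by fun_prop
    have herr : ∀ p q : ℝ × ℝ,
        ‖(ρ (p - q) * contractionDensity (u p) (v p) φ p
        + φ p * |u p - v p| * (2 - 2 * p.2) * ((p - q).2 * dx ρ (p - q) + ρ (p - q)))
        - (kruzkovDensity (u p) (v q) (fun p => φ p * ρ (p - q)) p
          + kruzkovDensity (v q) (u p) (fun q => φ p * ρ (p - q)) q)‖ ≤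
        6 * C * (κ (p - q) * |v q - v p| + κ (p - q) * |v q ^ 2 - v p ^ 2|
          + ε * (κ (p - q) * (u p + v p))) := by
      intro p q
      have hw1 : |(p - q).2 * ρ (p - q)| ≤ ε * ρ (p - q) := by
        rcases le_or_gt ‖p - q‖ ε with h | h
        · rw [abs_mul, abs_of_nonneg (hρ0 _)]
          exact mul_le_mul_of_nonneg_right ((norm_snd_le (p - q)).trans h) (hρ0 _)
        · simp [(hvan _ h).1]
      have hw2 : |(p - q).2 * ((p - q).2 * dx ρ (p - q))| ≤ ε * |(p - q).2 * dx ρ (p - q)| := by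
        rcases le_or_gt ‖p - q‖ ε with h | h
        · rw [abs_mul]
          exact mul_le_mul_of_nonneg_right ((norm_snd_le (p - q)).trans h) (abs_nonneg _)
        · simp [(hvan _ h).2]
      have hsum : (ρ (p - q) * contractionDensity (u p) (v p) φ p
          + φ p * |u p - v p| * (2 - 2 * p.2) * ((p - q).2 * dx ρ (p - q) + ρ (p - q)))
          - (kruzkovDensity (u p) (v q) (fun p => φ p * ρ (p - q)) p
          + kruzkovDensity (v q) (u p) (fun q => φ p * ρ (p - q)) q) =
          -((|u p - v q| - |u p - v p|) * ρ (p - q) * (dt φ p + drift p.2 * dx φ p)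
          - (|u p ^ 2 - v q ^ 2| - |u p ^ 2 - v p ^ 2|) * ρ (p - q) * dx φ p
          + (|u p - v q| - |u p - v p|) * ((2 - 2 * p.2) * φ p)
            * ((p - q).2 * dx ρ (p - q) + ρ (p - q))
          + φ p * |u p - v q| * ((p - q).2 * ((p - q).2 * dx ρ (p - q)))
          + 2 * φ p * (Real.sign (u p - v q) * u p) * ((p - q).2 * ρ (p - q))) := by
        have hx : q.2 = p.2 - (p - q).2 := by simp
        rw [doubled_limit_eq, kruzkovDensity_mul_sub_left hu0 hv0 hφ hρ,
          kruzkovDensity_mul_sub_right hu0 hv0 hρ, ← sign_mul_self_eq_abs (u p - v q), drift, drift, hx]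
        ring
      rw [hsum]
      exact doubling_error_le (hC1 p) (hC2 p) (hC3 p) (hC4 p) (hC5 p) (hu0 p) (hv0 p)
        (hρ0 _) hε.le hε1 hw1 hw2 (abs_sign_le_one _)
    -- Integration of the error.
    have hfin : ENNReal.ofReal (-L) ≤ ∫⁻ z : (ℝ × ℝ) × ℝ × ℝ, ENNReal.ofReal (6 * C) *
        (ENNReal.ofReal (κ (z.1 - z.2)) * ‖v z.2 - v z.1‖ₑ
          + ENNReal.ofReal (κ (z.1 - z.2)) * ‖v z.2 ^ 2 - v z.1 ^ 2‖ₑ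
          + ENNReal.ofReal ε * (ENNReal.ofReal (κ (z.1 - z.2)) * ‖u z.1 + v z.1‖ₑ)) := by
      have h1 : -L ≤ ‖∫ z : (ℝ × ℝ) × ℝ × ℝ,
          ((ρ (z.1 - z.2) * contractionDensity (u z.1) (v z.1) φ z.1
          + φ z.1 * |u z.1 - v z.1| * (2 - 2 * z.1.2) *
            ((z.1 - z.2).2 * dx ρ (z.1 - z.2) + ρ (z.1 - z.2)))
          - (kruzkovDensity (u z.1) (v z.2) (fun p => φ p * ρ (p - z.2)) z.1
          + kruzkovDensity (v z.2) (u z.1) (fun q => φ z.1 * ρ (z.1 - q)) z.2))‖ := by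
        have hJ12 : Integrable fun z : (ℝ × ℝ) × ℝ × ℝ =>
            kruzkovDensity (u z.1) (v z.2) (fun p => φ p * ρ (p - z.2)) z.1
            + kruzkovDensity (v z.2) (u z.1) (fun q => φ z.1 * ρ (z.1 - q)) z.2 := hJ1.add hJ2
        rw [integral_sub hJ0 hJ12, integral_add hJ1 hJ2, hL0, Real.norm_eq_abs]
        refine le_trans ?_ (neg_le_abs _)
        linarith
      refine (ENNReal.ofReal_le_ofReal h1).trans ?_
      rw [ofReal_norm]
      refine (enorm_integral_le_lintegral_enorm _).trans (lintegral_mono fun z => ?_)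
      rw [← ofReal_norm]
      refine (ENNReal.ofReal_le_ofReal (herr z.1 z.2)).trans (le_of_eq ?_)
      have hk := hκ0 (z.1 - z.2)
      have hs := add_nonneg (hu0 z.1) (hv0 z.1)
      rw [ENNReal.ofReal_mul (by positivity), ENNReal.ofReal_add (by positivity) (by positivity),
        ENNReal.ofReal_add (by positivity) (by positivity), ENNReal.ofReal_mul hk,
        ENNReal.ofReal_mul hk, ENNReal.ofReal_mul hε.le, ENNReal.ofReal_mul hk,
        ← Real.norm_eq_abs, ← Real.norm_eq_abs, ofReal_norm, ofReal_norm,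
        Real.enorm_of_nonneg hs]
    refine hfin.trans ?_
    have hK : ∫⁻ w, ENNReal.ofReal (κ w) ≤ ENNReal.ofReal (1 + M) := by
      have hκi : Integrable κ := hρi.add hρ2i.abs
      rw [← ofReal_integral_eq_lintegral_ofReal hκi (Eventually.of_forall hκ0)]
      refine ENNReal.ofReal_le_ofReal ?_
      rw [hκ, integral_add hρi hρ2i.abs, hρ1]
      linarith
    have hsupp : ∀ w, ENNReal.ofReal (κ w) ≠ 0 → ‖w‖ ≤ ε := by
      intro w hw
      by_contra! h
      exact hw (by simp [hκ, (hvan w h).1, (hvan w h).2])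
    have hκm' : Measurable fun w => ENNReal.ofReal (κ w) := by fun_prop
    have hM0 : 0 ≤ 1 + M := by
      have : 0 ≤ M := (integral_nonneg fun w => abs_nonneg _).trans hρM
      linarith
    have m1 : Measurable fun z : (ℝ × ℝ) × ℝ × ℝ =>
        ENNReal.ofReal (κ (z.1 - z.2)) * ‖v z.2 - v z.1‖ₑ := by fun_prop
    have m2 : Measurable fun z : (ℝ × ℝ) × ℝ × ℝ =>
        ENNReal.ofReal (κ (z.1 - z.2)) * ‖v z.2 ^ 2 - v z.1 ^ 2‖ₑ := by fun_prop
    have m3 : Measurable fun z : (ℝ × ℝ) × ℝ × ℝ =>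
        ENNReal.ofReal (κ (z.1 - z.2)) * ‖u z.1 + v z.1‖ₑ := by fun_prop
    have m12 : Measurable fun z : (ℝ × ℝ) × ℝ × ℝ =>
        ENNReal.ofReal (κ (z.1 - z.2)) * ‖v z.2 - v z.1‖ₑ
        + ENNReal.ofReal (κ (z.1 - z.2)) * ‖v z.2 ^ 2 - v z.1 ^ 2‖ₑ := m1.add m2
    rw [lintegral_const_mul' _ _ ENNReal.ofReal_ne_top, lintegral_add_left m12, lintegral_add_left m1, lintegral_const_mul _ m3,
      ENNReal.ofReal_mul (by positivity : 0 ≤ 6 * C), mul_assoc]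
    refine mul_le_mul_right ?_ _
    have k1 := lintegral_kernel_mul_enorm_sub_le (μ := (volume : Measure (ℝ × ℝ))) hκm' hvm
      (fun w hw => hδ1 w (hsupp w hw))
    have k2 := lintegral_kernel_mul_enorm_sub_le (μ := (volume : Measure (ℝ × ℝ))) hκm'
      (hvm.pow_const 2) (fun w hw => hδ2 w (hsupp w hw))
    have k3 := lintegral_kernel_mul_fst (μ := (volume : Measure (ℝ × ℝ))) hκm'
      (A := fun p => ‖u p + v p‖ₑ) (by fun_prop)
    refine (add_le_add (add_le_add k1 k2) (mul_le_mul_right k3.le _)).trans ?_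
    calc _ ≤ δ * ENNReal.ofReal (1 + M) + δ * ENNReal.ofReal (1 + M)
        + ENNReal.ofReal ε * (ENNReal.ofReal (1 + M) * I) := by gcongr
      _ = _ := by ring
  -- The scale `ε` tends to zero.
  have h1 := tendsto_lintegral_enorm_translate_sub volume hv.integrable
  have h2 := tendsto_lintegral_enorm_translate_sub volume hv.integrable_sq
  have hη : ∀ η : ℝ, 0 < η → ENNReal.ofReal (-L) ≤
      ENNReal.ofReal (6 * C * (1 + M)) * (2 + I) * ENNReal.ofReal η := by
    intro η hη
    have hη' : 0 < ENNReal.ofReal η := by simpa using hη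
    obtain ⟨r', hr', hball⟩ := Metric.eventually_nhds_iff.1
      ((ENNReal.tendsto_nhds_zero.1 h1 _ hη').and (ENNReal.tendsto_nhds_zero.1 h2 _ hη'))
    have hb : ∀ w : ℝ × ℝ, ‖w‖ ≤ min (min r 1) (min η (r' / 2)) → dist (-w) 0 < r' := by
      intro w hw
      rw [dist_zero_right, norm_neg]
      have : ‖w‖ ≤ r' / 2 := hw.trans ((min_le_right _ _).trans (min_le_right _ _))
      linarith
    refine (main (min (min r 1) (min η (r' / 2))) (by positivity)
      ((min_le_left _ _).trans (min_le_left _ _)) ((min_le_left _ _).trans (min_le_right _ _))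
      (ENNReal.ofReal η) (fun w hw => ?_) (fun w hw => ?_)).trans ?_
    · simpa [sub_eq_add_neg] using (hball (hb w hw)).1
    · simpa [sub_eq_add_neg] using (hball (hb w hw)).2
    · rw [mul_assoc (ENNReal.ofReal _), add_mul]
      refine mul_le_mul_right (add_le_add_right ?_ _) _
      rw [mul_comm]
      exact mul_le_mul_right (ENNReal.ofReal_le_ofReal
        ((min_le_right _ _).trans (min_le_left _ _))) _
  have hlim : Tendsto (fun η : ℝ => ENNReal.ofReal (6 * C * (1 + M)) * (2 + I) *
      ENNReal.ofReal η) (𝓝[>] 0) (𝓝 0) := by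
    have : Tendsto (fun η : ℝ => ENNReal.ofReal η) (𝓝[>] 0) (𝓝 0) := by
      simpa using (ENNReal.continuous_ofReal.tendsto 0).mono_left nhdsWithin_le_nhds
    simpa using ENNReal.Tendsto.const_mul this
      (Or.inr (ENNReal.mul_ne_top ENNReal.ofReal_ne_top (by simp [hIfin])))
  have := ge_of_tendsto hlim (eventually_nhdsWithin_of_forall hη)
  simpa using this

/-! ### The local contraction inequality and time translations -/

/-- The open quadrant `(0, ∞) × (0, ∞)` of the points `(t, x)`. -/
def quadrant : Set (ℝ × ℝ) := Ioi 0 ×ˢ Ioi 0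

theorem isOpen_quadrant : IsOpen quadrant := isOpen_Ioi.prod isOpen_Ioi

/-- Nonnegative functions, locally square integrable in the quadrant, that satisfy the
Kruzkov inequalities there. This notion is local and is stable under time translations. -/
structure IsKruzkovSolution (u : ℝ × ℝ → ℝ) : Prop where
  measurable : Measurable u
  nonneg : ∀ p, 0 ≤ u p
  integrableOn : ∀ K ⊆ quadrant, IsCompact K → IntegrableOn u K
  integrableOn_sq : ∀ K ⊆ quadrant, IsCompact K → IntegrableOn (fun p => u p ^ 2) K
  kruzkov : IsKruzkovOn quadrant u

theorem kruzkovDensity_eq_zero {a k : ℝ} {φ : ℝ × ℝ → ℝ} {p : ℝ × ℝ} (h : p ∉ tsupport φ) :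
    kruzkovDensity a k φ p = 0 := by
  simp [kruzkovDensity, dt_eq_zero h, dx_eq_zero h, image_eq_zero_of_notMem_tsupport h]

theorem contractionDensity_eq_zero {a c : ℝ} {φ : ℝ × ℝ → ℝ} {p : ℝ × ℝ} (h : p ∉ tsupport φ) :
    contractionDensity a c φ p = 0 := by
  simp [contractionDensity, dt_eq_zero h, dx_eq_zero h]

theorem IsKruzkovSolution.indicator_isNonnegL1L2 {u : ℝ × ℝ → ℝ} (hu : IsKruzkovSolution u)
    {K : Set (ℝ × ℝ)} (hK : IsCompact K) (hKq : K ⊆ quadrant) :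
    IsNonnegL1L2 (K.indicator u) where
  measurable := hu.measurable.indicator hK.measurableSet
  nonneg := fun p => indicator_nonneg (fun p _ => hu.nonneg p) p
  integrable := (hu.integrableOn K hKq hK).integrable_indicator hK.measurableSet
  integrable_sq := by
    refine ((hu.integrableOn_sq K hKq hK).integrable_indicator hK.measurableSet).congr
      (Eventually.of_forall fun p => ?_)
    by_cases hp : p ∈ K <;> simp [hp]

theorem IsKruzkovSolution.isKruzkovOn_indicator {u : ℝ × ℝ → ℝ} (hu : IsKruzkovSolution u)
    {K : Set (ℝ × ℝ)} (hKq : K ⊆ quadrant) : IsKruzkovOn K (K.indicator u) := by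
  intro k φ h1 h2 h3 h4
  refine (hu.kruzkov k φ h1 h2 (h3.trans hKq) h4).trans_eq
    (integral_congr_ae (Eventually.of_forall fun p => ?_))
  by_cases hp : p ∈ K
  · simp [hp]
  · simp only [kruzkovDensity_eq_zero fun h => hp (h3 h)]

/-- The local `L¹` contraction inequality between two nonnegative entropy solutions. -/
theorem IsKruzkovSolution.contraction {u v : ℝ × ℝ → ℝ} (hu : IsKruzkovSolution u)
    (hv : IsKruzkovSolution v) {φ : ℝ × ℝ → ℝ} (hφ : ContDiff ℝ ∞ φ) (hφc : HasCompactSupport φ)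
    (hφs : tsupport φ ⊆ quadrant) (hφ0 : ∀ p, 0 ≤ φ p) :
    0 ≤ ∫ p, contractionDensity (u p) (v p) φ p := by
  obtain ⟨r, hr, hrq⟩ := hφc.isCompact.exists_cthickening_subset_open isOpen_quadrant hφs
  have hK : IsCompact (Metric.cthickening r (tsupport φ)) := hφc.isCompact.cthickening
  refine (contraction_of_integrable (hu.indicator_isNonnegL1L2 hK hrq)
    (hv.indicator_isNonnegL1L2 hK hrq) (hu.isKruzkovOn_indicator hrq)
    (hv.isKruzkovOn_indicator hrq) hφ hφc hφ0 hr subset_rfl).trans_eq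
    (integral_congr_ae (Eventually.of_forall fun p => ?_))
  by_cases hp : p ∈ Metric.cthickening r (tsupport φ)
  · simp [hp]
  · simp only [contractionDensity_eq_zero fun h => hp (Metric.self_subset_cthickening _ h)]

theorem fderiv_comp_sub_const (φ : ℝ × ℝ → ℝ) (c p : ℝ × ℝ) :
    fderiv ℝ (fun p => φ (p - c)) p = fderiv ℝ φ (p - c) := fderiv_comp_sub c

theorem IsKruzkovSolution.translate {u : ℝ × ℝ → ℝ} (hu : IsKruzkovSolution u) {h : ℝ}
    (hh : 0 ≤ h) : IsKruzkovSolution fun p => u (p + (h, 0)) := by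
  have himg : ∀ K ⊆ quadrant, (fun p : ℝ × ℝ => p + (h, 0)) '' K ⊆ quadrant := by
    rintro K hK _ ⟨p, hp, rfl⟩
    have := hK hp
    simp only [quadrant, mem_prod, mem_Ioi, Prod.fst_add, Prod.snd_add] at this ⊢
    constructor <;> linarith [this.1, this.2]
  have hint : ∀ {f : ℝ × ℝ → ℝ} {K : Set (ℝ × ℝ)},
      IntegrableOn f ((fun p : ℝ × ℝ => p + (h, 0)) '' K) →
      IntegrableOn (fun p => f (p + (h, 0))) K := by
    intro f K hf
    exact ((measurePreserving_add_right volume ((h, 0) : ℝ × ℝ)).integrableOn_image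
      (measurableEmbedding_addRight _)).1 hf
  refine ⟨hu.measurable.comp (by fun_prop), fun p => hu.nonneg _, fun K hK hKc => ?_,
    fun K hK hKc => ?_, fun k φ h1 h2 h3 h4 => ?_⟩
  · exact hint (hu.integrableOn _ (himg K hK) (hKc.image (by fun_prop)))
  · exact hint (hu.integrableOn_sq _ (himg K hK) (hKc.image (by fun_prop)))
  · have hsupp : tsupport (fun p => φ (p - (h, 0))) ⊆
        (fun p : ℝ × ℝ => p + (h, 0)) '' tsupport φ := by
      refine closure_minimal (fun p hp => ⟨p - (h, 0), subset_tsupport _ hp, by simp⟩) ?_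
      exact (h2.isCompact.image (by fun_prop)).isClosed
    have := hu.kruzkov k (fun p => φ (p - (h, 0))) (h1.comp (contDiff_id.sub contDiff_const))
      ((h2.isCompact.image (by fun_prop : Continuous fun p : ℝ × ℝ => p + (h, 0))).of_isClosed_subset
        (isClosed_tsupport _) hsupp)
      (hsupp.trans (himg _ h3)) (fun p => h4 _)
    rw [← integral_add_right_eq_self _ ((h, 0) : ℝ × ℝ)] at this
    refine this.trans_eq (integral_congr_ae (Eventually.of_forall fun p => ?_))
    simp only [kruzkovDensity, dt, dx, fderiv_comp_sub_const, add_sub_cancel_right, Prod.snd_add,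
      add_zero]

/-! ### A measurable representative -/

/-- Entropy solutions, as measurable nonnegative functions on the plane that vanish outside the
quadrant. -/
structure IsSolution (u : ℝ × ℝ → ℝ) : Prop extends IsKruzkovSolution u where
  eq_zero : ∀ p ∉ quadrant, u p = 0
  integrable : ∀ T, IntegrableOn u (Ioo 0 T ×ˢ Ioi 0)
  weak : ∀ φ : ℝ × ℝ → ℝ, ContDiff ℝ ∞ φ → HasCompactSupport φ → tsupport φ ⊆ quadrant →
    ∫ p, (u p * dt φ p + flux p.2 (u p) * dx φ p) = 0
  flux_infinity : ∀ T, 0 < T →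
    Tendsto (fun R : ℝ => ∫⁻ t in Ioo 0 T, ‖flux R (u (t, R))‖ₑ) (atTop ⊓ ae volume) (𝓝 0)

theorem exists_Ioo_prod_of_isCompact {K : Set (ℝ × ℝ)} (hK : IsCompact K) (hKq : K ⊆ quadrant) :
    ∃ T : ℝ, 0 < T ∧ K ⊆ Ioo 0 T ×ˢ Ioi 0 := by
  obtain ⟨C, hC⟩ := hK.isBounded.exists_norm_le
  refine ⟨max C 0 + 1, by positivity, fun p hp => ?_⟩
  have h1 := hKq hp
  have h2 := (norm_fst_le p).trans (hC p hp)
  rw [Real.norm_eq_abs] at h2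
  exact ⟨⟨h1.1, by linarith [le_abs_self p.1, le_max_left C 0]⟩, h1.2⟩

theorem ae_fst_of_ae_quadrant {P : ℝ × ℝ → Prop} (h : ∀ᵐ p ∂(volume.restrict quadrant), P p) :
    ∀ᵐ t ∂(volume.restrict (Ioi (0 : ℝ))), ∀ᵐ x ∂(volume.restrict (Ioi (0 : ℝ))), P (t, x) := by
  rw [quadrant, Measure.volume_eq_prod, ← Measure.prod_restrict] at h
  exact Measure.ae_ae_of_ae_prod h

theorem ae_snd_of_ae_quadrant {P : ℝ × ℝ → Prop} (h : ∀ᵐ p ∂(volume.restrict quadrant), P p) :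
    ∀ᵐ x ∂(volume.restrict (Ioi (0 : ℝ))), ∀ᵐ t ∂(volume.restrict (Ioi (0 : ℝ))), P (t, x) := by
  rw [quadrant, Measure.volume_eq_prod, ← Measure.prod_restrict] at h
  have h' := (Measure.measurePreserving_swap (μ := volume.restrict (Ioi (0 : ℝ)))
    (ν := volume.restrict (Ioi (0 : ℝ)))).quasiMeasurePreserving.ae h
  exact Measure.ae_ae_of_ae_prod h'

/-- A nonnegative entropy solution agrees almost everywhere with a measurable function that is
nonnegative everywhere and zero outside the quadrant; the inequalities on the strips
`(0, T) × (0, ∞)` become one family on the quadrant. -/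
theorem IsEntropySolution.exists_isSolution {n : ℝ → ℝ → ℝ} (hn : IsEntropySolution n)
    (hn0 : ∀ᵐ p ∂(volume.restrict (Ioi (0 : ℝ) ×ˢ Ioi (0 : ℝ))), 0 ≤ n p.1 p.2) :
    ∃ u : ℝ × ℝ → ℝ, IsSolution u ∧ ∀ᵐ p ∂(volume.restrict quadrant), u p = n p.1 p.2 := by
  have hmeas : AEStronglyMeasurable (fun p : ℝ × ℝ => n p.1 p.2) (volume.restrict quadrant) := by
    have hU : quadrant = ⋃ j : ℕ, Ioo 0 ((j : ℝ) + 1) ×ˢ Ioi (0 : ℝ) := by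
      ext p
      simp only [quadrant, mem_prod, mem_Ioi, mem_iUnion, mem_Ioo]
      constructor
      · rintro ⟨h1, h2⟩
        obtain ⟨j, hj⟩ := exists_nat_gt p.1
        exact ⟨j, ⟨h1, by linarith⟩, h2⟩
      · rintro ⟨j, ⟨h1, -⟩, h2⟩
        exact ⟨h1, h2⟩
    rw [hU, aestronglyMeasurable_iUnion_iff]
    exact fun j => (hn ((j : ℝ) + 1) (by positivity)).integrable.1
  have hqm : MeasurableSet quadrant := isOpen_quadrant.measurableSet
  set u : ℝ × ℝ → ℝ := quadrant.indicator fun p => max (hmeas.mk _ p) 0 with hu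
  have hun : ∀ᵐ p ∂(volume.restrict quadrant), u p = n p.1 p.2 := by
    filter_upwards [hmeas.ae_eq_mk, hn0, ae_restrict_mem hqm] with p h1 h2 h3
    rw [hu, indicator_of_mem h3, ← h1, max_eq_left h2]
  have hum : Measurable u :=
    ((hmeas.stronglyMeasurable_mk.measurable).max measurable_const).indicator hqm
  have hsub : ∀ {s : Set (ℝ × ℝ)}, s ⊆ quadrant → ∀ᵐ p ∂(volume.restrict s), u p = n p.1 p.2 :=
    fun hs => ae_restrict_of_ae_restrict_of_subset hs hun
  have hTq : ∀ T : ℝ, Ioo 0 T ×ˢ Ioi 0 ⊆ quadrant :=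
    fun T => prod_mono (fun _ h => h.1) subset_rfl
  have hlocal : ∀ {φ : ℝ × ℝ → ℝ} {T : ℝ} {f : ℝ → ℝ × ℝ → ℝ}, tsupport φ ⊆ Ioo 0 T ×ˢ Ioi 0 →
      (∀ a, ∀ p ∉ tsupport φ, f a p = 0) →
      ∫ p in Ioo 0 T ×ˢ Ioi 0, f (n p.1 p.2) p = ∫ p, f (u p) p := by
    intro φ T f h1 h2
    have h3 : ∀ p ∉ Ioo 0 T ×ˢ Ioi 0, f (u p) p = 0 := fun p hp => h2 _ p fun h => hp (h1 h)
    rw [← setIntegral_eq_integral_of_forall_compl_eq_zero h3]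
    refine integral_congr_ae ?_
    filter_upwards [hsub (hTq T)] with p hp
    rw [hp]
  refine ⟨u, ⟨⟨hum, fun p => indicator_nonneg (fun _ _ => le_max_right _ _) p, ?_, ?_, ?_⟩,
    fun p hp => indicator_of_notMem hp _, ?_, ?_, ?_⟩, hun⟩
  · intro K hKq hK
    obtain ⟨T, hT, hKT⟩ := exists_Ioo_prod_of_isCompact hK hKq
    refine ((hn T hT).integrable.mono_set hKT).congr ?_
    filter_upwards [hsub hKq] with p hp using hp.symm
  · intro K hKq hK
    obtain ⟨T, hT, hKT⟩ := exists_Ioo_prod_of_isCompact hK hKq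
    refine ((hn T hT).sq_locallyIntegrable.integrableOn_compact_subset hKT hK).congr ?_
    filter_upwards [hsub hKq] with p hp
    rw [hp]
  · intro k φ h1 h2 h3 h4
    obtain ⟨T, hT, hKT⟩ := exists_Ioo_prod_of_isCompact h2.isCompact h3
    have := (hn T hT).entropy k φ ⟨h1, h2, hKT⟩ h4
    exact this.trans_eq (hlocal (f := fun a p => kruzkovDensity a k φ p) hKT
      fun a p hp => kruzkovDensity_eq_zero hp)
  · intro T
    rcases le_or_gt T 0 with hT | hT
    · simp [Ioo_eq_empty (not_lt.2 hT)]
    refine (hn T hT).integrable.congr ?_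
    filter_upwards [hsub (hTq T)] with p hp using hp.symm
  · intro φ h1 h2 h3
    obtain ⟨T, hT, hKT⟩ := exists_Ioo_prod_of_isCompact h2.isCompact h3
    have := (hn T hT).weak φ ⟨h1, h2, hKT⟩
    rwa [hlocal (f := fun a p => a * dt φ p + flux p.2 a * dx φ p) hKT
      fun a p hp => by simp [dt_eq_zero hp, dx_eq_zero hp]] at this
  · intro T hT
    refine (hn T hT).flux_infinity.congr' ?_
    have h1 : ∀ᶠ R : ℝ in atTop ⊓ ae volume, 0 < R :=
      Filter.Eventually.filter_mono inf_le_left (eventually_gt_atTop 0)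
    have h2 : ∀ᶠ R : ℝ in atTop ⊓ ae volume, R ∈ Ioi (0 : ℝ) →
        ∀ᵐ t ∂(volume.restrict (Ioi (0 : ℝ))), u (t, R) = n t R :=
      Filter.Eventually.filter_mono inf_le_right
        ((ae_restrict_iff' measurableSet_Ioi).1 (ae_snd_of_ae_quadrant hun))
    filter_upwards [h1, h2] with R hR hR2
    refine lintegral_congr_ae ?_
    filter_upwards [ae_restrict_of_ae_restrict_of_subset Ioo_subset_Ioi_self (hR2 hR)] with t ht
    rw [ht]

/-! ### Distributional inequalities in one variable -/

/-- Test functions of one variable, supported in `(0, ∞)`. -/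
structure IsTest (α : ℝ → ℝ) : Prop where
  contDiff : ContDiff ℝ ∞ α
  compact : HasCompactSupport α
  pos : tsupport α ⊆ Ioi 0

theorem support_deriv_smoothTransition_subset :
    Function.support (deriv Real.smoothTransition) ⊆ Icc 0 1 := by
  intro x hx
  by_contra h
  refine hx ?_
  rw [mem_Icc, not_and_or, not_le, not_le] at h
  rcases h with h | h
  · have : Real.smoothTransition =ᶠ[𝓝 x] fun _ => 0 := by
      filter_upwards [Iio_mem_nhds h] with y hy
      exact Real.smoothTransition.zero_of_nonpos (le_of_lt hy)
    rw [this.deriv_eq]; simp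
  · have : Real.smoothTransition =ᶠ[𝓝 x] fun _ => 1 := by
      filter_upwards [Ioi_mem_nhds h] with y hy
      exact Real.smoothTransition.one_of_one_le (le_of_lt hy)
    rw [this.deriv_eq]; simp

theorem contDiff_smoothTransition : ContDiff ℝ ∞ Real.smoothTransition :=
  Real.smoothTransition.contDiff

theorem continuous_deriv_smoothTransition : Continuous (deriv Real.smoothTransition) :=
  contDiff_smoothTransition.continuous_deriv (by simp)

theorem exists_bound_deriv_smoothTransition :
    ∃ M : ℝ, 0 ≤ M ∧ ∀ x, |deriv Real.smoothTransition x| ≤ M := by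
  obtain ⟨M, hM⟩ := (HasCompactSupport.of_support_subset_isCompact isCompact_Icc
    support_deriv_smoothTransition_subset).exists_bound_of_continuous
    continuous_deriv_smoothTransition
  exact ⟨M, (norm_nonneg _).trans (hM 0), hM⟩

theorem deriv_smoothTransition_comp (s ε x : ℝ) :
    HasDerivAt (fun x => Real.smoothTransition ((x - s) / ε))
      (ε⁻¹ * deriv Real.smoothTransition ((x - s) / ε)) x := by
  have h1 : HasDerivAt Real.smoothTransition (deriv Real.smoothTransition ((x - s) / ε))
      ((x - s) / ε) := (contDiff_smoothTransition.differentiable (by simp) _).hasDerivAt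
  have h2 : HasDerivAt (fun x => (x - s) / ε) (1 / ε) x :=
    ((hasDerivAt_id x).sub_const s).div_const ε
  refine (h1.comp x h2).congr_deriv ?_
  rw [one_div, mul_comm]

theorem support_deriv_smoothTransition_comp_subset {s ε : ℝ} (hε : 0 < ε) :
    (Function.support fun x => ε⁻¹ * deriv Real.smoothTransition ((x - s) / ε)) ⊆
      Icc s (s + ε) := by
  intro x hx
  have := support_deriv_smoothTransition_subset (right_ne_zero_of_mul hx)
  rw [mem_Icc, le_div_iff₀ hε, div_le_iff₀ hε] at this
  constructor <;> linarith [this.1, this.2]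

theorem integral_deriv_smoothTransition_comp {s ε : ℝ} (hε : 0 < ε) :
    ∫ x in Icc s (s + ε), ε⁻¹ * deriv Real.smoothTransition ((x - s) / ε) = 1 := by
  have hc := continuous_deriv_smoothTransition
  rw [integral_Icc_eq_integral_Ioc, ← intervalIntegral.integral_of_le (by linarith),
    intervalIntegral.integral_eq_sub_of_hasDerivAt (fun x _ => deriv_smoothTransition_comp s ε x)
      ((by fun_prop : Continuous fun x =>
        ε⁻¹ * deriv Real.smoothTransition ((x - s) / ε)).intervalIntegrable _ _)]
  rw [sub_self, zero_div, add_sub_cancel_left, div_self hε.ne', Real.smoothTransition.one,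
    Real.smoothTransition.zero, sub_zero]

/-- One-sided mollification converges at the right Lebesgue points. -/
theorem tendsto_integral_mul_deriv_smoothTransition {g : ℝ → ℝ} (hg : Integrable g) {s : ℝ}
    (hs : Tendsto (fun y => ⨍ z in Icc s y, ‖g z - g s‖) (𝓝[>] s) (𝓝 0)) :
    Tendsto (fun ε => ∫ x, g x * (ε⁻¹ * deriv Real.smoothTransition ((x - s) / ε)))
      (𝓝[>] 0) (𝓝 (g s)) := by
  obtain ⟨M, hM0, hM⟩ := exists_bound_deriv_smoothTransition
  have hc := continuous_deriv_smoothTransition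
  have hs' : Tendsto (fun ε : ℝ => ⨍ z in Icc s (s + ε), ‖g z - g s‖) (𝓝[>] 0) (𝓝 0) := by
    refine hs.comp (tendsto_nhdsWithin_iff.2 ⟨?_, ?_⟩)
    · have : Tendsto (fun ε : ℝ => s + ε) (𝓝 0) (𝓝 (s + 0)) :=
        (continuous_const.add continuous_id).tendsto 0
      rw [add_zero] at this
      exact this.mono_left nhdsWithin_le_nhds
    · filter_upwards [self_mem_nhdsWithin] with ε hε
      rw [mem_Ioi] at hε ⊢; linarith
  rw [tendsto_iff_norm_sub_tendsto_zero]
  refine squeeze_zero' (Eventually.of_forall fun _ => norm_nonneg _) ?_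
    (by simpa using hs'.const_mul M)
  filter_upwards [self_mem_nhdsWithin] with ε hε
  rw [mem_Ioi] at hε
  set K : ℝ → ℝ := fun x => ε⁻¹ * deriv Real.smoothTransition ((x - s) / ε) with hK
  have hKc : Continuous K := by fun_prop
  have hsupp : Function.support K ⊆ Icc s (s + ε) :=
    support_deriv_smoothTransition_comp_subset hε
  have hKb : ∀ x, ‖K x‖ ≤ ε⁻¹ * M := fun x => by
    rw [hK, Real.norm_eq_abs, abs_mul, abs_of_pos (inv_pos.2 hε)]
    exact mul_le_mul_of_nonneg_left (hM _) (inv_pos.2 hε).le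
  have e1 : ∫ x, g x * K x = ∫ x in Icc s (s + ε), g x * K x := by
    refine (setIntegral_eq_integral_of_forall_compl_eq_zero fun x hx => ?_).symm
    rw [Function.notMem_support.1 fun h => hx (hsupp h), mul_zero]
  have hgK : IntegrableOn (fun x => g x * K x) (Icc s (s + ε)) :=
    (hg.mul_bdd hKc.aestronglyMeasurable (Eventually.of_forall hKb)).integrableOn
  have e2 : g s = ∫ x in Icc s (s + ε), g s * K x := by
    rw [integral_const_mul, integral_deriv_smoothTransition_comp hε, mul_one]
  have hsK : IntegrableOn (fun x => g s * K x) (Icc s (s + ε)) :=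
    (continuous_const.mul hKc).integrableOn_Icc
  have hgs : IntegrableOn (fun x => ‖g x - g s‖) (Icc s (s + ε)) :=
    (hg.integrableOn.sub (integrableOn_const (by simp))).norm
  rw [e1]
  conv_lhs => rw [e2]
  rw [← integral_sub hgK hsK]
  calc ‖∫ x in Icc s (s + ε), (g x * K x - g s * K x)‖
      ≤ ∫ x in Icc s (s + ε), ε⁻¹ * M * ‖g x - g s‖ := by
        refine norm_integral_le_of_norm_le (hgs.const_mul _) (Eventually.of_forall fun x => ?_)
        rw [← sub_mul, norm_mul, mul_comm]
        exact mul_le_mul_of_nonneg_right (hKb x) (norm_nonneg _)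
    _ = M * ⨍ z in Icc s (s + ε), ‖g z - g s‖ := by
        rw [integral_const_mul, setAverage_eq]
        simp only [measureReal_def, Real.volume_Icc, add_sub_cancel_left, smul_eq_mul,
          ENNReal.toReal_ofReal hε.le]
        ring

/-- The smooth approximation of the indicator function of `(s, t]`. -/
noncomputable def smoothStep (s t ε x : ℝ) : ℝ :=
  Real.smoothTransition ((x - s) / ε) - Real.smoothTransition ((x - t) / ε)

section smoothStep
variable {s t ε : ℝ}

theorem contDiff_smoothStep : ContDiff ℝ ∞ (smoothStep s t ε) := by
  have h : ∀ s : ℝ, ContDiff ℝ ∞ fun x : ℝ => Real.smoothTransition ((x - s) / ε) := fun s =>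
    contDiff_smoothTransition.comp ((contDiff_id.sub contDiff_const).div_const ε)
  exact (h s).sub (h t)

theorem smoothStep_nonneg (hst : s ≤ t) (hε : 0 < ε) (x : ℝ) : 0 ≤ smoothStep s t ε x := by
  refine sub_nonneg.2 (Real.smoothTransition.monotone ?_)
  gcongr

theorem smoothStep_le_one (x : ℝ) : smoothStep s t ε x ≤ 1 := by
  have h1 := Real.smoothTransition.le_one ((x - s) / ε)
  have h2 := Real.smoothTransition.nonneg ((x - t) / ε)
  rw [smoothStep]; linarith

theorem smoothStep_eq_zero (hst : s ≤ t) (hε : 0 < ε) {x : ℝ} (hx : x ∉ Icc s (t + ε)) :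
    smoothStep s t ε x = 0 := by
  rw [mem_Icc, not_and_or, not_le, not_le] at hx
  rcases hx with h | h
  · rw [smoothStep, Real.smoothTransition.zero_of_nonpos (div_nonpos_of_nonpos_of_nonneg
      (by linarith) hε.le), Real.smoothTransition.zero_of_nonpos
      (div_nonpos_of_nonpos_of_nonneg (by linarith) hε.le), sub_zero]
  · rw [smoothStep, Real.smoothTransition.one_of_one_le ((one_le_div hε).2 (by linarith)),
      Real.smoothTransition.one_of_one_le ((one_le_div hε).2 (by linarith)), sub_self]

theorem tsupport_smoothStep_subset (hst : s ≤ t) (hε : 0 < ε) :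
    tsupport (smoothStep s t ε) ⊆ Icc s (t + ε) :=
  closure_minimal (fun _ hx => by_contra fun h => hx (smoothStep_eq_zero hst hε h)) isClosed_Icc

theorem hasCompactSupport_smoothStep (hst : s ≤ t) (hε : 0 < ε) :
    HasCompactSupport (smoothStep s t ε) :=
  isCompact_Icc.of_isClosed_subset (isClosed_tsupport _) (tsupport_smoothStep_subset hst hε)

theorem deriv_smoothStep (x : ℝ) : deriv (smoothStep s t ε) x =
    ε⁻¹ * deriv Real.smoothTransition ((x - s) / ε)
      - ε⁻¹ * deriv Real.smoothTransition ((x - t) / ε) :=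
  ((deriv_smoothTransition_comp s ε x).sub (deriv_smoothTransition_comp t ε x)).deriv

theorem isTest_smoothStep (hs : 0 < s) (hst : s ≤ t) (hε : 0 < ε) : IsTest (smoothStep s t ε) :=
  ⟨contDiff_smoothStep, hasCompactSupport_smoothStep hst hε,
    (tsupport_smoothStep_subset hst hε).trans fun _ hx => hs.trans_le hx.1⟩

theorem tendsto_smoothTransition_div (s x : ℝ) :
    Tendsto (fun ε => Real.smoothTransition ((x - s) / ε)) (𝓝[>] 0)
      (𝓝 ((Ioi s).indicator 1 x)) := by
  rcases le_or_gt x s with h | h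
  · rw [indicator_of_notMem (by simpa using h)]
    refine tendsto_const_nhds.congr' ?_
    filter_upwards [self_mem_nhdsWithin] with ε hε
    exact (Real.smoothTransition.zero_of_nonpos (div_nonpos_of_nonpos_of_nonneg
      (by linarith) (le_of_lt hε))).symm
  · rw [indicator_of_mem (by simpa using h)]
    refine tendsto_const_nhds.congr' ?_
    filter_upwards [Ioo_mem_nhdsGT (show (0 : ℝ) < x - s by linarith)] with ε hε
    exact (Real.smoothTransition.one_of_one_le ((one_le_div hε.1).2 hε.2.le)).symm

theorem tendsto_smoothStep (hst : s ≤ t) (x : ℝ) :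
    Tendsto (fun ε => smoothStep s t ε x) (𝓝[>] 0) (𝓝 ((Ioc s t).indicator 1 x)) := by
  have h := (tendsto_smoothTransition_div s x).sub (tendsto_smoothTransition_div t x)
  convert! h using 2
  by_cases h1 : s < x <;> by_cases h2 : t < x <;> simp [indicator, h1, h2, not_lt.1]
  exact absurd (hst.trans_lt h2) h1

theorem tendsto_integral_mul_smoothStep {k : ℝ → ℝ} (hk : Integrable k) (hst : s ≤ t) :
    Tendsto (fun ε => ∫ x, k x * smoothStep s t ε x) (𝓝[>] 0) (𝓝 (∫ x in s..t, k x)) := by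
  have e : ∫ x in s..t, k x = ∫ x, k x * (Ioc s t).indicator 1 x := by
    rw [intervalIntegral.integral_of_le hst, ← integral_indicator measurableSet_Ioc]
    refine integral_congr_ae (Eventually.of_forall fun x => ?_)
    by_cases hx : x ∈ Ioc s t <;> simp [hx]
  rw [e]
  refine tendsto_integral_filter_of_dominated_convergence (fun x => ‖k x‖) ?_ ?_ hk.norm ?_
  · exact Eventually.of_forall fun ε =>
      hk.1.mul contDiff_smoothStep.continuous.aestronglyMeasurable
  · filter_upwards [self_mem_nhdsWithin] with ε hε
    refine Eventually.of_forall fun x => ?_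
    rw [norm_mul, Real.norm_eq_abs (smoothStep _ _ _ _),
      abs_of_nonneg (smoothStep_nonneg hst hε x)]
    exact mul_le_of_le_one_right (norm_nonneg _) (smoothStep_le_one x)
  · exact Eventually.of_forall fun x => (tendsto_smoothStep hst x).const_mul (k x)

end smoothStep

theorem ae_tendsto_right_average {g : ℝ → ℝ} (hg : Integrable g) :
    ∀ᵐ s, Tendsto (fun y => ⨍ z in Icc s y, ‖g z - g s‖) (𝓝[>] s) (𝓝 0) := by
  filter_upwards [(IsUnifLocDoublingMeasure.vitaliFamily volume 1).ae_tendsto_average_norm_sub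
    hg.locallyIntegrable] with s hs
  exact hs.comp (Real.tendsto_Icc_vitaliFamily_right s)

/-- A distributional inequality `g' ≤ k` on `(0, ∞)` holds in integrated form between any two
points of a set of full measure. -/
theorem exists_ae_le_of_forall_test {g k : ℝ → ℝ}
    (hg : ∀ a b, 0 < a → IntegrableOn g (Icc a b)) (hk : ∀ a b, 0 < a → IntegrableOn k (Icc a b))
    (h : ∀ α : ℝ → ℝ, IsTest α → (∀ t, 0 ≤ α t) → 0 ≤ ∫ t, (g t * deriv α t + k t * α t)) :
    ∃ S : Set ℝ, (∀ᵐ s, s ∈ S) ∧ ∀ s ∈ S, ∀ t ∈ S, 0 < s → s < t →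
      g t ≤ g s + ∫ r in s..t, k r := by
  have hbase : ∀ j : ℕ, 0 < ((j : ℝ) + 1)⁻¹ := fun j => by positivity
  set I : ℕ → Set ℝ := fun j => Icc ((j : ℝ) + 1)⁻¹ (j : ℝ) with hI
  set gg : ℕ → ℝ → ℝ := fun j => (I j).indicator g with hgg
  have hgi : ∀ j, Integrable (gg j) := fun j =>
    (hg _ _ (hbase j)).integrable_indicator measurableSet_Icc
  have hki : ∀ j, Integrable ((I j).indicator k) := fun j =>
    (hk _ _ (hbase j)).integrable_indicator measurableSet_Icc
  refine ⟨{s | ∀ j, Tendsto (fun y => ⨍ z in Icc s y, ‖gg j z - gg j s‖) (𝓝[>] s) (𝓝 0)},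
    ae_all_iff.2 fun j => ae_tendsto_right_average (hgi j), fun s hs t ht hs0 hst => ?_⟩
  obtain ⟨j1, hj1⟩ := exists_nat_gt s⁻¹
  obtain ⟨j2, hj2⟩ := exists_nat_gt (t + 1)
  set j := max j1 j2
  have hjs : ((j : ℝ) + 1)⁻¹ < s := by
    rw [inv_lt_comm₀ (by positivity) hs0]
    have : (j1 : ℝ) ≤ j := by exact_mod_cast le_max_left _ _
    linarith
  have hjt : t + 1 < j := by
    have : (j2 : ℝ) ≤ j := by exact_mod_cast le_max_right _ _
    linarith
  have hsI : s ∈ I j := mem_Icc.2 ⟨hjs.le, by linarith⟩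
  have htI : t ∈ I j := mem_Icc.2 ⟨by linarith, by linarith⟩
  have l1 := tendsto_integral_mul_deriv_smoothTransition (hgi j) (hs j)
  have l2 := tendsto_integral_mul_deriv_smoothTransition (hgi j) (ht j)
  have l3 := tendsto_integral_mul_smoothStep (hki j) hst.le
  have e1 : gg j s = g s := indicator_of_mem hsI _
  have e2 : gg j t = g t := indicator_of_mem htI _
  have e3 : ∫ x in s..t, (I j).indicator k x = ∫ x in s..t, k x := by
    refine intervalIntegral.integral_congr fun x hx => ?_
    rw [uIcc_of_le hst.le] at hx
    exact indicator_of_mem (mem_Icc.2 ⟨hsI.1.trans hx.1, hx.2.trans htI.2⟩) _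
  rw [e1] at l1
  rw [e2] at l2
  rw [e3] at l3
  have key := (l1.sub l2).add l3
  have : 0 ≤ g s - g t + ∫ r in s..t, k r := by
    refine ge_of_tendsto key ?_
    filter_upwards [Ioo_mem_nhdsGT (zero_lt_one' ℝ)] with ε hε
    have := h _ (isTest_smoothStep hs0 hst.le hε.1) (smoothStep_nonneg hst.le hε.1)
    refine this.trans_eq ?_
    have hc := continuous_deriv_smoothTransition
    obtain ⟨M, hM0, hM⟩ := exists_bound_deriv_smoothTransition
    have hKi : ∀ s : ℝ, Integrable fun x =>
        gg j x * (ε⁻¹ * deriv Real.smoothTransition ((x - s) / ε)) := fun s =>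
      (hgi j).mul_bdd (c := ε⁻¹ * M) (by fun_prop) (Eventually.of_forall fun x => by
        rw [Real.norm_eq_abs, abs_mul, abs_of_pos (inv_pos.2 hε.1)]
        exact mul_le_mul_of_nonneg_left (hM _) (inv_pos.2 hε.1).le)
    have hk' : Integrable fun x => (I j).indicator k x * smoothStep s t ε x :=
      (hki j).mul_bdd (c := 1) contDiff_smoothStep.continuous.aestronglyMeasurable
        (Eventually.of_forall fun x => by
          rw [Real.norm_eq_abs, abs_of_nonneg (smoothStep_nonneg hst.le hε.1 x)]
          exact smoothStep_le_one x)
    have hKst : Integrable fun x => gg j x * (ε⁻¹ * deriv Real.smoothTransition ((x - s) / ε))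
        - gg j x * (ε⁻¹ * deriv Real.smoothTransition ((x - t) / ε)) := (hKi s).sub (hKi t)
    rw [← integral_sub (hKi s) (hKi t), ← integral_add hKst hk']
    refine integral_congr_ae (Eventually.of_forall fun x => ?_)
    dsimp only
    rw [← mul_sub, ← deriv_smoothStep]
    by_cases hx : x ∈ I j
    · rw [hgg]; simp only [indicator_of_mem hx]
    · have hx' : x ∉ tsupport (smoothStep s t ε) := fun h' => by
        have := tsupport_smoothStep_subset hst.le hε.1 h'
        exact hx ⟨hjs.le.trans this.1, by linarith [this.2, hε.2]⟩
      have hd : deriv (smoothStep s t ε) x = 0 :=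
        image_eq_zero_of_notMem_tsupport fun h' => hx' (tsupport_deriv_subset h')
      rw [hd, image_eq_zero_of_notMem_tsupport hx']
      simp
  linarith

/-- A distributional identity `g' = k` on `(0, ∞)` holds in integrated form between any two points
of a set of full measure. -/
theorem exists_ae_eq_of_forall_test {g k : ℝ → ℝ}
    (hg : ∀ a b, 0 < a → IntegrableOn g (Icc a b)) (hk : ∀ a b, 0 < a → IntegrableOn k (Icc a b))
    (h : ∀ α : ℝ → ℝ, IsTest α → ∫ t, (g t * deriv α t + k t * α t) = 0) :
    ∃ S : Set ℝ, (∀ᵐ s, s ∈ S) ∧ ∀ s ∈ S, ∀ t ∈ S, 0 < s → s < t →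
      g t = g s + ∫ r in s..t, k r := by
  obtain ⟨S, hS, h1⟩ := exists_ae_le_of_forall_test hg hk fun α hα _ => (h α hα).ge
  obtain ⟨S', hS', h2⟩ := exists_ae_le_of_forall_test (g := fun t => -g t) (k := fun t => -k t)
    (fun a b ha => (hg a b ha).neg) (fun a b ha => (hk a b ha).neg) fun α hα _ => by
      have := h α hα
      have e : ∀ t, -g t * deriv α t + -k t * α t = -(g t * deriv α t + k t * α t) :=
        fun t => by ring
      simp_rw [e]
      rw [integral_neg, this, neg_zero]
  refine ⟨S ∩ S', by filter_upwards [hS, hS'] with s a b using ⟨a, b⟩,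
    fun s hs t ht h0 hst => le_antisymm (h1 s hs.1 t ht.1 h0 hst) ?_⟩
  have := h2 s hs.2 t ht.2 h0 hst
  rw [intervalIntegral.integral_neg] at this
  linarith

/-! ### Product test functions -/

section product
variable {α β : ℝ → ℝ}

theorem IsTest.differentiable (hα : IsTest α) : Differentiable ℝ α :=
  hα.contDiff.differentiable (by simp)

theorem IsTest.continuous (hα : IsTest α) : Continuous α := hα.contDiff.continuous

theorem IsTest.continuous_deriv (hα : IsTest α) : Continuous (deriv α) :=
  hα.contDiff.continuous_deriv (by simp)

theorem IsTest.dt_prodMul (hα : IsTest α) (hβ : IsTest β) (p : ℝ × ℝ) :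
    dt (fun p => α p.1 * β p.2) p = deriv α p.1 * β p.2 := by
  have h1 := (hα.differentiable p.1).hasDerivAt.hasFDerivAt.comp p (hasFDerivAt_fst (p := p))
  have h2 := (hβ.differentiable p.2).hasDerivAt.hasFDerivAt.comp p (hasFDerivAt_snd (p := p))
  rw [dt, HasFDerivAt.fderiv (f := fun p : ℝ × ℝ => α p.1 * β p.2) (h1.mul h2)]
  simp [mul_comm]

theorem IsTest.dx_prodMul (hα : IsTest α) (hβ : IsTest β) (p : ℝ × ℝ) :
    dx (fun p => α p.1 * β p.2) p = α p.1 * deriv β p.2 := by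
  have h1 := (hα.differentiable p.1).hasDerivAt.hasFDerivAt.comp p (hasFDerivAt_fst (p := p))
  have h2 := (hβ.differentiable p.2).hasDerivAt.hasFDerivAt.comp p (hasFDerivAt_snd (p := p))
  rw [dx, HasFDerivAt.fderiv (f := fun p : ℝ × ℝ => α p.1 * β p.2) (h1.mul h2)]
  simp [mul_comm]

theorem IsTest.contDiff_prodMul (hα : IsTest α) (hβ : IsTest β) :
    ContDiff ℝ ∞ fun p : ℝ × ℝ => α p.1 * β p.2 :=
  (hα.contDiff.comp contDiff_fst).mul (hβ.contDiff.comp contDiff_snd)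

theorem tsupport_prodMul_subset (α β : ℝ → ℝ) :
    tsupport (fun p : ℝ × ℝ => α p.1 * β p.2) ⊆ tsupport α ×ˢ tsupport β :=
  closure_minimal (fun _ hp => ⟨subset_tsupport _ (left_ne_zero_of_mul hp),
    subset_tsupport _ (right_ne_zero_of_mul hp)⟩)
    ((isClosed_tsupport _).prod (isClosed_tsupport _))

theorem IsTest.hasCompactSupport_prodMul (hα : IsTest α) (hβ : IsTest β) :
    HasCompactSupport fun p : ℝ × ℝ => α p.1 * β p.2 :=
  (hα.compact.isCompact.prod hβ.compact.isCompact).of_isClosed_subset (isClosed_tsupport _)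
    (tsupport_prodMul_subset α β)

theorem IsTest.tsupport_prodMul_subset_quadrant (hα : IsTest α) (hβ : IsTest β) :
    tsupport (fun p : ℝ × ℝ => α p.1 * β p.2) ⊆ quadrant :=
  (tsupport_prodMul_subset α β).trans (Set.prod_mono hα.pos hβ.pos)

end product

/-! ### Fubini against products of cut-off functions -/

/-- Integrability on the compact subsets of the quadrant. -/
def IsLocInt (A : ℝ × ℝ → ℝ) : Prop := ∀ K ⊆ quadrant, IsCompact K → IntegrableOn A K

/-- Continuous functions with compact support in `(0, ∞)`. -/
structure IsCutoff (a : ℝ → ℝ) : Prop where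
  continuous : Continuous a
  compact : HasCompactSupport a
  pos : tsupport a ⊆ Ioi 0

theorem IsTest.isCutoff {α : ℝ → ℝ} (h : IsTest α) : IsCutoff α :=
  ⟨h.continuous, h.compact, h.pos⟩

theorem IsTest.isCutoff_deriv {α : ℝ → ℝ} (h : IsTest α) : IsCutoff (deriv α) :=
  ⟨h.continuous_deriv, h.compact.deriv, tsupport_deriv_subset.trans h.pos⟩

theorem IsCutoff.exists_Icc {a : ℝ → ℝ} (ha : IsCutoff a) :
    ∃ c d : ℝ, 0 < c ∧ c ≤ d ∧ tsupport a ⊆ Icc c d := by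
  rcases (tsupport a).eq_empty_or_nonempty with h | h
  · exact ⟨1, 1, one_pos, le_rfl, by simp [h]⟩
  · have hc := ha.compact.isCompact
    refine ⟨sInf (tsupport a), sSup (tsupport a), ha.pos (hc.sInf_mem h),
      csInf_le_csSup h hc.bddBelow hc.bddAbove, fun x hx =>
      ⟨csInf_le hc.bddBelow hx, le_csSup hc.bddAbove hx⟩⟩

theorem IsCutoff.exists_bound {a : ℝ → ℝ} (ha : IsCutoff a) : ∃ C : ℝ, 0 ≤ C ∧ ∀ x, |a x| ≤ C := by
  obtain ⟨C, hC⟩ := ha.compact.exists_bound_of_continuous ha.continuous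
  exact ⟨C, (norm_nonneg _).trans (hC 0), hC⟩

section
variable {A B : ℝ × ℝ → ℝ}

theorem IsLocInt.sub (hA : IsLocInt A) (hB : IsLocInt B) : IsLocInt fun p => A p - B p :=
  fun K hK hKc => (hA K hK hKc).sub (hB K hK hKc)

theorem IsLocInt.abs (hA : IsLocInt A) : IsLocInt fun p => |A p| :=
  fun K hK hKc => (hA K hK hKc).abs

theorem IsLocInt.continuous_mul (hA : IsLocInt A) {c : ℝ × ℝ → ℝ} (hc : Continuous c) :
    IsLocInt fun p => c p * A p :=
  fun K hK hKc => (hA K hK hKc).continuousOn_mul hc.continuousOn hKc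

theorem IsLocInt.integrable_mul (hA : IsLocInt A) {a b : ℝ → ℝ} (ha : IsCutoff a)
    (hb : IsCutoff b) : Integrable fun p : ℝ × ℝ => A p * (a p.1 * b p.2) := by
  have hK : IsCompact (tsupport a ×ˢ tsupport b) := ha.compact.isCompact.prod hb.compact.isCompact
  have hc : Continuous fun p : ℝ × ℝ => a p.1 * b p.2 :=
    (ha.continuous.comp continuous_fst).mul (hb.continuous.comp continuous_snd)
  have h := (hA _ (Set.prod_mono ha.pos hb.pos) hK).mul_continuousOn hc.continuousOn hK
  refine (integrableOn_iff_integrable_of_support_subset ?_).1 h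
  intro p hp
  have := right_ne_zero_of_mul hp
  exact ⟨subset_tsupport _ (left_ne_zero_of_mul this), subset_tsupport _ (right_ne_zero_of_mul this)⟩

theorem IsLocInt.integrableOn_mul_fst (hA : IsLocInt A) {a : ℝ → ℝ} (ha : IsCutoff a) {c d : ℝ}
    (hc : 0 < c) : IntegrableOn (fun p : ℝ × ℝ => A p * a p.1) (univ ×ˢ Icc c d) := by
  have hK : IsCompact (tsupport a ×ˢ Icc c d) := ha.compact.isCompact.prod isCompact_Icc
  have h := (hA _ (Set.prod_mono ha.pos fun x hx => hc.trans_le hx.1) hK).mul_continuousOn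
    (g' := fun p : ℝ × ℝ => a p.1) (ha.continuous.comp continuous_fst).continuousOn hK
  refine IntegrableOn.of_forall_sdiff_eq_zero h (MeasurableSet.univ.prod measurableSet_Icc) ?_
  rintro p ⟨⟨-, hp2⟩, hp3⟩
  have : p.1 ∉ tsupport a := fun h => hp3 ⟨h, hp2⟩
  rw [image_eq_zero_of_notMem_tsupport this, mul_zero]

theorem IsLocInt.integrableOn_integral_fst (hA : IsLocInt A) {a : ℝ → ℝ} (ha : IsCutoff a)
    {c d : ℝ} (hc : 0 < c) : IntegrableOn (fun x => ∫ t, A (t, x) * a t) (Icc c d) := by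
  have h := hA.integrableOn_mul_fst ha (d := d) hc
  rw [IntegrableOn, Measure.volume_eq_prod, ← Measure.prod_restrict, Measure.restrict_univ] at h
  exact h.integral_prod_right

theorem IsLocInt.swap (hA : IsLocInt A) : IsLocInt fun p => A p.swap := by
  intro K hK hKc
  have h : K = Prod.swap ⁻¹' (Prod.swap '' K) := (preimage_image_eq _ Prod.swap_injective).symm
  have h1 : Prod.swap '' K ⊆ quadrant := by
    rintro _ ⟨p, hp, rfl⟩
    exact ⟨(hK hp).2, (hK hp).1⟩
  rw [h]
  exact (Measure.measurePreserving_swap (μ := (volume : Measure ℝ))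
    (ν := (volume : Measure ℝ))).integrableOn_comp_preimage
    MeasurableEquiv.prodComm.measurableEmbedding |>.2 (hA _ h1 (hKc.image continuous_swap))

theorem IsLocInt.integrableOn_integral_snd (hA : IsLocInt A) {b : ℝ → ℝ} (hb : IsCutoff b)
    {c d : ℝ} (hc : 0 < c) : IntegrableOn (fun t => ∫ x, A (t, x) * b x) (Icc c d) :=
  hA.swap.integrableOn_integral_fst hb hc

theorem IsLocInt.integral_mul (hA : IsLocInt A) {a b : ℝ → ℝ} (ha : IsCutoff a)
    (hb : IsCutoff b) :
    ∫ p : ℝ × ℝ, A p * (a p.1 * b p.2) = ∫ x, (∫ t, A (t, x) * a t) * b x := by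
  rw [Measure.volume_eq_prod, integral_prod_symm _ (hA.integrable_mul ha hb)]
  refine integral_congr_ae (Eventually.of_forall fun x => ?_)
  dsimp only
  rw [← integral_mul_const]
  simp only [mul_assoc]

theorem IsLocInt.integral_mul' (hA : IsLocInt A) {a b : ℝ → ℝ} (ha : IsCutoff a)
    (hb : IsCutoff b) :
    ∫ p : ℝ × ℝ, A p * (a p.1 * b p.2) = ∫ t, (∫ x, A (t, x) * b x) * a t := by
  rw [Measure.volume_eq_prod, integral_prod _ (hA.integrable_mul ha hb)]
  refine integral_congr_ae (Eventually.of_forall fun t => ?_)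
  dsimp only
  rw [← integral_mul_const]
  refine integral_congr_ae (Eventually.of_forall fun x => ?_)
  dsimp only; ring

theorem IsCutoff.integrable_mul_of_integrableOn {b : ℝ → ℝ} (hb : IsCutoff b) {g : ℝ → ℝ}
    (hg : ∀ c d, 0 < c → IntegrableOn g (Icc c d)) : Integrable fun x => g x * b x := by
  obtain ⟨c, d, hc, -, hs⟩ := hb.exists_Icc
  have h := (hg c d hc).mul_continuousOn hb.continuous.continuousOn isCompact_Icc
  refine (integrableOn_iff_integrable_of_support_subset ?_).1 h
  exact fun x hx => hs (subset_tsupport _ (right_ne_zero_of_mul hx))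

end

/-! ### Consequences of the local contraction inequality -/

section
variable {u v : ℝ × ℝ → ℝ}

theorem IsKruzkovSolution.isLocInt (hu : IsKruzkovSolution u) : IsLocInt u := hu.integrableOn

theorem IsKruzkovSolution.isLocInt_sq (hu : IsKruzkovSolution u) : IsLocInt fun p => u p ^ 2 :=
  hu.integrableOn_sq

theorem IsKruzkovSolution.isLocInt_flux (hu : IsKruzkovSolution u) :
    IsLocInt fun p => flux p.2 (u p) :=
  (hu.isLocInt.continuous_mul (continuous_drift.comp continuous_snd)).sub hu.isLocInt_sq

theorem IsKruzkovSolution.isLocInt_abs_sub (hu : IsKruzkovSolution u) (hv : IsKruzkovSolution v) :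
    IsLocInt fun p => |u p - v p| := (hu.isLocInt.sub hv.isLocInt).abs

/-- The entropy flux between two nonnegative solutions. -/
def entropyFlux (u v : ℝ × ℝ → ℝ) (p : ℝ × ℝ) : ℝ := drift p.2 * |u p - v p| - |u p ^ 2 - v p ^ 2|

theorem IsKruzkovSolution.isLocInt_entropyFlux (hu : IsKruzkovSolution u)
    (hv : IsKruzkovSolution v) : IsLocInt (entropyFlux u v) :=
  ((hu.isLocInt_abs_sub hv).continuous_mul (continuous_drift.comp continuous_snd)).sub
    (hu.isLocInt_sq.sub hv.isLocInt_sq).abs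

theorem abs_entropyFlux_le (hu : ∀ p, 0 ≤ u p) (hv : ∀ p, 0 ≤ v p) (p : ℝ × ℝ) :
    |entropyFlux u v p| ≤ |flux p.2 (u p)| + |flux p.2 (v p)| := by
  rw [entropyFlux, ← sign_mul_flux_sub (hu p) (hv p), abs_mul]
  refine (mul_le_of_le_one_left (abs_nonneg _) (abs_sign_le_one _)).trans ?_
  exact abs_sub _ _

theorem IsKruzkovSolution.contraction_prod (hu : IsKruzkovSolution u) (hv : IsKruzkovSolution v)
    {α β : ℝ → ℝ} (hα : IsTest α) (hβ : IsTest β) (hα0 : ∀ t, 0 ≤ α t) (hβ0 : ∀ x, 0 ≤ β x) :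
    0 ≤ (∫ p : ℝ × ℝ, |u p - v p| * (deriv α p.1 * β p.2))
      + ∫ p : ℝ × ℝ, entropyFlux u v p * (α p.1 * deriv β p.2) := by
  have h := hu.contraction hv (hα.contDiff_prodMul hβ) (hα.hasCompactSupport_prodMul hβ)
    (hα.tsupport_prodMul_subset_quadrant hβ) (fun p => mul_nonneg (hα0 _) (hβ0 _))
  rw [← integral_add ((hu.isLocInt_abs_sub hv).integrable_mul hα.isCutoff_deriv hβ.isCutoff)
    ((hu.isLocInt_entropyFlux hv).integrable_mul hα.isCutoff hβ.isCutoff_deriv)]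
  refine h.trans_eq (integral_congr_ae (Eventually.of_forall fun p => ?_))
  simp only [contractionDensity, hα.dt_prodMul hβ, hα.dx_prodMul hβ, entropyFlux]

/-- Integrated over time, the entropy flux towards the boundary `x = 0` is controlled by its
value further inside the domain. -/
theorem IsKruzkovSolution.exists_ae_entropyFlux_le (hu : IsKruzkovSolution u)
    (hv : IsKruzkovSolution v) {α : ℝ → ℝ} (hα : IsTest α) (hα0 : ∀ t, 0 ≤ α t) :
    ∃ S : Set ℝ, (∀ᵐ x, x ∈ S) ∧ ∀ x ∈ S, ∀ y ∈ S, 0 < x → x < y →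
      ∫ t, entropyFlux u v (t, y) * α t ≤ (∫ t, entropyFlux u v (t, x) * α t)
        + ∫ z in x..y, ∫ t, |u (t, z) - v (t, z)| * deriv α t := by
  have hE := hu.isLocInt_entropyFlux hv
  have hA := hu.isLocInt_abs_sub hv
  refine exists_ae_le_of_forall_test (fun a b ha => hE.integrableOn_integral_fst hα.isCutoff ha)
    (fun a b ha => hA.integrableOn_integral_fst hα.isCutoff_deriv ha) fun β hβ hβ0 => ?_
  have h := hu.contraction_prod hv hα hβ hα0 hβ0
  rw [hA.integral_mul hα.isCutoff_deriv hβ.isCutoff,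
    hE.integral_mul hα.isCutoff hβ.isCutoff_deriv, add_comm, ← integral_add] at h
  · exact h
  · exact hβ.isCutoff_deriv.integrable_mul_of_integrableOn fun a b ha =>
      hE.integrableOn_integral_fst hα.isCutoff ha
  · exact hβ.isCutoff.integrable_mul_of_integrableOn fun a b ha =>
      hA.integrableOn_integral_fst hα.isCutoff_deriv ha

end

/-! ### The contraction in time -/

section
variable {u : ℝ × ℝ → ℝ}

theorem IsSolution.integrableOn_Iio (hu : IsSolution u) (T : ℝ) :
    IntegrableOn u (Iio T ×ˢ univ) := by
  refine IntegrableOn.of_forall_sdiff_eq_zero (hu.integrable T)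
    (measurableSet_Iio.prod MeasurableSet.univ) ?_
  rintro p ⟨⟨hp1, -⟩, hp2⟩
  exact hu.eq_zero p fun h => hp2 ⟨⟨h.1, hp1⟩, h.2⟩

theorem IsSolution.integrableOn_translate (hu : IsSolution u) (h T : ℝ) :
    IntegrableOn (fun p => u (p + (h, 0))) (Iio T ×ˢ univ) := by
  have hpre : (Iio T ×ˢ univ : Set (ℝ × ℝ)) =
      (fun p : ℝ × ℝ => p + (h, 0)) ⁻¹' (Iio (T + h) ×ˢ univ) := by
    ext p; simp
  rw [hpre]
  exact ((measurePreserving_add_right volume ((h, 0) : ℝ × ℝ)).integrableOn_comp_preimage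
    (measurableEmbedding_addRight _)).2 (hu.integrableOn_Iio _)

theorem IsSolution.eq_zero_of_nonpos (hu : IsSolution u) {p : ℝ × ℝ} (hp : p.2 ≤ 0) : u p = 0 :=
  hu.eq_zero p fun h => absurd h.2 (not_lt.2 hp)

theorem integrable_mul_fst {A : ℝ × ℝ → ℝ} (hA : ∀ T, IntegrableOn A (Iio T ×ˢ univ)) {a : ℝ → ℝ}
    (ha : IsCutoff a) : Integrable fun p : ℝ × ℝ => A p * a p.1 := by
  obtain ⟨c, d, -, -, hs⟩ := ha.exists_Icc
  obtain ⟨C, -, hC⟩ := ha.exists_bound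
  have h : IntegrableOn (fun p : ℝ × ℝ => A p * a p.1) (Iio (d + 1) ×ˢ univ) :=
    (hA (d + 1)).mul_bdd (c := C)
      (ha.continuous.comp continuous_fst).aestronglyMeasurable (Eventually.of_forall fun p => hC _)
  refine (integrableOn_iff_integrable_of_support_subset fun p hp => ?_).1 h
  have := (hs (subset_tsupport _ (right_ne_zero_of_mul hp))).2
  exact ⟨by rw [mem_Iio]; linarith, trivial⟩

theorem IsSolution.integrableOn_abs_sub_translate (hu : IsSolution u) (h T : ℝ) :
    IntegrableOn (fun p => |u p - u (p + (h, 0))|) (Iio T ×ˢ univ) :=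
  ((hu.integrableOn_Iio T).sub (hu.integrableOn_translate h T)).abs

/-- A smooth cut-off of `[2δ, R]` inside `[δ, R + 1]`. -/
noncomputable def spaceCutoff (δ R x : ℝ) : ℝ :=
  Real.smoothTransition ((x - δ) / δ) - Real.smoothTransition ((x - R) / 1)

theorem spaceCutoff_nonneg {δ R : ℝ} (hδ : 0 < δ) (hδ1 : δ ≤ 1) (hR : 1 ≤ R) (x : ℝ) :
    0 ≤ spaceCutoff δ R x := by
  rcases le_or_gt x 0 with hx | hx
  · rw [spaceCutoff, Real.smoothTransition.zero_of_nonpos (div_nonpos_of_nonpos_of_nonneg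
      (by linarith) hδ.le), Real.smoothTransition.zero_of_nonpos (by linarith), sub_zero]
  · refine sub_nonneg.2 (Real.smoothTransition.monotone ?_)
    rw [div_one, sub_div, div_self hδ.ne']
    have : x ≤ x / δ := by rw [le_div_iff₀ hδ]; nlinarith
    linarith

theorem abs_spaceCutoff_le_one {δ R : ℝ} (hδ : 0 < δ) (hδ1 : δ ≤ 1) (hR : 1 ≤ R) (x : ℝ) :
    |spaceCutoff δ R x| ≤ 1 := by
  rw [abs_of_nonneg (spaceCutoff_nonneg hδ hδ1 hR x), spaceCutoff]
  linarith [Real.smoothTransition.le_one ((x - δ) / δ), Real.smoothTransition.nonneg ((x - R) / 1)]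

theorem isTest_spaceCutoff {δ R : ℝ} (hδ : 0 < δ) (hδ1 : δ ≤ 1) (hR : 1 ≤ R) :
    IsTest (spaceCutoff δ R) := by
  have hs : tsupport (spaceCutoff δ R) ⊆ Icc δ (R + 1) := by
    refine closure_minimal (fun x hx => ?_) isClosed_Icc
    by_contra h
    rw [mem_Icc, not_and_or, not_le, not_le] at h
    refine hx ?_
    rcases h with h | h
    · rw [spaceCutoff, Real.smoothTransition.zero_of_nonpos (div_nonpos_of_nonpos_of_nonneg
        (by linarith) hδ.le), Real.smoothTransition.zero_of_nonpos (by linarith), sub_zero]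
    · rw [spaceCutoff, Real.smoothTransition.one_of_one_le ((one_le_div hδ).2 (by linarith)),
        Real.smoothTransition.one_of_one_le (by linarith), sub_self]
  refine ⟨?_, isCompact_Icc.of_isClosed_subset (isClosed_tsupport _) hs,
    hs.trans fun x hx => hδ.trans_le hx.1⟩
  exact (contDiff_smoothTransition.comp ((contDiff_id.sub contDiff_const).div_const δ)).sub
    (contDiff_smoothTransition.comp ((contDiff_id.sub contDiff_const).div_const 1))

theorem deriv_spaceCutoff (δ R x : ℝ) : deriv (spaceCutoff δ R) x =
    δ⁻¹ * deriv Real.smoothTransition ((x - δ) / δ)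
      - 1⁻¹ * deriv Real.smoothTransition ((x - R) / 1) :=
  ((deriv_smoothTransition_comp δ δ x).sub (deriv_smoothTransition_comp R 1 x)).deriv

/-- The flux through `x` tends to zero as `x → ∞`, on average over unit intervals. -/
theorem IsSolution.exists_lintegral_flux_le (hu : IsSolution u) {T : ℝ} (hT : 0 < T)
    {ε : ENNReal} (hε : 0 < ε) : ∃ R₀ : ℝ, ∀ R, R₀ ≤ R →
      ∫⁻ p in Ioo 0 T ×ˢ Icc R (R + 1), ‖flux p.2 (u p)‖ₑ ≤ ε := by
  have h := ENNReal.tendsto_nhds_zero.1 (hu.flux_infinity T hT) ε hε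
  rw [Filter.eventually_inf] at h
  obtain ⟨s, hs, s', hs', hss⟩ := h
  obtain ⟨R₀, hR₀⟩ := mem_atTop_sets.1 hs
  refine ⟨R₀, fun R hR => ?_⟩
  have hum := hu.measurable
  have hm : Measurable fun p : ℝ × ℝ => ‖flux p.2 (u p)‖ₑ := by unfold flux; fun_prop
  rw [Measure.volume_eq_prod, ← Measure.prod_restrict, lintegral_prod_symm _ hm.aemeasurable]
  calc ∫⁻ x in Icc R (R + 1), ∫⁻ t in Ioo 0 T, ‖flux x (u (t, x))‖ₑ
      ≤ ∫⁻ x in Icc R (R + 1), ε := by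
        refine lintegral_mono_ae ?_
        filter_upwards [ae_restrict_mem measurableSet_Icc, ae_restrict_of_ae hs'] with x hx hx'
        exact hss x ⟨hR₀ x (hR.trans hx.1), hx'⟩
    _ = ε := by simp

theorem setLIntegral_translate_le {Φ : ℝ × ℝ → ENNReal} (h T : ℝ) (hh : 0 ≤ h)
    {s : Set ℝ} (hs : MeasurableSet s) :
    ∫⁻ p in Ioo 0 T ×ˢ s, Φ (p + (h, 0)) ≤ ∫⁻ p in Ioo 0 (T + h) ×ˢ s, Φ p := by
  rw [← lintegral_indicator (measurableSet_Ioo.prod hs),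
    ← lintegral_indicator (measurableSet_Ioo.prod hs),
    ← lintegral_add_right_eq_self ((Ioo 0 (T + h) ×ˢ s).indicator Φ) ((h, 0) : ℝ × ℝ)]
  refine lintegral_mono fun p => ?_
  by_cases hp : p ∈ Ioo 0 T ×ˢ s
  · have hp' : p + (h, 0) ∈ Ioo 0 (T + h) ×ˢ s := by
      obtain ⟨⟨h1, h2⟩, h3⟩ := hp
      refine ⟨⟨?_, ?_⟩, ?_⟩ <;> simp <;> first | linarith | exact h3
    rw [indicator_of_mem hp, indicator_of_mem hp']
  · rw [indicator_of_notMem hp]; exact zero_le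

/-- The `L¹` distance between a solution and its time translate is nonincreasing in time. The
cut-off near `x = 0` is harmless because the entropy flux is bounded above by
`drift * |u - v|`, the one near `x = ∞` by the condition of no flux at infinity. -/
theorem IsSolution.time_contraction (hu : IsSolution u) {h : ℝ} (hh : 0 ≤ h) {α : ℝ → ℝ}
    (hα : IsTest α) (hα0 : ∀ t, 0 ≤ α t) :
    0 ≤ ∫ p : ℝ × ℝ, |u p - u (p + (h, 0))| * deriv α p.1 := by
  have hv := hu.toIsKruzkovSolution.translate hh
  set v : ℝ × ℝ → ℝ := fun p => u (p + (h, 0)) with hvdef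
  have hum := hu.measurable
  have hvm := hv.measurable
  have hv0 : ∀ p : ℝ × ℝ, p.2 ≤ 0 → v p = 0 := fun p hp =>
    hu.eq_zero_of_nonpos (by simpa using hp)
  set A : ℝ × ℝ → ℝ := fun p => |u p - v p| with hA
  have hA0 : ∀ p : ℝ × ℝ, p.2 ≤ 0 → A p = 0 := fun p hp => by
    simp only [hA, hu.eq_zero_of_nonpos hp, hv0 p hp]; simp
  have hAnn : ∀ p, 0 ≤ A p := fun p => abs_nonneg _
  have hAα' := integrable_mul_fst (hu.integrableOn_abs_sub_translate h) hα.isCutoff_deriv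
  have hAα := integrable_mul_fst (hu.integrableOn_abs_sub_translate h) hα.isCutoff
  obtain ⟨M, hM0, hM⟩ := exists_bound_deriv_smoothTransition
  have hηnn : ∀ x, 0 ≤ deriv Real.smoothTransition x := fun x =>
    Real.smoothTransition.monotone.deriv_nonneg
  obtain ⟨C, hC0, hC⟩ := hα.isCutoff.exists_bound
  obtain ⟨c, d, hc, hcd, hsupp⟩ := hα.isCutoff.exists_Icc
  have hE := hu.toIsKruzkovSolution.isLocInt_entropyFlux hv
  -- The cut-off inequality, with the boundary terms estimated.
  have key : ∀ δ R : ℝ, 0 < δ → δ ≤ 1 → 1 ≤ R →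
      ∫⁻ p in Ioo 0 (d + 1) ×ˢ Icc R (R + 1), (‖flux p.2 (u p)‖ₑ + ‖flux p.2 (v p)‖ₑ) ≠ ⊤ →
      0 ≤ (∫ p : ℝ × ℝ, A p * deriv α p.1 * spaceCutoff δ R p.2)
        + 4 * M * (∫ p : ℝ × ℝ, A p * α p.1 * (Ioc 0 (2 * δ)).indicator 1 p.2)
        + (C * M) * (∫⁻ p in Ioo 0 (d + 1) ×ˢ Icc R (R + 1),
          (‖flux p.2 (u p)‖ₑ + ‖flux p.2 (v p)‖ₑ)).toReal := by
    intro δ R hδ hδ1 hR hfin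
    have hβ := isTest_spaceCutoff hδ hδ1 hR
    have hcη := continuous_deriv_smoothTransition
    have hcut : ∀ s ε : ℝ, 0 < s → 0 < ε →
        IsCutoff fun x => ε⁻¹ * deriv Real.smoothTransition ((x - s) / ε) := by
      intro s ε hs hε
      have h1 := support_deriv_smoothTransition_comp_subset (s := s) hε
      exact ⟨by fun_prop, HasCompactSupport.of_support_subset_isCompact isCompact_Icc h1,
        (closure_minimal h1 isClosed_Icc).trans fun x hx => hs.trans_le hx.1⟩
    have hK1 := hcut δ δ hδ hδ
    have hK2 := hcut R 1 (by linarith) one_pos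
    have hk := hu.toIsKruzkovSolution.contraction_prod hv hα hβ hα0
      (spaceCutoff_nonneg hδ hδ1 hR)
    have e1 : ∫ p : ℝ × ℝ, |u p - v p| * (deriv α p.1 * spaceCutoff δ R p.2) =
        ∫ p : ℝ × ℝ, A p * deriv α p.1 * spaceCutoff δ R p.2 := by
      simp only [hA, mul_assoc]
    have e2 : ∫ p : ℝ × ℝ, entropyFlux u v p * (α p.1 * deriv (spaceCutoff δ R) p.2) =
        (∫ p : ℝ × ℝ, entropyFlux u v p *
          (α p.1 * (δ⁻¹ * deriv Real.smoothTransition ((p.2 - δ) / δ))))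
        - ∫ p : ℝ × ℝ, entropyFlux u v p *
          (α p.1 * (1⁻¹ * deriv Real.smoothTransition ((p.2 - R) / 1))) := by
      rw [← integral_sub (hE.integrable_mul hα.isCutoff hK1) (hE.integrable_mul hα.isCutoff hK2)]
      refine integral_congr_ae (Eventually.of_forall fun p => ?_)
      dsimp only
      rw [deriv_spaceCutoff]; ring
    rw [e1, e2] at hk
    have b1 : ∫ p : ℝ × ℝ, entropyFlux u v p *
        (α p.1 * (δ⁻¹ * deriv Real.smoothTransition ((p.2 - δ) / δ))) ≤
        4 * M * ∫ p : ℝ × ℝ, A p * α p.1 * (Ioc 0 (2 * δ)).indicator 1 p.2 := by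
      rw [← integral_const_mul]
      refine integral_mono (hE.integrable_mul hα.isCutoff hK1) ?_ fun p => ?_
      · refine (hAα.mul_bdd (c := 1) ?_ (Eventually.of_forall fun p => ?_)).const_mul _
        · exact ((measurable_one.indicator measurableSet_Ioc).comp
            measurable_snd).aestronglyMeasurable
        · by_cases hp : p.2 ∈ Ioc 0 (2 * δ) <;> simp [hp]
      · by_cases hp : p.2 ∈ Icc δ (δ + δ)
        · have hp' : p.2 ∈ Ioc 0 (2 * δ) := ⟨hδ.trans_le hp.1, by linarith [hp.2]⟩
          simp only [indicator_of_mem hp', Pi.one_apply, mul_one]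
          have f1 : entropyFlux u v p ≤ 4 * δ * A p := by
            have : drift p.2 ≤ 4 * δ := by rw [drift]; nlinarith [hp.2, sq_nonneg p.2]
            rw [entropyFlux]
            nlinarith [abs_nonneg (u p ^ 2 - v p ^ 2), hAnn p]
          have f2 : δ⁻¹ * deriv Real.smoothTransition ((p.2 - δ) / δ) ≤ δ⁻¹ * M :=
            mul_le_mul_of_nonneg_left ((le_abs_self _).trans (hM _)) (inv_pos.2 hδ).le
          have f3 : 0 ≤ δ⁻¹ * deriv Real.smoothTransition ((p.2 - δ) / δ) :=
            mul_nonneg (inv_pos.2 hδ).le (hηnn _)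
          calc entropyFlux u v p * (α p.1 * (δ⁻¹ * deriv Real.smoothTransition ((p.2 - δ) / δ)))
              ≤ 4 * δ * A p * (α p.1 * (δ⁻¹ * deriv Real.smoothTransition ((p.2 - δ) / δ))) :=
                mul_le_mul_of_nonneg_right f1 (mul_nonneg (hα0 _) f3)
            _ ≤ 4 * δ * A p * (α p.1 * (δ⁻¹ * M)) := by
                have := hAnn p
                have := hα0 p.1
                gcongr
            _ = 4 * M * (A p * α p.1) := by field_simp
        · have : δ⁻¹ * deriv Real.smoothTransition ((p.2 - δ) / δ) = 0 :=
            Function.notMem_support.1 fun h' =>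
              hp (support_deriv_smoothTransition_comp_subset hδ h')
          rw [this]
          simp only [mul_zero]
          exact mul_nonneg (by positivity) (mul_nonneg (mul_nonneg (hAnn _) (hα0 _))
            (indicator_nonneg (fun _ _ => zero_le_one) _))
    have b2 : -∫ p : ℝ × ℝ, entropyFlux u v p *
        (α p.1 * (1⁻¹ * deriv Real.smoothTransition ((p.2 - R) / 1))) ≤
        (C * M) * (∫⁻ p in Ioo 0 (d + 1) ×ˢ Icc R (R + 1),
          (‖flux p.2 (u p)‖ₑ + ‖flux p.2 (v p)‖ₑ)).toReal := by
      refine (neg_le_abs _).trans ?_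
      have hCM : C * M = (ENNReal.ofReal (C * M)).toReal :=
        (ENNReal.toReal_ofReal (by positivity)).symm
      rw [← Real.norm_eq_abs, ← toReal_enorm, hCM, ← ENNReal.toReal_mul]
      refine ENNReal.toReal_mono (ENNReal.mul_ne_top ENNReal.ofReal_ne_top hfin) ?_
      refine (enorm_integral_le_lintegral_enorm _).trans ?_
      rw [← lintegral_const_mul' _ _ ENNReal.ofReal_ne_top,
        ← lintegral_indicator (measurableSet_Ioo.prod measurableSet_Icc)]
      refine lintegral_mono fun p => ?_
      by_cases hp : p ∈ Ioo 0 (d + 1) ×ˢ Icc R (R + 1)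
      · rw [indicator_of_mem hp, ← ofReal_norm, ← ofReal_norm, ← ofReal_norm,
          ← ENNReal.ofReal_add (norm_nonneg _) (norm_nonneg _),
          ← ENNReal.ofReal_mul (by positivity)]
        refine ENNReal.ofReal_le_ofReal ?_
        simp only [Real.norm_eq_abs, abs_mul, inv_one, one_mul]
        calc _ ≤ (|flux p.2 (u p)| + |flux p.2 (v p)|) * (C * M) := by
              have := abs_entropyFlux_le hu.nonneg hv.nonneg p
              have := hC p.1
              have := hM ((p.2 - R) / 1)
              gcongr
          _ = _ := by ring
      · have : α p.1 * (1⁻¹ * deriv Real.smoothTransition ((p.2 - R) / 1)) = 0 := by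
          by_contra h0
          have g1 := hsupp (subset_tsupport _ (left_ne_zero_of_mul h0))
          have g2 := support_deriv_smoothTransition_comp_subset one_pos (right_ne_zero_of_mul h0)
          exact hp ⟨⟨hc.trans_le g1.1, by linarith [g1.2]⟩, g2⟩
        rw [this]; simp
    linarith
  -- Passage to the limit.
  set W : ℝ → ENNReal := fun R => ∫⁻ p in Ioo 0 (d + 1) ×ˢ Icc R (R + 1),
    (‖flux p.2 (u p)‖ₑ + ‖flux p.2 (v p)‖ₑ) with hW
  have hWle : ∀ ε : ℝ, 0 < ε → ∃ R₀ : ℝ, ∀ R, R₀ ≤ R → W R ≤ ENNReal.ofReal (2 * ε) := by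
    intro ε hε
    have hε' : 0 < ENNReal.ofReal ε := by simpa using hε
    obtain ⟨R₁, h1⟩ := hu.exists_lintegral_flux_le (by linarith : 0 < d + 1) hε'
    obtain ⟨R₂, h2⟩ := hu.exists_lintegral_flux_le (by linarith : 0 < d + 1 + h) hε'
    refine ⟨max R₁ R₂, fun R hR => ?_⟩
    have hm : Measurable fun p : ℝ × ℝ => ‖flux p.2 (u p)‖ₑ := by unfold flux; fun_prop
    rw [hW]
    dsimp only
    rw [lintegral_add_left hm, two_mul, ENNReal.ofReal_add hε.le hε.le]
    refine add_le_add (h1 R ((le_max_left _ _).trans hR)) ?_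
    refine le_trans (le_of_eq ?_) ((setLIntegral_translate_le
      (Φ := fun p : ℝ × ℝ => ‖flux p.2 (u p)‖ₑ) h (d + 1) hh
      (measurableSet_Icc (a := R) (b := R + 1))).trans (h2 R ((le_max_right _ _).trans hR)))
    simp only [hvdef, Prod.snd_add, add_zero]
  have lim1 : Tendsto (fun j : ℕ => ∫ p : ℝ × ℝ, A p * deriv α p.1 *
      spaceCutoff (((j : ℝ) + 1)⁻¹) ((j : ℝ) + 1) p.2) atTop (𝓝 (∫ p, A p * deriv α p.1)) := by
    refine tendsto_integral_of_dominated_convergence (fun p => ‖A p * deriv α p.1‖)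
      (fun j => ?_) hAα'.norm (fun j => Eventually.of_forall fun p => ?_)
      (Eventually.of_forall fun p => ?_)
    · refine hAα'.1.mul (Continuous.aestronglyMeasurable ?_)
      unfold spaceCutoff
      have := Real.smoothTransition.continuous
      fun_prop
    · rw [norm_mul]
      exact mul_le_of_le_one_right (norm_nonneg _) (abs_spaceCutoff_le_one (by positivity)
        (inv_le_one_of_one_le₀ (by linarith [j.cast_nonneg (α := ℝ)]))
        (by linarith [j.cast_nonneg (α := ℝ)]) _)
    · rcases le_or_gt p.2 0 with hp | hp
      · simp [hA0 p hp]
      · refine tendsto_const_nhds.congr' ?_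
        obtain ⟨j1, hj1⟩ := exists_nat_gt (2 * p.2⁻¹)
        obtain ⟨j2, hj2⟩ := exists_nat_gt p.2
        filter_upwards [eventually_ge_atTop (max j1 j2)] with j hj
        have g1 : (j1 : ℝ) ≤ j := by exact_mod_cast (le_max_left _ _).trans hj
        have g2 : (j2 : ℝ) ≤ j := by exact_mod_cast (le_max_right _ _).trans hj
        have hj0 : (0 : ℝ) < (j : ℝ) + 1 := by positivity
        rw [spaceCutoff, Real.smoothTransition.one_of_one_le,
          Real.smoothTransition.zero_of_nonpos, sub_zero, mul_one]
        · linarith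
        · rw [one_le_div (by positivity)]
          have h2 : 2 * p.2⁻¹ < j + 1 := by linarith
          have h3 : 2 * (p.2⁻¹ * p.2) < (j + 1) * p.2 := by nlinarith
          rw [inv_mul_cancel₀ hp.ne'] at h3
          have h4 : ((j : ℝ) + 1)⁻¹ * (((j : ℝ) + 1) * p.2) = p.2 := by field_simp
          have h5 := mul_lt_mul_of_pos_left h3 (inv_pos.2 hj0)
          linarith
  have lim2 : Tendsto (fun j : ℕ => ∫ p : ℝ × ℝ, A p * α p.1 *
      (Ioc 0 (2 * ((j : ℝ) + 1)⁻¹)).indicator 1 p.2) atTop (𝓝 (∫ _ : ℝ × ℝ, 0)) := by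
    refine tendsto_integral_of_dominated_convergence (fun p => ‖A p * α p.1‖)
      (fun j => ?_) hAα.norm (fun j => Eventually.of_forall fun p => ?_)
      (Eventually.of_forall fun p => ?_)
    · exact hAα.1.mul ((measurable_one.indicator measurableSet_Ioc).comp
        measurable_snd).aestronglyMeasurable
    · rw [norm_mul]
      refine mul_le_of_le_one_right (norm_nonneg _) ?_
      by_cases hp : p.2 ∈ Ioc 0 (2 * ((j : ℝ) + 1)⁻¹) <;> simp [hp]
    · rcases le_or_gt p.2 0 with hp | hp
      · simp [hA0 p hp]
      · refine tendsto_const_nhds.congr' ?_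
        have hlim : Tendsto (fun j : ℕ => 2 * ((j : ℝ) + 1)⁻¹) atTop (𝓝 (2 * 0)) := by
          simpa [one_div] using (tendsto_one_div_add_atTop_nhds_zero_nat (𝕜 := ℝ)).const_mul 2
        rw [mul_zero] at hlim
        filter_upwards [hlim.eventually_lt_const hp] with j hj
        rw [indicator_of_notMem (fun h => absurd h.2 (not_le.2 hj)), mul_zero]
  rw [integral_zero] at lim2
  refine le_of_forall_pos_le_add fun ε hε => ?_
  obtain ⟨ε', hε', hle⟩ : ∃ ε' : ℝ, 0 < ε' ∧ C * M * (2 * ε') ≤ ε := by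
    refine ⟨ε / (2 * (C * M + 1)), by positivity, ?_⟩
    rw [mul_div_assoc', mul_div_assoc', div_le_iff₀ (by positivity)]
    nlinarith [mul_nonneg hC0 hM0]
  obtain ⟨R₀, hR₀⟩ := hWle ε' hε'
  have hlim := (lim1.add (lim2.const_mul (4 * M))).add_const ε
  rw [mul_zero, add_zero] at hlim
  refine ge_of_tendsto hlim ?_
  obtain ⟨j0, hj0⟩ := exists_nat_gt R₀
  filter_upwards [eventually_ge_atTop j0] with j hj
  have g : (j0 : ℝ) ≤ j := by exact_mod_cast hj
  have hWj := hR₀ ((j : ℝ) + 1) (by linarith)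
  have := key (((j : ℝ) + 1)⁻¹) ((j : ℝ) + 1) (by positivity)
    (inv_le_one_of_one_le₀ (by linarith [j.cast_nonneg (α := ℝ)]))
    (by linarith [j.cast_nonneg (α := ℝ)]) (ne_top_of_le_ne_top ENNReal.ofReal_ne_top hWj)
  have hWr : (W ((j : ℝ) + 1)).toReal ≤ 2 * ε' := by
    have := ENNReal.toReal_mono ENNReal.ofReal_ne_top hWj
    rwa [ENNReal.toReal_ofReal (by positivity)] at this
  have := mul_le_mul_of_nonneg_left hWr (mul_nonneg hC0 hM0)
  linarith

end

/-! ### The continuous version in `L¹` -/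

section
variable {u : ℝ × ℝ → ℝ}

/-- The `L¹` distance in space between the slices at the times `t + h` and `t`. -/
noncomputable def shiftDist (u : ℝ × ℝ → ℝ) (h t : ℝ) : ℝ≥0∞ := ∫⁻ x, ‖u (t + h, x) - u (t, x)‖ₑ

theorem measurable_shiftDist (hu : Measurable u) :
    Measurable fun z : ℝ × ℝ => shiftDist u z.2 z.1 := by
  have : Measurable fun q : (ℝ × ℝ) × ℝ => ‖u (q.1.1 + q.1.2, q.2) - u (q.1.1, q.2)‖ₑ := by
    fun_prop
  exact this.lintegral_prod_right'

theorem IsSolution.ae_integrable_slice (hu : IsSolution u) :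
    ∀ᵐ t, Integrable fun x => u (t, x) := by
  have h : ∀ j : ℕ, ∀ᵐ t ∂(volume.restrict (Iio (j : ℝ))), Integrable fun x => u (t, x) := by
    intro j
    have := hu.integrableOn_Iio j
    rw [IntegrableOn, Measure.volume_eq_prod, ← Measure.prod_restrict, Measure.restrict_univ] at this
    exact this.prod_right_ae
  have h' : ∀ᵐ t, ∀ j : ℕ, t ∈ Iio (j : ℝ) → Integrable fun x => u (t, x) :=
    ae_all_iff.2 fun j => (ae_restrict_iff' measurableSet_Iio).1 (h j)
  filter_upwards [h'] with t ht
  obtain ⟨j, hj⟩ := exists_nat_gt t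
  exact ht j hj

/-- Being nonincreasing, the distance to the time translate at `t` is at most its mean over `(0, τ)`. -/
theorem IsSolution.ae_mul_shiftDist_le (hu : IsSolution u) {h τ : ℝ} (hh : 0 ≤ h) :
    ∀ᵐ t, τ < t → ENNReal.ofReal τ * shiftDist u h t ≤ ∫⁻ s in Ioo 0 τ, shiftDist u h s := by
  have hA := hu.integrableOn_abs_sub_translate h
  have hDi : ∀ a b : ℝ, 0 < a →
      IntegrableOn (fun t => ∫ x, |u (t, x) - u (t + h, x)|) (Icc a b) := by
    intro a b _
    have := hA (b + 1)
    rw [IntegrableOn, Measure.volume_eq_prod, ← Measure.prod_restrict, Measure.restrict_univ] at this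
    have h1 : IntegrableOn (fun t => ∫ x, |u (t, x) - u (t + h, x)|) (Iio (b + 1)) := by
      have h2 := this.integral_prod_left
      simp only [Prod.mk_add_mk, add_zero] at h2
      exact h2
    exact h1.mono_set fun x hx => by rw [mem_Iio]; linarith [hx.2]
  obtain ⟨S, hS, hmono⟩ := exists_ae_le_of_forall_test hDi (k := fun _ => 0)
    (fun a b _ => integrableOn_zero) fun α hα hα0 => by
      have h1 := hu.time_contraction hh hα hα0
      rw [Measure.volume_eq_prod, integral_prod _ (integrable_mul_fst hA hα.isCutoff_deriv)] at h1
      refine h1.trans_eq (integral_congr_ae (Eventually.of_forall fun t => ?_))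
      simp [integral_mul_const]
  have hconv : ∀ᵐ t, shiftDist u h t = ENNReal.ofReal (∫ x, |u (t, x) - u (t + h, x)|) := by
    have h1 := hu.ae_integrable_slice
    have h2 : ∀ᵐ t, Integrable fun x => u (t + h, x) :=
      (measurePreserving_add_right volume h).quasiMeasurePreserving.ae h1
    filter_upwards [h1, h2] with t a b
    have hab : Integrable fun x => |u (t, x) - u (t + h, x)| := (a.sub b).abs
    rw [ofReal_integral_eq_lintegral_ofReal hab
      (Eventually.of_forall fun _ => abs_nonneg _), shiftDist]
    refine lintegral_congr fun x => ?_
    rw [abs_sub_comm, ← Real.norm_eq_abs, ofReal_norm]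
  filter_upwards [hS, hconv] with t htS htc htτ
  calc ENNReal.ofReal τ * shiftDist u h t = ∫⁻ _ in Ioo 0 τ, shiftDist u h t := by
        simp [mul_comm]
    _ ≤ ∫⁻ s in Ioo 0 τ, shiftDist u h s := by
        refine lintegral_mono_ae ?_
        filter_upwards [ae_restrict_mem measurableSet_Ioo, ae_restrict_of_ae hS,
          ae_restrict_of_ae hconv] with s hs hsS hsc
        rw [htc, hsc]
        refine ENNReal.ofReal_le_ofReal ?_
        simpa using hmono s hsS t htS hs.1 (hs.2.trans htτ)

theorem IsSolution.tendsto_lintegral_shiftDist (hu : IsSolution u) (τ : ℝ) :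
    Tendsto (fun h => ∫⁻ s in Ioo 0 τ, shiftDist u h s) (𝓝 0) (𝓝 0) := by
  set w : ℝ × ℝ → ℝ := (Iio (τ + 1) ×ˢ univ).indicator u with hw
  have hwi : Integrable w := (hu.integrableOn_Iio _).integrable_indicator
    (measurableSet_Iio.prod MeasurableSet.univ)
  have hum := hu.measurable
  have h1 : Tendsto (fun h : ℝ => ∫⁻ p, ‖w (p + (h, 0)) - w p‖ₑ) (𝓝 0) (𝓝 0) := by
    have hc : Tendsto (fun h : ℝ => ((h, 0) : ℝ × ℝ)) (𝓝 0) (𝓝 0) := by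
      have : Continuous fun h : ℝ => ((h, 0) : ℝ × ℝ) := by fun_prop
      exact this.tendsto 0
    exact (tendsto_lintegral_enorm_translate_sub volume hwi).comp hc
  refine tendsto_of_tendsto_of_tendsto_of_le_of_le' tendsto_const_nhds h1
    (Eventually.of_forall fun _ => zero_le) ?_
  filter_upwards [Iio_mem_nhds (zero_lt_one' ℝ)] with h hh
  have hm : Measurable fun p : ℝ × ℝ => ‖w (p + (h, 0)) - w p‖ₑ := by
    have : Measurable w := hum.indicator (measurableSet_Iio.prod MeasurableSet.univ)
    fun_prop
  rw [Measure.volume_eq_prod, lintegral_prod _ hm.aemeasurable]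
  refine le_trans (le_of_eq ?_) (setLIntegral_le_lintegral (Ioo 0 τ) _)
  refine setLIntegral_congr_fun measurableSet_Ioo fun s hs => ?_
  refine lintegral_congr fun x => ?_
  rw [mem_Iio] at hh
  rw [hw, indicator_of_mem (show ((s, x) : ℝ × ℝ) + (h, 0) ∈ Iio (τ + 1) ×ˢ univ from
      ⟨by simp; linarith [hs.2], trivial⟩),
    indicator_of_mem (show ((s, x) : ℝ × ℝ) ∈ Iio (τ + 1) ×ˢ univ from
      ⟨by rw [mem_Iio]; linarith [hs.2], trivial⟩)]
  simp

/-- On a set of times of full measure the slices of a solution are uniformly continuous in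
`L¹`, away from `t = 0`. -/
theorem IsSolution.exists_good_times (hu : IsSolution u) : ∃ S ⊆ Ioi (0 : ℝ),
    (∀ᵐ t, 0 < t → t ∈ S) ∧ (∀ t ∈ S, Integrable fun x => u (t, x)) ∧
    ∀ τ : ℝ, 0 < τ → ∀ ε : ℝ≥0∞, 0 < ε → ∃ δ : ℝ, 0 < δ ∧ ∀ s ∈ S, ∀ t ∈ S, τ < s → τ < t →
      |s - t| < δ → ∫⁻ x, ‖u (s, x) - u (t, x)‖ₑ ≤ ε := by
  have hum := hu.measurable
  have hae : ∀ j : ℕ, ∀ᵐ t, ∀ᵐ t', ((j : ℝ) + 1)⁻¹ < t → t ≤ t' →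
      ENNReal.ofReal ((j : ℝ) + 1)⁻¹ * (∫⁻ x, ‖u (t', x) - u (t, x)‖ₑ) ≤
        ∫⁻ s in Ioo 0 ((j : ℝ) + 1)⁻¹, shiftDist u (t' - t) s := by
    intro j
    set τ : ℝ := ((j : ℝ) + 1)⁻¹ with hτ
    have hm1 := measurable_shiftDist hum
    have hm2 : Measurable fun h => ∫⁻ s in Ioo 0 τ, shiftDist u h s := by
      have : Measurable fun q : ℝ × ℝ => shiftDist u q.1 q.2 := hm1.comp measurable_swap
      exact this.lintegral_prod_right'
    have hms : MeasurableSet {z : ℝ × ℝ | 0 ≤ z.1 → τ < z.2 →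
        ENNReal.ofReal τ * shiftDist u z.1 z.2 ≤ ∫⁻ s in Ioo 0 τ, shiftDist u z.1 s} := by
      have a1 : MeasurableSet {z : ℝ × ℝ | 0 ≤ z.1} := measurableSet_le measurable_const
        measurable_fst
      have a2 : MeasurableSet {z : ℝ × ℝ | τ < z.2} := measurableSet_lt measurable_const
        measurable_snd
      have a3 : MeasurableSet {z : ℝ × ℝ | ENNReal.ofReal τ * shiftDist u z.1 z.2 ≤
          ∫⁻ s in Ioo 0 τ, shiftDist u z.1 s} :=
        measurableSet_le ((hm1.comp measurable_swap).const_mul _) (hm2.comp measurable_fst)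
      exact a1.imp (a2.imp a3)
    have h1 : ∀ᵐ h : ℝ, ∀ᵐ t : ℝ, 0 ≤ h → τ < t →
        ENNReal.ofReal τ * shiftDist u h t ≤ ∫⁻ s in Ioo 0 τ, shiftDist u h s := by
      refine Eventually.of_forall fun h => ?_
      by_cases hh : 0 ≤ h
      · filter_upwards [hu.ae_mul_shiftDist_le (τ := τ) hh] with t ht _ using ht
      · exact Eventually.of_forall fun t h0 => absurd h0 hh
    -- By Fubini, for almost every `t` the estimate holds at almost every later time `t' = t + h`.
    have h2 := (Measure.ae_ae_comm hms).1 h1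
    filter_upwards [h2] with t ht
    have h3 := (measurePreserving_sub_right volume t).quasiMeasurePreserving.ae ht
    filter_upwards [h3] with t' ht' a b
    have := ht' (sub_nonneg.2 b) a
    simpa [shiftDist] using this
  refine ⟨{t | 0 < t ∧ (Integrable fun x => u (t, x)) ∧ ∀ j : ℕ, ∀ᵐ t', ((j : ℝ) + 1)⁻¹ < t →
    t ≤ t' → ENNReal.ofReal ((j : ℝ) + 1)⁻¹ * (∫⁻ x, ‖u (t', x) - u (t, x)‖ₑ) ≤
        ∫⁻ s in Ioo 0 ((j : ℝ) + 1)⁻¹, shiftDist u (t' - t) s}, fun t ht => ht.1, ?_,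
    fun t ht => ht.2.1, fun τ hτ ε hε => ?_⟩
  · filter_upwards [hu.ae_integrable_slice, ae_all_iff.2 hae] with t h1 h2 h0
    exact ⟨h0, h1, h2⟩
  obtain ⟨j, hj⟩ := exists_nat_gt τ⁻¹
  set σ : ℝ := ((j : ℝ) + 1)⁻¹ with hσ
  have hσ0 : 0 < σ := by positivity
  have hστ : σ < τ := by
    rw [hσ, inv_lt_comm₀ (by positivity) hτ]; linarith
  have hε2 : 0 < ENNReal.ofReal σ * (ε / 2) := by
    refine ENNReal.mul_pos (by simpa using hσ0) ?_
    simpa using hε.ne'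
  obtain ⟨δ, hδ, hball⟩ := Metric.eventually_nhds_iff.1
    (ENNReal.tendsto_nhds_zero.1 (hu.tendsto_lintegral_shiftDist σ) _ hε2)
  refine ⟨δ / 2, by positivity, fun s hs t ht hsτ htτ hst => ?_⟩
  -- A later time, close to both, at which both estimates hold.
  have hex : ∃ r, max s t < r ∧ r < max s t + δ / 2 ∧
      ENNReal.ofReal σ * (∫⁻ x, ‖u (r, x) - u (s, x)‖ₑ) ≤
        ∫⁻ z in Ioo 0 σ, shiftDist u (r - s) z ∧
      ENNReal.ofReal σ * (∫⁻ x, ‖u (r, x) - u (t, x)‖ₑ) ≤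
        ∫⁻ z in Ioo 0 σ, shiftDist u (r - t) z := by
    have h1 := (hs.2.2 j).and (ht.2.2 j)
    have hpos : (volume.restrict (Ioo (max s t) (max s t + δ / 2))) ≠ 0 := by
      rw [Ne, Measure.restrict_eq_zero]
      simp [hδ]
    have : (ae (volume.restrict (Ioo (max s t) (max s t + δ / 2)))).NeBot := ae_neBot.2 hpos
    have h2 : ∀ᵐ r ∂(volume.restrict (Ioo (max s t) (max s t + δ / 2))), _ := ae_restrict_of_ae h1
    obtain ⟨r, hr⟩ := ((ae_restrict_mem measurableSet_Ioo).and h2).exists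
    exact ⟨r, hr.1.1, hr.1.2, hr.2.1 (hστ.trans hsτ) ((le_max_left _ _).trans hr.1.1.le),
      hr.2.2 (hστ.trans htτ) ((le_max_right _ _).trans hr.1.1.le)⟩
  obtain ⟨r, hr1, hr2, hrs, hrt⟩ := hex
  have hst' := abs_lt.1 hst
  have hb : ∀ {z}, z = s ∨ z = t → dist (r - z) 0 < δ := by
    intro z hz
    rw [Real.dist_0_eq_abs, abs_lt]
    rcases max_cases s t with ⟨hm, -⟩ | ⟨hm, -⟩ <;> rw [hm] at hr1 hr2 <;>
      rcases hz with rfl | rfl <;> constructor <;> linarith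
  have hcancel : ∀ {a : ℝ≥0∞}, ENNReal.ofReal σ * a ≤ ENNReal.ofReal σ * (ε / 2) → a ≤ ε / 2 :=
    fun h => (ENNReal.mul_le_mul_iff_right (by simpa using hσ0) ENNReal.ofReal_ne_top).1 h
  have h1 := hcancel (hrs.trans (hball (hb (Or.inl rfl))))
  have h2 := hcancel (hrt.trans (hball (hb (Or.inr rfl))))
  calc ∫⁻ x, ‖u (s, x) - u (t, x)‖ₑ
      ≤ ∫⁻ x, (‖u (r, x) - u (s, x)‖ₑ + ‖u (r, x) - u (t, x)‖ₑ) := by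
        refine lintegral_mono fun x => ?_
        rw [← enorm_neg (u (r, x) - u (s, x)), neg_sub]
        refine le_trans (le_of_eq ?_) (enorm_add_le _ _)
        congr 1; ring
    _ = (∫⁻ x, ‖u (r, x) - u (s, x)‖ₑ) + ∫⁻ x, ‖u (r, x) - u (t, x)‖ₑ :=
        lintegral_add_left (by fun_prop) _
    _ ≤ ε / 2 + ε / 2 := add_le_add h1 h2
    _ = ε := ENNReal.add_halves ε

end

/-- The space `L¹(0, ∞)`. -/
noncomputable abbrev HalfLineL1 := Lp ℝ 1 (volume.restrict (Ioi (0 : ℝ)))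

/-- `U` is a version of `u`, continuous in time with values in `L¹(0, ∞)` for positive times;
the two agree at the times of the set `S`, which has full measure. -/
structure IsVersion (u : ℝ × ℝ → ℝ) (S : Set ℝ) (U : ℝ → HalfLineL1) : Prop where
  subset : S ⊆ Ioi 0
  full : ∀ᵐ t, 0 < t → t ∈ S
  integrable : ∀ t ∈ S, Integrable fun x => u (t, x)
  eq : ∀ t ∈ S, U t =ᵐ[volume.restrict (Ioi (0 : ℝ))] fun x => u (t, x)
  continuousOn : ContinuousOn U (Ioi 0)

section
variable {u : ℝ × ℝ → ℝ} {S : Set ℝ} {U : ℝ → HalfLineL1}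

theorem nhdsWithin_neBot_of_full (hS : ∀ᵐ t : ℝ, 0 < t → t ∈ S) {t : ℝ} (ht : 0 ≤ t) :
    (𝓝[S ∩ Ioi t] t).NeBot := by
  rw [← mem_closure_iff_nhdsWithin_neBot, Metric.mem_closure_iff]
  intro ε hε
  have hpos : (volume.restrict (Ioo t (t + ε))) ≠ 0 := by
    rw [Ne, Measure.restrict_eq_zero]
    simp [hε]
  have : (ae (volume.restrict (Ioo t (t + ε)))).NeBot := ae_neBot.2 hpos
  have h2 : ∀ᵐ r ∂(volume.restrict (Ioo t (t + ε))), 0 < r → r ∈ S := ae_restrict_of_ae hS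
  obtain ⟨r, hr⟩ := ((ae_restrict_mem measurableSet_Ioo).and h2).exists
  refine ⟨r, ⟨hr.2 (ht.trans_lt hr.1.1), hr.1.1⟩, ?_⟩
  rw [dist_comm, Real.dist_eq, abs_lt]
  constructor <;> linarith [hr.1.1, hr.1.2]

theorem IsSolution.exists_isVersion (hu : IsSolution u) :
    ∃ (S : Set ℝ) (U : ℝ → HalfLineL1), IsVersion u S U := by
  classical
  obtain ⟨S, hS0, hSfull, hSi, hSc⟩ := hu.exists_good_times
  have hSi' : ∀ t ∈ S, MemLp (fun x => u (t, x)) 1 (volume.restrict (Ioi (0 : ℝ))) :=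
    fun t ht => memLp_one_iff_integrable.2 (hSi t ht).restrict
  set f : ℝ → HalfLineL1 := fun t => if ht : t ∈ S then (hSi' t ht).toLp else 0 with hf
  have hfS : ∀ t (ht : t ∈ S), f t = (hSi' t ht).toLp := fun t ht => by simp [hf, ht]
  have hne : ∀ t ∈ Ioi (0 : ℝ), (𝓝[S] t).NeBot := fun t ht =>
    (nhdsWithin_neBot_of_full hSfull (le_of_lt ht)).mono (nhdsWithin_mono _ inter_subset_left)
  have hdist : ∀ τ : ℝ, 0 < τ → ∀ ε : ℝ≥0∞, 0 < ε → ∃ δ : ℝ, 0 < δ ∧ ∀ s ∈ S, ∀ t ∈ S, τ < s →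
      τ < t → |s - t| < δ → edist (f s) (f t) ≤ ε := by
    intro τ hτ ε hε
    obtain ⟨δ, hδ, h⟩ := hSc τ hτ ε hε
    refine ⟨δ, hδ, fun s hs t ht h1 h2 h3 => ?_⟩
    rw [hfS s hs, hfS t ht, Lp.edist_toLp_toLp, eLpNorm_one_eq_lintegral_enorm]
    exact (setLIntegral_le_lintegral _ _).trans (h s hs t ht h1 h2 h3)
  have hlim : ∀ t ∈ Ioi (0 : ℝ), ∃ y, Tendsto f (𝓝[S] t) (𝓝 y) := by
    intro t ht
    have := hne t ht
    rw [mem_Ioi] at ht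
    refine cauchy_map_iff_exists_tendsto.1 (EMetric.cauchy_iff.2 ⟨map_neBot.ne, fun ε hε => ?_⟩)
    obtain ⟨δ, hδ, h⟩ := hdist (t / 2) (by positivity) (ε / 2) (ENNReal.half_pos hε.ne')
    refine ⟨f '' (S ∩ (Ioi (t / 2) ∩ Metric.ball t (δ / 2))), image_mem_map ?_, ?_⟩
    · exact inter_mem self_mem_nhdsWithin (mem_nhdsWithin_of_mem_nhds
        (inter_mem (Ioi_mem_nhds (by linarith)) (Metric.ball_mem_nhds _ (by positivity))))
    · rintro _ ⟨a, ⟨ha, ha1, ha2⟩, rfl⟩ _ ⟨b, ⟨hb, hb1, hb2⟩, rfl⟩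
      have hab : |a - b| < δ := by
        have := dist_triangle_right a b t
        rw [Metric.mem_ball] at ha2 hb2
        rw [← Real.dist_eq]; linarith
      rcases eq_or_ne ε ⊤ with h' | h'
      · rw [h']; exact edist_lt_top _ _
      · exact (h a ha b hb ha1 hb1 hab).trans_lt (ENNReal.half_lt_self hε.ne' h')
  have hself : ∀ t ∈ S, Tendsto f (𝓝[S] t) (𝓝 (f t)) := by
    intro t ht
    have ht0 : 0 < t := hS0 ht
    rw [EMetric.tendsto_nhds]
    intro ε hε
    rcases eq_or_ne ε ⊤ with h' | h'
    · exact Eventually.of_forall fun _ => h' ▸ edist_lt_top _ _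
    obtain ⟨δ, hδ, h⟩ := hdist (t / 2) (by positivity) (ε / 2) (ENNReal.half_pos hε.ne')
    filter_upwards [self_mem_nhdsWithin, mem_nhdsWithin_of_mem_nhds (inter_mem
      (Ioi_mem_nhds (show t / 2 < t by linarith)) (Metric.ball_mem_nhds t hδ))] with s hs hs'
    refine (h s hs t ht hs'.1 (by linarith) ?_).trans_lt (ENNReal.half_lt_self hε.ne' h')
    have := hs'.2
    rwa [Metric.mem_ball, Real.dist_eq] at this
  have hcl : Ioi 0 ⊆ closure S := fun t ht => mem_closure_iff_nhdsWithin_neBot.2 (hne t ht)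
  refine ⟨S, extendFrom S f, hS0, hSfull, hSi, fun t ht => ?_, continuousOn_extendFrom hcl hlim⟩
  rw [extendFrom_eq (hcl (hS0 ht)) (hself t ht), hfS t ht]
  exact MemLp.coeFn_toLp _

theorem HalfLineL1.integrable (w : HalfLineL1) : IntegrableOn w (Ioi 0) := L1.integrable_coeFn w

theorem HalfLineL1.dist_eq (w w' : HalfLineL1) : dist w w' = ∫ x in Ioi (0 : ℝ), |w x - w' x| := by
  rw [dist_eq_norm, L1.norm_eq_integral_norm]
  refine integral_congr_ae ?_
  filter_upwards [Lp.coeFn_sub w w'] with x hx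
  rw [hx, Pi.sub_apply, Real.norm_eq_abs]

theorem IsVersion.nhdsWithin_neBot (hU : IsVersion u S U) {t : ℝ} (ht : 0 < t) :
    (𝓝[S] t).NeBot :=
  (nhdsWithin_neBot_of_full hU.full ht.le).mono (nhdsWithin_mono _ inter_subset_left)

theorem IsVersion.tendsto (hU : IsVersion u S U) {t : ℝ} (ht : 0 < t) :
    Tendsto U (𝓝[S] t) (𝓝 (U t)) :=
  ((hU.continuousOn t ht).mono hU.subset)

theorem IsVersion.nonneg (hU : IsVersion u S U) (hu : ∀ p, 0 ≤ u p) {t : ℝ} (ht : 0 < t) :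
    0 ≤ U t := by
  have := hU.nhdsWithin_neBot ht
  refine ge_of_tendsto (hU.tendsto ht) ?_
  filter_upwards [self_mem_nhdsWithin] with s hs
  rw [← Lp.coeFn_nonneg]
  filter_upwards [hU.eq s hs] with x hx
  rw [hx]; exact hu _

/-- Two functions, continuous for positive times, agree if they agree on a set of times of full
measure. -/
theorem eq_of_eqOn_full {X : Type*} [TopologicalSpace X] [T2Space X] {f g : ℝ → X} {S : Set ℝ}
    (hS : ∀ᵐ t : ℝ, 0 < t → t ∈ S) (hf : ContinuousOn f (Ioi 0)) (hg : ContinuousOn g (Ioi 0))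
    (h : ∀ t ∈ S, 0 < t → f t = g t) {t : ℝ} (ht : 0 < t) : f t = g t := by
  have := nhdsWithin_neBot_of_full hS ht.le
  have hsub : S ∩ Ioi t ⊆ Ioi 0 := fun s hs => ht.trans hs.2
  refine tendsto_nhds_unique ((hf t ht).mono hsub) (((hg t ht).mono hsub).congr' ?_)
  filter_upwards [self_mem_nhdsWithin] with s hs
  exact (h s hs.1 (ht.trans hs.2)).symm

theorem continuousOn_integral_mul {T : Set ℝ} (hU : ContinuousOn U T) {b : ℝ → ℝ}
    (hb : Measurable b) {C : ℝ} (hC : ∀ x, |b x| ≤ C) :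
    ContinuousOn (fun t => ∫ x in Ioi (0 : ℝ), U t x * b x) T := by
  have hi : ∀ w : HalfLineL1, IntegrableOn (fun x => w x * b x) (Ioi 0) := fun w =>
    (HalfLineL1.integrable w).mul_bdd hb.aestronglyMeasurable (Eventually.of_forall hC)
  have hC0 : 0 ≤ C := (abs_nonneg _).trans (hC 0)
  have hL : LipschitzWith C.toNNReal fun w : HalfLineL1 => ∫ x in Ioi (0 : ℝ), w x * b x := by
    refine LipschitzWith.of_dist_le_mul fun w w' => ?_
    rw [Real.dist_eq, ← integral_sub (hi w) (hi w'), HalfLineL1.dist_eq, Real.coe_toNNReal C hC0,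
      ← integral_const_mul]
    have h1 : Integrable (fun x => C * |w x - w' x|) (volume.restrict (Ioi (0 : ℝ))) :=
      ((HalfLineL1.integrable w).sub (HalfLineL1.integrable w')).abs.const_mul C
    rw [← Real.norm_eq_abs]
    refine norm_integral_le_of_norm_le h1 (Eventually.of_forall fun x => ?_)
    rw [← sub_mul, norm_mul, mul_comm, Real.norm_eq_abs, Real.norm_eq_abs]
    exact mul_le_mul_of_nonneg_right (hC x) (abs_nonneg _)
  exact hL.continuous.comp_continuousOn hU

theorem continuousOn_intervalIntegral {k : ℝ → ℝ} (hk : ∀ a b, 0 < a → IntegrableOn k (Icc a b))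
    {c : ℝ} (hc : 0 < c) : ContinuousOn (fun t => ∫ r in c..t, k r) (Ioi 0) := by
  intro t ht
  rw [mem_Ioi] at ht
  have hmin : 0 < min c t / 2 := by positivity
  have h1 : IntegrableOn k (uIcc (min c t / 2) (max c t + 1)) := by
    rw [uIcc_of_le (by linarith [min_le_max (a := c) (b := t)])]
    exact hk _ _ hmin
  have h2 := intervalIntegral.continuousOn_primitive_interval' (a := c)
    h1.intervalIntegrable (by
      rw [uIcc_of_le (by linarith [min_le_max (a := c) (b := t)])]
      constructor <;> linarith [min_le_left c t, le_max_left c t])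
  rw [uIcc_of_le (by linarith [min_le_max (a := c) (b := t)])] at h2
  have h3 : Icc (min c t / 2) (max c t + 1) ∈ 𝓝 t := Icc_mem_nhds
    (by linarith [min_le_right c t]) (by linarith [le_max_right c t])
  exact (h2.continuousAt h3).continuousWithinAt

/-- The weak formulation, tested in space only. -/
theorem IsVersion.integral_sub_eq (hU : IsVersion u S U) (hu : IsSolution u) {β : ℝ → ℝ}
    (hβ : IsTest β) {s t : ℝ} (hs : 0 < s) (hst : s < t) :
    (∫ x in Ioi (0 : ℝ), U t x * β x) - ∫ x in Ioi (0 : ℝ), U s x * β x =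
      ∫ r in s..t, ∫ x, flux x (u (r, x)) * deriv β x := by
  set k : ℝ → ℝ := fun r => ∫ x, flux x (u (r, x)) * deriv β x with hk
  have hki : ∀ a b, 0 < a → IntegrableOn k (Icc a b) := fun a b ha =>
    hu.isLocInt_flux.integrableOn_integral_snd hβ.isCutoff_deriv ha
  have hgi : ∀ a b, 0 < a → IntegrableOn (fun t => ∫ x, u (t, x) * β x) (Icc a b) :=
    fun a b ha => hu.isLocInt.integrableOn_integral_snd hβ.isCutoff ha
  obtain ⟨S', hS', heq⟩ := exists_ae_eq_of_forall_test hgi hki fun α hα => by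
    have h := hu.weak _ (hα.contDiff_prodMul hβ) (hα.hasCompactSupport_prodMul hβ)
      (hα.tsupport_prodMul_subset_quadrant hβ)
    simp only [hα.dt_prodMul hβ, hα.dx_prodMul hβ] at h
    rw [integral_add (hu.isLocInt.integrable_mul hα.isCutoff_deriv hβ.isCutoff)
      (hu.isLocInt_flux.integrable_mul hα.isCutoff hβ.isCutoff_deriv),
      hu.isLocInt.integral_mul' hα.isCutoff_deriv hβ.isCutoff,
      hu.isLocInt_flux.integral_mul' hα.isCutoff hβ.isCutoff_deriv, ← integral_add] at h
    · exact h
    · exact hα.isCutoff_deriv.integrable_mul_of_integrableOn hgi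
    · exact hα.isCutoff.integrable_mul_of_integrableOn hki
  have hg : ∀ t ∈ S, ∫ x in Ioi (0 : ℝ), U t x * β x = ∫ x, u (t, x) * β x := by
    intro t ht
    have h0 : ∀ x ∉ Ioi (0 : ℝ), u (t, x) * β x = 0 := fun x hx => by
      rw [image_eq_zero_of_notMem_tsupport fun h => hx (hβ.pos h), mul_zero]
    rw [← setIntegral_eq_integral_of_forall_compl_eq_zero h0]
    refine integral_congr_ae ?_
    filter_upwards [hU.eq t ht] with x hx
    rw [hx]
  obtain ⟨C, hC0, hC⟩ := hβ.isCutoff.exists_bound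
  have hSS : ∀ᵐ t : ℝ, 0 < t → t ∈ S ∩ S' := by
    filter_upwards [hU.full, hS'] with t h1 h2 h0 using ⟨h1 h0, h2⟩
  have hne := nhdsWithin_neBot_of_full hSS zero_le_one
  obtain ⟨c, hc⟩ := (eventually_mem_nhdsWithin (a := (1 : ℝ)) (s := (S ∩ S') ∩ Ioi 1)).exists
  have hc0 : 0 < c := one_pos.trans hc.2
  have hii : ∀ {a b : ℝ}, 0 < a → 0 < b → IntervalIntegrable k volume a b := by
    intro a b ha hb
    refine IntegrableOn.intervalIntegrable ?_
    exact hki _ _ (lt_min ha hb)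
  have key : ∀ t, 0 < t → ∫ x in Ioi (0 : ℝ), U t x * β x =
      (∫ x in Ioi (0 : ℝ), U c x * β x) + ∫ r in c..t, k r := by
    intro t ht
    refine eq_of_eqOn_full hSS (continuousOn_integral_mul hU.continuousOn
      hβ.continuous.measurable hC) (continuousOn_const.add (continuousOn_intervalIntegral hki hc0))
      (fun r hr hr0 => ?_) ht
    change _ = (∫ x in Ioi (0 : ℝ), U c x * β x) + ∫ r in c..r, k r
    rw [hg r hr.1, hg c hc.1.1]
    rcases lt_trichotomy r c with h | h | h
    · rw [heq r hr.2 c hc.1.2 hr0 h, intervalIntegral.integral_symm r c]; ring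
    · simp [h]
    · exact heq c hc.1.2 r hr.2 hc0 h
  have ht := hs.trans hst
  rw [key t ht, key s hs, ← intervalIntegral.integral_add_adjacent_intervals (hii hs hc0)
    (hii hc0 ht), intervalIntegral.integral_symm c s]
  ring

end

/-! ### The balance law on the half-lines `(x, ∞)` -/

/-- The photon number in `(x, ∞)`. -/
noncomputable def tail (w : HalfLineL1) (x : ℝ) : ℝ := ∫ z in Ioi x, w z

theorem HalfLineL1.integrableOn_Ioi (w : HalfLineL1) {x : ℝ} (hx : 0 ≤ x) :
    IntegrableOn w (Ioi x) := (HalfLineL1.integrable w).mono_set (Ioi_subset_Ioi hx)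

theorem abs_tail_sub_le (w w' : HalfLineL1) {x : ℝ} (hx : 0 ≤ x) :
    |tail w x - tail w' x| ≤ dist w w' := by
  rw [tail, tail, ← integral_sub (HalfLineL1.integrableOn_Ioi w hx) (HalfLineL1.integrableOn_Ioi w' hx),
    HalfLineL1.dist_eq]
  refine (abs_integral_le_integral_abs).trans (setIntegral_mono_set ?_ ?_ ?_)
  · exact ((HalfLineL1.integrable w).sub (HalfLineL1.integrable w')).abs
  · exact Eventually.of_forall fun _ => abs_nonneg _
  · exact (Ioi_subset_Ioi hx).eventuallyLE

theorem continuous_tail {x : ℝ} (hx : 0 ≤ x) : Continuous fun w => tail w x := by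
  refine (LipschitzWith.of_dist_le_mul (K := 1) fun w w' => ?_).continuous
  rw [Real.dist_eq, NNReal.coe_one, one_mul]
  exact abs_tail_sub_le w w' hx

theorem tail_nonneg {w : HalfLineL1} (hw : 0 ≤ w) {x : ℝ} (hx : 0 ≤ x) : 0 ≤ tail w x := by
  refine setIntegral_nonneg_of_ae_restrict ?_
  exact ae_mono (Measure.restrict_mono (Ioi_subset_Ioi hx) le_rfl) ((Lp.coeFn_nonneg w).2 hw)

theorem tendsto_tail_atTop (w : HalfLineL1) : Tendsto (tail w) atTop (𝓝 0) := by
  have h := intervalIntegral_tendsto_integral_Ioi 0 (HalfLineL1.integrable w) tendsto_id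
  have h2 := tendsto_const_nhds.sub h (a := ∫ z in Ioi (0 : ℝ), w z)
  rw [sub_self] at h2
  refine h2.congr' ?_
  filter_upwards [eventually_ge_atTop 0] with x hx
  rw [tail, id, ← intervalIntegral.integral_Ioi_sub_Ioi (HalfLineL1.integrable w) hx]
  ring

theorem tendsto_tail_zero (w : HalfLineL1) : Tendsto (tail w) (𝓝[>] 0) (𝓝 (tail w 0)) := by
  have hi : IntegrableOn w (Ioc 0 1) := (HalfLineL1.integrable w).mono_set Ioc_subset_Ioi_self
  have h := intervalIntegral.continuousOn_primitive_interval' (a := 0) (b₁ := 0) (b₂ := 1)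
    ((intervalIntegrable_iff_integrableOn_Ioc_of_le zero_le_one).2 hi) (by simp)
  have h1 : Tendsto (fun x => ∫ z in (0 : ℝ)..x, w z) (𝓝[>] 0) (𝓝 0) := by
    have h3 := h 0 (by simp)
    rw [ContinuousWithinAt, intervalIntegral.integral_same, uIcc_of_le zero_le_one] at h3
    refine h3.mono_left (nhdsWithin_le_iff.2 ?_)
    filter_upwards [Ioo_mem_nhdsGT (zero_lt_one' ℝ)] with x hx using ⟨hx.1.le, hx.2.le⟩
  have h2 := tendsto_const_nhds.sub h1 (a := tail w 0)
  rw [sub_zero] at h2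
  refine h2.congr' ?_
  filter_upwards [self_mem_nhdsWithin] with x hx
  rw [tail, ← intervalIntegral.integral_Ioi_sub_Ioi (HalfLineL1.integrable w) (le_of_lt hx)]
  rw [tail]; ring

instance atTop_inf_ae_neBot : (atTop ⊓ ae (volume : Measure ℝ)).NeBot := by
  refine inf_neBot_iff.2 fun {s} hs {t} ht => ?_
  obtain ⟨a, ha⟩ := mem_atTop_sets.1 hs
  have hpos : (volume.restrict (Ioi a)) ≠ 0 := by
    rw [Ne, Measure.restrict_eq_zero]
    simp
  have : (ae (volume.restrict (Ioi a))).NeBot := ae_neBot.2 hpos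
  have h2 : ∀ᵐ r ∂(volume.restrict (Ioi a)), r ∈ t := ae_restrict_of_ae ht
  obtain ⟨r, hr, hr'⟩ := ((ae_restrict_mem measurableSet_Ioi).and h2).exists
  exact ⟨r, ha r (le_of_lt hr), hr'⟩

section
variable {u : ℝ × ℝ → ℝ} {S : Set ℝ} {U : ℝ → HalfLineL1}

theorem IsKruzkovSolution.integrableOn_flux_prod (hu : IsKruzkovSolution u) {s t a b : ℝ}
    (hs : 0 < s) (ha : 0 < a) :
    Integrable (fun p : ℝ × ℝ => flux p.2 (u p))
      ((volume.restrict (Ioc s t)).prod (volume.restrict (Icc a b))) := by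
  rw [Measure.prod_restrict, ← Measure.volume_eq_prod]
  exact (hu.isLocInt_flux (Icc s t ×ˢ Icc a b) (Set.prod_mono (fun x hx => hs.trans_le hx.1)
    fun x hx => ha.trans_le hx.1) (isCompact_Icc.prod isCompact_Icc)).mono_set
    (Set.prod_mono Ioc_subset_Icc_self subset_rfl)

/-- In the sense of distributions, the `x`-derivative of the flux through `x` in the time interval
`(s, t)` is `U s - U t`. -/
theorem IsVersion.integral_flux_mul_deriv (hU : IsVersion u S U) (hu : IsSolution u) {s t : ℝ}
    (hs : 0 < s) (hst : s < t) {β : ℝ → ℝ} (hβ : IsTest β) :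
    ∫ x, ((∫ r in s..t, flux x (u (r, x))) * deriv β x + (U s x - U t x) * β x) = 0 := by
  obtain ⟨c, d, hc, -, hcd⟩ := hβ.isCutoff.exists_Icc
  have hgi : ∀ a b, 0 < a → IntegrableOn (fun x => ∫ r in s..t, flux x (u (r, x))) (Icc a b) := by
    intro a b ha
    simp only [intervalIntegral.integral_of_le hst.le]
    exact (hu.integrableOn_flux_prod hs ha).integral_prod_right
  have hUi : ∀ w : HalfLineL1, Integrable fun x => w x * β x := fun w =>
    hβ.isCutoff.integrable_mul_of_integrableOn fun a b ha =>
      (HalfLineL1.integrable w).mono_set fun x hx => ha.trans_le hx.1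
  have hset : ∀ w : HalfLineL1, ∫ x in Ioi (0 : ℝ), w x * β x = ∫ x, w x * β x := fun w =>
    setIntegral_eq_integral_of_forall_compl_eq_zero fun x hx => by
      rw [image_eq_zero_of_notMem_tsupport fun h => hx (hβ.pos h), mul_zero]
  have h := hU.integral_sub_eq hu hβ hs hst
  rw [hset, hset, intervalIntegral.integral_of_le hst.le] at h
  have hd : ∀ x ∉ Icc c d, deriv β x = 0 := fun x hx =>
    image_eq_zero_of_notMem_tsupport fun h => hx (hcd (tsupport_deriv_subset h))
  have hswap : ∫ r in Ioc s t, ∫ x, flux x (u (r, x)) * deriv β x =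
      ∫ x, (∫ r in s..t, flux x (u (r, x))) * deriv β x := by
    obtain ⟨C, -, hC⟩ := hβ.isCutoff_deriv.exists_bound
    have hint : Integrable (fun p : ℝ × ℝ => flux p.2 (u p) * deriv β p.2)
        ((volume.restrict (Ioc s t)).prod (volume.restrict (Icc c d))) :=
      (hu.integrableOn_flux_prod hs hc).mul_bdd
        (hβ.continuous_deriv.comp continuous_snd).aestronglyMeasurable
        (Eventually.of_forall fun p => hC p.2)
    have h1 : ∀ r, ∫ x, flux x (u (r, x)) * deriv β x =
        ∫ x in Icc c d, flux x (u (r, x)) * deriv β x := fun r =>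
      (setIntegral_eq_integral_of_forall_compl_eq_zero fun x hx => by
        rw [hd x hx, mul_zero]).symm
    simp only [h1]
    rw [integral_integral_swap (f := fun r x => flux x (u (r, x)) * deriv β x) hint]
    have h2 : ∀ x ∉ Icc c d, (∫ r in s..t, flux x (u (r, x))) * deriv β x = 0 := fun x hx => by
      rw [hd x hx, mul_zero]
    rw [← setIntegral_eq_integral_of_forall_compl_eq_zero h2]
    refine integral_congr_ae (Eventually.of_forall fun x => ?_)
    dsimp only
    rw [integral_mul_const, intervalIntegral.integral_of_le hst.le]
  rw [hswap] at h
  have h3 : Integrable fun x => (U s x - U t x) * β x := by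
    simp only [sub_mul]
    exact (hUi (U s)).sub (hUi (U t))
  have h4 : ∫ x, (U s x - U t x) * β x = (∫ x, U s x * β x) - ∫ x, U t x * β x := by
    simp only [sub_mul]
    exact integral_sub (hUi (U s)) (hUi (U t))
  rw [integral_add (hβ.isCutoff_deriv.integrable_mul_of_integrableOn hgi) h3, h4]
  linarith

/-- The mass in `(x, ∞)` changes by the flux through `x`, because there is no flux at infinity. -/
theorem IsVersion.ae_tail_sub_eq (hU : IsVersion u S U) (hu : IsSolution u) {s t : ℝ}
    (hs : 0 < s) (hst : s < t) :
    ∀ᵐ x, 0 < x → tail (U t) x - tail (U s) x = ∫ r in s..t, flux x (u (r, x)) := by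
  set g : ℝ → ℝ := fun x => ∫ r in s..t, flux x (u (r, x)) with hg
  have hgi : ∀ a b, 0 < a → IntegrableOn g (Icc a b) := by
    intro a b ha
    simp only [hg, intervalIntegral.integral_of_le hst.le]
    exact (hu.integrableOn_flux_prod hs ha).integral_prod_right
  have hki : ∀ a : ℝ, 0 < a → IntegrableOn (fun x => U s x - U t x) (Ioi a) := fun a ha =>
    (HalfLineL1.integrableOn_Ioi (U s) ha.le).sub (HalfLineL1.integrableOn_Ioi (U t) ha.le)
  obtain ⟨N, hN, hNg⟩ := exists_ae_eq_of_forall_test hgi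
    (fun a b ha => (hki (a / 2) (by positivity)).mono_set fun x hx => by
      rw [mem_Ioi]; linarith [hx.1])
    fun β hβ => hU.integral_flux_mul_deriv hu hs hst hβ
  have hg0 : Tendsto g (atTop ⊓ ae volume) (𝓝 0) := by
    rw [tendsto_zero_iff_enorm_tendsto_zero]
    refine tendsto_of_tendsto_of_tendsto_of_le_of_le tendsto_const_nhds
      (hu.flux_infinity (t + 1) (by linarith)) (fun _ => zero_le) fun x => ?_
    simp only [hg, intervalIntegral.integral_of_le hst.le]
    refine (enorm_integral_le_lintegral_enorm _).trans (lintegral_mono_set fun r hr => ?_)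
    exact ⟨hs.trans hr.1, by linarith [hr.2]⟩
  filter_upwards [hN] with x hx hx0
  have h1 : Tendsto (fun y => ∫ z in x..y, (U s z - U t z)) (atTop ⊓ ae volume)
      (𝓝 (∫ z in Ioi x, (U s z - U t z))) :=
    (intervalIntegral_tendsto_integral_Ioi x (hki x hx0) tendsto_id).mono_left inf_le_left
  have h2 : (fun y => g x + ∫ z in x..y, (U s z - U t z)) =ᶠ[atTop ⊓ ae volume] g := by
    filter_upwards [mem_inf_of_left (Ioi_mem_atTop x), mem_inf_of_right hN] with y hy hyN
    exact (hNg x hx y hyN hx0 hy).symm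
  have h3 := tendsto_nhds_unique (hg0.congr' h2.symm) (h1.const_add (g x))
  rw [integral_sub (HalfLineL1.integrableOn_Ioi (U s) hx0.le) (HalfLineL1.integrableOn_Ioi (U t) hx0.le)] at h3
  simp only [tail]
  linarith

end

/-! ### Continuity at the initial time -/

section
variable {u : ℝ × ℝ → ℝ} {S : Set ℝ} {U : ℝ → HalfLineL1}

theorem IsLocInt.ae_integrableOn_slice {A : ℝ × ℝ → ℝ} (hA : IsLocInt A) :
    ∀ᵐ x, 0 < x → ∀ a b, 0 < a → IntegrableOn (fun r => A (r, x)) (Icc a b) := by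
  have h : ∀ j : ℕ, ∀ᵐ x, x ∈ Icc ((j : ℝ) + 1)⁻¹ (j + 1) →
      IntegrableOn (fun r => A (r, x)) (Icc ((j : ℝ) + 1)⁻¹ (j + 1)) := by
    intro j
    have hj : (0 : ℝ) < ((j : ℝ) + 1)⁻¹ := by positivity
    have hK : Icc ((j : ℝ) + 1)⁻¹ (j + 1) ×ˢ Icc ((j : ℝ) + 1)⁻¹ (j + 1) ⊆ quadrant :=
      Set.prod_mono (fun x hx => hj.trans_le hx.1) fun x hx => hj.trans_le hx.1
    have := hA _ hK (isCompact_Icc.prod isCompact_Icc)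
    rw [IntegrableOn, Measure.volume_eq_prod, ← Measure.prod_restrict] at this
    exact (ae_restrict_iff' measurableSet_Icc).1 this.prod_left_ae
  filter_upwards [ae_all_iff.2 h] with x hx hx0 a b ha
  obtain ⟨j, hj⟩ := exists_nat_gt (max (max x⁻¹ x) (max a⁻¹ b))
  have h1 : x⁻¹ < j := lt_of_le_of_lt ((le_max_left _ _).trans (le_max_left _ _)) hj
  have h2 : x < j := lt_of_le_of_lt ((le_max_right _ _).trans (le_max_left _ _)) hj
  have h3 : a⁻¹ < j := lt_of_le_of_lt ((le_max_left _ _).trans (le_max_right _ _)) hj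
  have h4 : b < j := lt_of_le_of_lt ((le_max_right _ _).trans (le_max_right _ _)) hj
  have hinv : ∀ {y : ℝ}, 0 < y → y⁻¹ < j → ((j : ℝ) + 1)⁻¹ ≤ y := fun hy h => by
    rw [inv_le_comm₀ (by positivity) hy]; linarith
  exact (hx j ⟨hinv hx0 h1, by linarith⟩).mono_set (Icc_subset_Icc (hinv ha h3) (by linarith))

/-- The null set of positions excluded from the balance law can be chosen independently of the
times: it suffices to treat rational times, both sides being continuous in time. -/
theorem IsVersion.ae_forall_tail_sub_eq (hU : IsVersion u S U) (hu : IsSolution u) :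
    ∀ᵐ x, 0 < x → ∀ s t, 0 < s → 0 < t →
      tail (U t) x - tail (U s) x = ∫ r in s..t, flux x (u (r, x)) := by
  have h1 : ∀ᵐ x, ∀ q : ℚ, (1 : ℝ) < q → 0 < x →
      tail (U q) x - tail (U 1) x = ∫ r in (1 : ℝ)..q, flux x (u (r, x)) := by
    refine ae_all_iff.2 fun q => ?_
    by_cases hq : (1 : ℝ) < q
    · filter_upwards [hU.ae_tail_sub_eq hu one_pos hq] with x hx _ using hx
    · exact Eventually.of_forall fun x h => absurd h hq
  have h2 : ∀ᵐ x, ∀ q : ℚ, (0 : ℝ) < q → (q : ℝ) < 1 → 0 < x →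
      tail (U 1) x - tail (U q) x = ∫ r in (q : ℝ)..1, flux x (u (r, x)) := by
    refine ae_all_iff.2 fun q => ?_
    by_cases hq : (0 : ℝ) < q ∧ (q : ℝ) < 1
    · filter_upwards [hU.ae_tail_sub_eq hu hq.1 hq.2] with x hx _ _ using hx
    · exact Eventually.of_forall fun x a b => absurd ⟨a, b⟩ hq
  filter_upwards [h1, h2, hu.isLocInt_flux.ae_integrableOn_slice] with x hx1 hx2 hx3 hx0 s t hs ht
  have hi : ∀ a b, 0 < a → IntegrableOn (fun r => flux x (u (r, x))) (Icc a b) := hx3 hx0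
  have key : EqOn (fun t => tail (U t) x - tail (U 1) x)
      (fun t => ∫ r in (1 : ℝ)..t, flux x (u (r, x))) (Ioi 0) := by
    refine EqOn.of_subset_closure (s := Ioi 0 ∩ range ((↑) : ℚ → ℝ)) ?_ ?_
      (continuousOn_intervalIntegral hi one_pos) inter_subset_left
      (Rat.denseRange_cast.open_subset_closure_inter isOpen_Ioi)
    · rintro _ ⟨hq0, q, rfl⟩
      dsimp only
      rcases lt_trichotomy (q : ℝ) 1 with h | h | h
      · rw [intervalIntegral.integral_symm, ← hx2 q hq0 h hx0]; ring
      · simp [h]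
      · exact hx1 q h hx0
    · exact ((continuous_tail hx0.le).comp_continuousOn hU.continuousOn).sub continuousOn_const
  have hii : ∀ {a b : ℝ}, 0 < a → 0 < b →
      IntervalIntegrable (fun r => flux x (u (r, x))) volume a b := by
    intro a b ha hb
    refine IntegrableOn.intervalIntegrable ?_
    exact hi _ _ (lt_min ha hb)
  have e1 := key hs
  have e2 := key ht
  dsimp only at e1 e2
  rw [← intervalIntegral.integral_interval_sub_left (hii one_pos ht) (hii one_pos hs), ← e1, ← e2]
  ring

/-- No mass escapes to infinity as `t → 0`, because little of it crosses a distant point `R` in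
the time interval `(0, 1)`; hence the initial data is attained in `L¹(0, ∞)`. -/
theorem IsVersion.tendsto_initial (hU : IsVersion u S U) (hu : IsSolution u) {w : HalfLineL1}
    (hw : ∀ R : ℝ, 0 < R → Tendsto (fun t : ℝ => ∫⁻ x in Ioo 0 R, ‖u (t, x) - w x‖ₑ)
      (𝓝[>] 0 ⊓ ae volume) (𝓝 0)) :
    Tendsto U (𝓝[>] 0) (𝓝 w) := by
  rw [Metric.tendsto_nhds]
  intro ε hε
  have hε' : 0 < ε / 5 := by positivity
  have hεe : 0 < ENNReal.ofReal (ε / 5) := ENNReal.ofReal_pos.2 hε'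
  obtain ⟨R, h1, h2, h3, h4, hR⟩ := ((ENNReal.tendsto_nhds_zero.1
    (hu.flux_infinity 2 two_pos) _ hεe).and
    ((((tendsto_tail_atTop (U 1)).eventually_le_const hε').filter_mono inf_le_left).and
    ((((tendsto_tail_atTop |w|).eventually_le_const hε').filter_mono inf_le_left).and
    (((hU.ae_forall_tail_sub_eq hu).filter_mono inf_le_right).and
    ((eventually_gt_atTop (0 : ℝ)).filter_mono inf_le_left))))).exists
  -- Up to the time `1`, the mass beyond `R` differs from its value at `1` by at most `ε / 5`.
  have htail : ∀ t, 0 < t → t < 1 → tail (U t) R ≤ 2 * (ε / 5) := by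
    intro t ht ht1
    have h5 := h4 hR t 1 ht one_pos
    have h6 : |∫ r in t..1, flux R (u (r, R))| ≤ ε / 5 := by
      rw [intervalIntegral.integral_of_le ht1.le, ← Real.norm_eq_abs, ← toReal_enorm]
      refine ENNReal.toReal_le_of_le_ofReal hε'.le ((enorm_integral_le_lintegral_enorm _).trans
        ((lintegral_mono_set fun r hr => ?_).trans h1))
      exact ⟨ht.trans hr.1, by linarith [hr.2]⟩
    linarith [neg_abs_le (∫ r in t..1, flux R (u (r, R)))]
  have hwR : ∫ x in Ioi R, |w x| ≤ ε / 5 := by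
    refine le_trans (le_of_eq ?_) h3
    refine integral_congr_ae (ae_mono (Measure.restrict_mono (Ioi_subset_Ioi hR.le) le_rfl) ?_)
    filter_upwards [Lp.coeFn_abs w] with x hx using hx.symm
  obtain ⟨V, hV, W, hW, hVW⟩ := mem_inf_iff_superset.1
    (ENNReal.tendsto_nhds_zero.1 (hw R hR) _ hεe)
  obtain ⟨δ, hδ, hδV⟩ := mem_nhdsGT_iff_exists_Ioo_subset.1 hV
  have hnonneg : ∀ t, 0 < t → 0 ≤ U t := fun t ht => hU.nonneg hu.nonneg ht
  have key : ∀ t, 0 < t → t < min δ 1 → t ∈ S → t ∈ W → dist (U t) w ≤ 4 * (ε / 5) := by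
    intro t ht htδ htS htW
    have hi : IntegrableOn (fun x => |U t x - w x|) (Ioi 0) :=
      ((HalfLineL1.integrable (U t)).sub (HalfLineL1.integrable w)).abs
    rw [HalfLineL1.dist_eq, ← intervalIntegral.integral_interval_add_Ioi hi
      (hi.mono_set (Ioi_subset_Ioi hR.le)), intervalIntegral.integral_of_le hR.le,
      integral_Ioc_eq_integral_Ioo]
    have e1 : ∫ x in Ioo 0 R, |U t x - w x| ≤ ε / 5 := by
      simp only [← Real.norm_eq_abs]
      have hm : AEStronglyMeasurable (fun x => U t x - w x) (volume.restrict (Ioo 0 R)) :=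
        (((HalfLineL1.integrable (U t)).sub (HalfLineL1.integrable w)).mono_set
          Ioo_subset_Ioi_self).aestronglyMeasurable
      rw [integral_norm_eq_lintegral_enorm hm]
      refine ENNReal.toReal_le_of_le_ofReal hε'.le (le_trans (le_of_eq ?_)
        (hVW ⟨hδV ⟨ht, htδ.trans_le (min_le_left _ _)⟩, htW⟩))
      refine lintegral_congr_ae
        (ae_mono (Measure.restrict_mono Ioo_subset_Ioi_self le_rfl) ?_)
      filter_upwards [hU.eq t htS] with x hx
      rw [hx]
    have hRU := HalfLineL1.integrableOn_Ioi (U t) hR.le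
    have hRw := HalfLineL1.integrableOn_Ioi w hR.le
    have e2 : ∫ x in Ioi R, |U t x - w x| ≤ tail (U t) R + ∫ x in Ioi R, |w x| := by
      rw [tail, ← integral_add hRU hRw.abs]
      refine integral_mono_ae (hRU.sub hRw).abs (hRU.add hRw.abs) ?_
      have := ae_mono (Measure.restrict_mono (Ioi_subset_Ioi hR.le) le_rfl)
        ((Lp.coeFn_nonneg _).2 (hnonneg t ht))
      filter_upwards [this] with x hx
      refine (abs_sub _ _).trans_eq ?_
      rw [abs_of_nonneg hx]
    linarith [htail t ht (htδ.trans_le (min_le_right _ _))]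
  have hfull : ∀ᵐ t : ℝ, 0 < t → t ∈ S ∩ W := by
    filter_upwards [hU.full, hW] with t a b h0 using ⟨a h0, b⟩
  filter_upwards [Ioo_mem_nhdsGT (lt_min hδ one_pos)] with t ht
  -- The estimate extends from the times in `S ∩ W` to all small times by continuity.
  have := nhdsWithin_neBot_of_full hfull ht.1.le
  have hlim : Tendsto U (𝓝[(S ∩ W) ∩ Ioi t] t) (𝓝 (U t)) :=
    (hU.continuousOn t ht.1).mono fun r hr => ht.1.trans hr.2
  refine (le_of_tendsto (hlim.dist tendsto_const_nhds) ?_).trans_lt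
    (show 4 * (ε / 5) < ε by linarith)
  filter_upwards [self_mem_nhdsWithin, mem_nhdsWithin_of_mem_nhds (Iio_mem_nhds ht.2)] with r hr hr'
  exact key r (ht.1.trans hr.2) hr' hr.1.1 hr.1.2

theorem IsSolution.exists_isVersion_initial (hu : IsSolution u) {w : HalfLineL1}
    (hw : ∀ R : ℝ, 0 < R → Tendsto (fun t : ℝ => ∫⁻ x in Ioo 0 R, ‖u (t, x) - w x‖ₑ)
      (𝓝[>] 0 ⊓ ae volume) (𝓝 0)) :
    ∃ (S : Set ℝ) (U : ℝ → HalfLineL1), IsVersion u S U ∧ ContinuousOn U (Ici 0) ∧ U 0 = w := by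
  obtain ⟨S, U, hU⟩ := hu.exists_isVersion
  have hne : ∀ t : ℝ, 0 < t → Function.update U 0 w t = U t := fun t ht =>
    Function.update_of_ne ht.ne' _ _
  have hc : ContinuousOn (Function.update U 0 w) (Ioi 0) := hU.continuousOn.congr fun t ht => hne t ht
  refine ⟨S, Function.update U 0 w, ⟨hU.subset, hU.full, hU.integrable, fun t ht => ?_, hc⟩, ?_, by
    simp⟩
  · rw [hne t (hU.subset ht)]; exact hU.eq t ht
  · intro t ht
    rcases (mem_Ici.1 ht).eq_or_lt with rfl | h
    · rw [← Ioi_insert, continuousWithinAt_insert_self, ContinuousWithinAt, Function.update_self]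
      refine (hU.tendsto_initial hu hw).congr' ?_
      filter_upwards [self_mem_nhdsWithin] with t ht using (hne t ht).symm
    · exact (hc.continuousAt (Ioi_mem_nhds h)).continuousWithinAt

end

/-! ### The balance law down to the initial time -/

/-- The positions `x` at which the square of the solution is integrable in time, and the balance
law on `(x, ∞)` holds between any two times `0 ≤ s ≤ t`. -/
structure IsGoodPosition (u : ℝ × ℝ → ℝ) (U : ℝ → HalfLineL1) (x : ℝ) : Prop where
  pos : 0 < x
  integrable : ∀ T, IntegrableOn (fun r => u (r, x)) (Ioc 0 T)
  integrable_sq : ∀ T, IntegrableOn (fun r => u (r, x) ^ 2) (Ioc 0 T)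
  balance : ∀ s t, 0 ≤ s → s ≤ t → ∫ r in s..t, u (r, x) ^ 2 =
    tail (U s) x - tail (U t) x + drift x * ∫ r in s..t, u (r, x)

theorem tendsto_intervalIntegral_left {f : ℝ → ℝ} {T : ℝ} (hT : 0 < T)
    (hf : IntegrableOn f (Ioc 0 T)) :
    Tendsto (fun s => ∫ r in s..T, f r) (𝓝[>] 0) (𝓝 (∫ r in (0 : ℝ)..T, f r)) := by
  have hi : IntervalIntegrable f volume T 0 :=
    ((intervalIntegrable_iff_integrableOn_Ioc_of_le hT.le).2 hf).symm
  have h := intervalIntegral.continuousOn_primitive_interval' hi (a := T) (by simp) 0 (by simp)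
  have h1 : Tendsto (fun s => ∫ r in T..s, f r) (𝓝[>] 0) (𝓝 (∫ r in T..0, f r)) := by
    refine h.tendsto.mono_left (nhdsWithin_le_iff.2 ?_)
    rw [uIcc_of_ge hT.le]
    filter_upwards [Ioo_mem_nhdsGT hT] with x hx using ⟨hx.1.le, hx.2.le⟩
  have h2 := h1.neg
  simp only [← intervalIntegral.integral_symm] at h2
  exact h2

section
variable {u : ℝ × ℝ → ℝ} {S : Set ℝ} {U : ℝ → HalfLineL1}

theorem IsSolution.ae_integrableOn_slice (hu : IsSolution u) :
    ∀ᵐ x, ∀ T, IntegrableOn (fun r => u (r, x)) (Ioc 0 T) := by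
  have h : ∀ j : ℕ, ∀ᵐ x, IntegrableOn (fun r => u (r, x)) (Iio (j : ℝ)) := by
    intro j
    have := hu.integrableOn_Iio j
    rw [IntegrableOn, Measure.volume_eq_prod, ← Measure.prod_restrict, Measure.restrict_univ] at this
    exact this.prod_left_ae
  filter_upwards [ae_all_iff.2 h] with x hx T
  obtain ⟨j, hj⟩ := exists_nat_gt T
  exact (hx j).mono_set fun r hr => hr.2.trans_lt hj

theorem mul_le_half_sq_add_half_sq (b a : ℝ) : b * a ≤ a ^ 2 / 2 + b ^ 2 / 2 := by
  linarith [sq_nonneg (a - b)]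

theorem IsVersion.nonneg_of_continuousOn (hU : IsVersion u S U) (hu : IsSolution u)
    (hc : ContinuousOn U (Ici 0)) {t : ℝ} (ht : 0 ≤ t) : 0 ≤ U t := by
  rcases ht.eq_or_lt with rfl | h
  · refine ge_of_tendsto ((hc 0 self_mem_Ici).mono_left (nhdsWithin_mono _ Ioi_subset_Ici_self)) ?_
    filter_upwards [self_mem_nhdsWithin] with t ht using hU.nonneg hu.nonneg ht
  · exact hU.nonneg hu.nonneg h

/-- The balance law bounds the time integral of `u ^ 2` at almost every position, uniformly down
to the initial time. -/
theorem IsVersion.ae_isGoodPosition (hU : IsVersion u S U) (hu : IsSolution u)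
    (hc : ContinuousOn U (Ici 0)) : ∀ᵐ x, 0 < x → IsGoodPosition u U x := by
  filter_upwards [hU.ae_forall_tail_sub_eq hu, hu.isLocInt_sq.ae_integrableOn_slice,
    hu.ae_integrableOn_slice] with x h1 h2 h3 hx
  have hsq : ∀ a b, 0 < a → IntegrableOn (fun r => u (r, x) ^ 2) (Ioc a b) := fun a b ha =>
    (h2 hx a b ha).mono_set Ioc_subset_Icc_self
  have hu1 : ∀ a b, 0 ≤ a → IntegrableOn (fun r => u (r, x)) (Ioc a b) := fun a b ha =>
    (h3 b).mono_set (Ioc_subset_Ioc_left ha)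
  have hbal : ∀ s t, 0 < s → s ≤ t → ∫ r in s..t, u (r, x) ^ 2 =
      tail (U s) x - tail (U t) x + drift x * ∫ r in s..t, u (r, x) := by
    intro s t hs hst
    have h4 := h1 hx s t hs (hs.trans_le hst)
    simp only [flux_eq, intervalIntegral.integral_of_le hst] at h4 ⊢
    rw [integral_sub ((hu1 s t hs.le).const_mul _) (hsq s t hs), integral_const_mul] at h4
    linarith
  have htail : Tendsto (fun s => tail (U s) x) (𝓝[>] 0) (𝓝 (tail (U 0) x)) :=
    ((continuous_tail hx.le).tendsto _).comp
      ((hc 0 self_mem_Ici).mono_left (nhdsWithin_mono _ Ioi_subset_Ici_self))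
  have hsq0 : ∀ T, IntegrableOn (fun r => u (r, x) ^ 2) (Ioc 0 T) := by
    intro T
    rcases le_or_gt T 0 with hT | hT
    · simp [Ioc_eq_empty_of_le hT]
    have hseq : Tendsto (fun n : ℕ => 1 / ((n : ℝ) + 1)) atTop (𝓝[>] 0) :=
      tendsto_nhdsWithin_iff.2 ⟨tendsto_one_div_add_atTop_nhds_zero_nat,
        Eventually.of_forall fun n => by rw [mem_Ioi]; positivity⟩
    -- Integrability at `t = 0` comes from the boundedness of the right side of the balance law.
    refine integrableOn_Ioc_of_intervalIntegral_norm_bounded_left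
      (I := tail (U 0) x + 1 - tail (U T) x + |drift x| * ∫ r in Ioc 0 T, u (r, x))
      (fun n => hsq _ T (by positivity)) (hseq.mono_right nhdsWithin_le_nhds) ?_
    filter_upwards [hseq.eventually (htail.eventually_le_const (lt_add_one _)),
      hseq.eventually (Ioo_mem_nhdsGT hT)] with n hn1 hn2
    have h4 := hbal _ T hn2.1 hn2.2.le
    simp only [intervalIntegral.integral_of_le hn2.2.le] at h4
    simp only [Real.norm_eq_abs, abs_sq]
    rw [h4]
    have h5 : ∫ r in Ioc (1 / ((n : ℝ) + 1)) T, u (r, x) ≤ ∫ r in Ioc 0 T, u (r, x) :=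
      setIntegral_mono_set (h3 T) (Eventually.of_forall fun r => hu.nonneg _)
        (Ioc_subset_Ioc_left hn2.1.le).eventuallyLE
    have h6 : 0 ≤ ∫ r in Ioc (1 / ((n : ℝ) + 1)) T, u (r, x) :=
      integral_nonneg fun r => hu.nonneg _
    have h7 : drift x * ∫ r in Ioc (1 / ((n : ℝ) + 1)) T, u (r, x) ≤
        |drift x| * ∫ r in Ioc 0 T, u (r, x) :=
      (mul_le_mul_of_nonneg_right (le_abs_self _) h6).trans
        (mul_le_mul_of_nonneg_left h5 (abs_nonneg _))
    linarith
  refine ⟨hx, h3, hsq0, fun s t hs hst => ?_⟩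
  rcases hst.eq_or_lt with rfl | hst
  · simp
  rcases hs.eq_or_lt with rfl | hs
  · have e1 := tendsto_intervalIntegral_left hst (hsq0 t)
    have e2 := (htail.sub_const (tail (U t) x)).add
      ((tendsto_intervalIntegral_left hst (h3 t)).const_mul (drift x))
    refine tendsto_nhds_unique e1 (e2.congr' ?_)
    filter_upwards [Ioo_mem_nhdsGT hst] with s hs using (hbal s t hs.1 hs.2.le).symm
  · exact hbal s t hs hst.le

variable {x : ℝ}

theorem drift_nonneg (h0 : 0 ≤ x) (h2 : x ≤ 2) : 0 ≤ drift x := by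
  rw [drift]; nlinarith

theorem drift_le_one (x : ℝ) : drift x ≤ 1 := by
  rw [drift]; nlinarith [sq_nonneg (x - 1)]

theorem drift_le (x : ℝ) : drift x ≤ 2 * x := by
  rw [drift]; nlinarith [sq_nonneg x]

/-- Little of `u ^ 2` passes a position close to the boundary in a short initial time. -/
theorem IsGoodPosition.integral_sq_le (h : IsGoodPosition u U x) {T : ℝ} (hT : 0 ≤ T) :
    ∫ r in Ioc 0 T, u (r, x) ^ 2 ≤ 2 * dist (U 0) (U T) + drift x ^ 2 * T := by
  have h1 := h.balance 0 T le_rfl hT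
  simp only [intervalIntegral.integral_of_le hT] at h1
  have h2 := (le_abs_self _).trans (abs_tail_sub_le (U 0) (U T) h.pos.le)
  have h3 : drift x * ∫ r in Ioc 0 T, u (r, x) ≤
      ∫ r in Ioc 0 T, (u (r, x) ^ 2 / 2 + drift x ^ 2 / 2) := by
    rw [← integral_const_mul]
    refine integral_mono ((h.integrable T).const_mul _) (((h.integrable_sq T).div_const _).add ?_)
      fun r => mul_le_half_sq_add_half_sq _ _
    exact integrable_const _
  rw [integral_add ((h.integrable_sq T).div_const _) (integrable_const _), integral_div] at h3
  simp only [integral_const, MeasurableSet.univ, measureReal_restrict_apply, univ_inter,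
    Real.volume_real_Ioc_of_le hT, smul_eq_mul, sub_zero] at h3
  linarith

/-- The drift contributes little close to the boundary. -/
theorem IsGoodPosition.drift_mul_integral_le (h : IsGoodPosition u U x) (hx : x ≤ 1) {T : ℝ}
    (hT : 0 ≤ T) :
    drift x * ∫ r in Ioc 0 T, u (r, x) ≤ 4 * (dist (U 0) (U T) + T) * x := by
  have hb0 := drift_nonneg h.pos.le (by linarith)
  have h1 := h.integral_sq_le hT
  have h2 : ∫ r in Ioc 0 T, u (r, x) ≤ ∫ r in Ioc 0 T, (u (r, x) ^ 2 / 2 + 1 / 2) := by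
    refine integral_mono (h.integrable T) (((h.integrable_sq T).div_const _).add ?_) fun r => ?_
    · exact integrable_const _
    · have := mul_le_half_sq_add_half_sq 1 (u (r, x))
      simpa using this
  rw [integral_add ((h.integrable_sq T).div_const _) (integrable_const _), integral_div] at h2
  simp only [integral_const, MeasurableSet.univ, measureReal_restrict_apply, univ_inter,
    Real.volume_real_Ioc_of_le hT, smul_eq_mul, sub_zero] at h2
  have h3 : drift x ^ 2 * T ≤ 1 * T :=
    mul_le_mul_of_nonneg_right (by nlinarith [drift_le_one x]) hT
  have h4 : ∫ r in Ioc 0 T, u (r, x) ≤ 2 * (dist (U 0) (U T) + T) := by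
    have := dist_nonneg (x := U 0) (y := U T)
    linarith
  have h5 : 0 ≤ 2 * (dist (U 0) (U T) + T) := by positivity
  calc drift x * ∫ r in Ioc 0 T, u (r, x) ≤ drift x * (2 * (dist (U 0) (U T) + T)) :=
        mul_le_mul_of_nonneg_left h4 hb0
    _ ≤ (2 * x) * (2 * (dist (U 0) (U T) + T)) := mul_le_mul_of_nonneg_right (drift_le x) h5
    _ = _ := by ring

end

/-! ### Completeness and translations -/

theorem tendsto_setLIntegral_translate {F : ℝ × ℝ → ℝ} {K K' : Set (ℝ × ℝ)}
    (hK : MeasurableSet K) (hK' : MeasurableSet K') (hF : IntegrableOn F K')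
    (hsub : ∀ᶠ h : ℝ in 𝓝 0, ∀ p ∈ K, p + (h, 0) ∈ K') :
    Tendsto (fun h : ℝ => ∫⁻ p in K, ‖F (p + (h, 0)) - F p‖ₑ) (𝓝 0) (𝓝 0) := by
  have hc : Tendsto (fun h : ℝ => ((h, 0) : ℝ × ℝ)) (𝓝 0) (𝓝 0) := by
    have : Continuous fun h : ℝ => ((h, 0) : ℝ × ℝ) := by fun_prop
    exact this.tendsto 0
  have h1 := (tendsto_lintegral_enorm_translate_sub volume (hF.integrable_indicator hK')).comp hc
  have h0 : ∀ p ∈ K, p ∈ K' := fun p hp => by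
    have := hsub.self_of_nhds p hp
    rwa [show ((0 : ℝ), (0 : ℝ)) = 0 from rfl, add_zero] at this
  refine tendsto_of_tendsto_of_tendsto_of_le_of_le' tendsto_const_nhds h1
    (Eventually.of_forall fun _ => zero_le) ?_
  filter_upwards [hsub] with h hh
  refine le_trans (le_of_eq (setLIntegral_congr_fun hK fun p hp => ?_))
    (setLIntegral_le_lintegral K _)
  rw [indicator_of_mem (hh p hp), indicator_of_mem (h0 p hp)]

/-- A family that is approximated by fixed functions in `L¹(0, T)`, for every `T`, up to arbitrarily
small errors, converges in `L¹(0, T)` for every `T`, and the limit does not depend on `T`. -/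
theorem exists_tendsto_of_approx {ι : Type*} {l : Filter ι} [l.NeBot] {f : ι → ℝ → ℝ}
    (hf : ∀ x, Measurable (f x))
    (h : ∀ T ε : ℝ, 0 < T → 0 < ε → ∃ a : ℝ → ℝ, Measurable a ∧
      ∀ᶠ x in l, ∫⁻ t in Ioo 0 T, ‖f x t - a t‖ₑ ≤ ENNReal.ofReal ε) :
    ∃ f₀ : ℝ → ℝ, Measurable f₀ ∧
      ∀ T, 0 < T → Tendsto (fun x => ∫⁻ t in Ioo 0 T, ‖f x t - f₀ t‖ₑ) l (𝓝 0) := by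
  choose a ham ha using fun k : ℕ => h (k + 1) ((1 / 2) ^ k / 4) (by positivity) (by positivity)
  have hcau : ∀ k j : ℕ, ∀ T : ℝ, T ≤ k + 1 → T ≤ j + 1 →
      ∫⁻ t in Ioo 0 T, ‖a k t - a j t‖ₑ ≤
        ENNReal.ofReal ((1 / 2) ^ k / 4) + ENNReal.ofReal ((1 / 2) ^ j / 4) := by
    intro k j T hk hj
    obtain ⟨x, h1, h2⟩ := ((ha k).and (ha j)).exists
    calc ∫⁻ t in Ioo 0 T, ‖a k t - a j t‖ₑ
        ≤ ∫⁻ t in Ioo 0 T, (‖f x t - a k t‖ₑ + ‖f x t - a j t‖ₑ) := by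
          refine lintegral_mono fun t => ?_
          rw [← enorm_neg (f x t - a k t), neg_sub]
          refine le_trans (le_of_eq ?_) (enorm_add_le _ _)
          congr 1; ring
      _ = (∫⁻ t in Ioo 0 T, ‖f x t - a k t‖ₑ) + ∫⁻ t in Ioo 0 T, ‖f x t - a j t‖ₑ :=
          lintegral_add_left ((hf x).sub (ham k)).enorm _
      _ ≤ _ := add_le_add ((lintegral_mono_set (Ioo_subset_Ioo_right hk)).trans h1)
          ((lintegral_mono_set (Ioo_subset_Ioo_right hj)).trans h2)
  set f₀ : ℝ → ℝ := fun t => limsup (fun n => a n t) atTop with hf₀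
  have hf₀m : Measurable f₀ := Measurable.limsup ham
  refine ⟨f₀, hf₀m, fun T hT => ?_⟩
  obtain ⟨j, hj⟩ := exists_nat_gt T
  set μ := (volume : Measure ℝ).restrict (Ioo 0 T) with hμ
  have hB : ∑' i : ℕ, ENNReal.ofReal ((1 / 2) ^ i) ≠ ⊤ :=
    (summable_geometric_two).tsum_ofReal_ne_top
  have hcau' : ∀ N n m : ℕ, N ≤ n → N ≤ m →
      eLpNorm (a (n + j) - a (m + j)) 1 μ < ENNReal.ofReal ((1 / 2) ^ N) := by
    intro N n m hn hm
    rw [eLpNorm_one_eq_lintegral_enorm]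
    refine (hcau (n + j) (m + j) T (by push_cast; linarith [n.cast_nonneg (α := ℝ)])
      (by push_cast; linarith [m.cast_nonneg (α := ℝ)])).trans_lt ?_
    rw [← ENNReal.ofReal_add (by positivity) (by positivity)]
    refine (ENNReal.ofReal_lt_ofReal_iff (by positivity)).2 ?_
    have e1 : ((1 : ℝ) / 2) ^ (n + j) ≤ (1 / 2) ^ N :=
      pow_le_pow_of_le_one (by norm_num) (by norm_num) (by omega)
    have e2 : ((1 : ℝ) / 2) ^ (m + j) ≤ (1 / 2) ^ N :=
      pow_le_pow_of_le_one (by norm_num) (by norm_num) (by omega)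
    have e3 : (0 : ℝ) < (1 / 2) ^ N := by positivity
    linarith
  have hlim : ∀ᵐ t ∂μ, Tendsto (fun n => a (n + j) t) atTop (𝓝 (f₀ t)) := by
    filter_upwards [Lp.ae_tendsto_of_cauchy_eLpNorm (μ := μ) (p := 1)
      (fun n => (ham (n + j)).aestronglyMeasurable) le_rfl hB hcau'] with t ⟨L, hL⟩
    have hL' : Tendsto (fun n => a n t) atTop (𝓝 L) :=
      (tendsto_add_atTop_iff_nat (f := fun n => a n t) j).1 hL
    rw [hf₀]
    dsimp only
    rwa [hL'.limsup_eq]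
  have hconv := Lp.cauchy_tendsto_of_tendsto (p := 1)
    (fun n => (ham (n + j)).aestronglyMeasurable) f₀ hB hcau' hlim
  rw [ENNReal.tendsto_nhds_zero]
  intro ε hε
  have hpow : Tendsto (fun n : ℕ => ENNReal.ofReal ((1 / 2) ^ (n + j) / 4)) atTop (𝓝 0) := by
    have h1 : Tendsto (fun n : ℕ => ((1 : ℝ) / 2) ^ (n + j) / 4) atTop (𝓝 0) := by
      have := (((tendsto_pow_atTop_nhds_zero_of_lt_one (r := (1 : ℝ) / 2) (by norm_num)
        (by norm_num)).comp (tendsto_add_atTop_nat j)).div_const 4)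
      simpa using this
    simpa using ENNReal.tendsto_ofReal h1
  have hε2 : 0 < ε / 2 := ENNReal.half_pos hε.ne'
  obtain ⟨n, hn1, hn2⟩ := ((ENNReal.tendsto_nhds_zero.1 hconv _ hε2).and
    (ENNReal.tendsto_nhds_zero.1 hpow _ hε2)).exists
  filter_upwards [ha (n + j)] with x hx
  calc ∫⁻ t in Ioo 0 T, ‖f x t - f₀ t‖ₑ
      ≤ ∫⁻ t in Ioo 0 T, (‖f x t - a (n + j) t‖ₑ + ‖a (n + j) t - f₀ t‖ₑ) := by
        refine lintegral_mono fun t => ?_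
        refine le_trans (le_of_eq ?_) (enorm_add_le _ _)
        congr 1; ring
    _ = (∫⁻ t in Ioo 0 T, ‖f x t - a (n + j) t‖ₑ) + ∫⁻ t in Ioo 0 T, ‖a (n + j) t - f₀ t‖ₑ :=
        lintegral_add_left ((hf x).sub (ham _)).enorm _
    _ ≤ ε / 2 + ε / 2 := by
        refine add_le_add ?_ ?_
        · refine ((lintegral_mono_set (Ioo_subset_Ioo_right ?_)).trans hx).trans hn2
          push_cast
          linarith [n.cast_nonneg (α := ℝ)]
        · rw [eLpNorm_one_eq_lintegral_enorm] at hn1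
          exact hn1
    _ = ε := ENNReal.add_halves ε

/-! ### Time translations of the square near the boundary -/

theorem smoothStep_eq_one {s t ε x : ℝ} (hε : 0 < ε) (h1 : s + ε ≤ x) (h2 : x ≤ t) :
    smoothStep s t ε x = 1 := by
  rw [smoothStep, Real.smoothTransition.one_of_one_le ((one_le_div hε).2 (by linarith)),
    Real.smoothTransition.zero_of_nonpos (div_nonpos_of_nonpos_of_nonneg (by linarith) hε.le),
    sub_zero]

theorem setLIntegral_prod_eq_iterated {Φ : ℝ × ℝ → ℝ≥0∞} (hΦ : Measurable Φ) (I J : Set ℝ) :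
    ∫⁻ p in I ×ˢ J, Φ p = ∫⁻ y in J, ∫⁻ t in I, Φ (t, y) := by
  rw [Measure.volume_eq_prod, ← Measure.prod_restrict, lintegral_prod_symm _ hΦ.aemeasurable]

theorem enorm_integral_mul_le {A a : ℝ → ℝ} {I : Set ℝ} {C : ℝ}
    (hI : ∀ t ∉ I, a t = 0) (hC : ∀ t, |a t| ≤ C) :
    ‖∫ t, A t * a t‖ₑ ≤ ∫⁻ t in I, ENNReal.ofReal C * ‖A t‖ₑ := by
  have h : ∫ t, A t * a t = ∫ t in I, A t * a t :=
    (setIntegral_eq_integral_of_forall_compl_eq_zero fun t ht => by rw [hI t ht, mul_zero]).symm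
  rw [h]
  refine (enorm_integral_le_lintegral_enorm _).trans (lintegral_mono fun t => ?_)
  rw [enorm_mul, mul_comm]
  gcongr
  rw [Real.enorm_eq_ofReal_abs]
  exact ENNReal.ofReal_le_ofReal (hC t)

/-- A bound for the effect of a time translation by `h`, measured away from the boundary `x = 0`:
the change of `u` and `u ^ 2` at the positions between `1` and `2`, and `C` times the change of `u`
at the positions up to `2`, during the time interval `I`. -/
noncomputable def interiorModulus (u : ℝ × ℝ → ℝ) (I : Set ℝ) (C h : ℝ) : ℝ≥0∞ :=
  (∫⁻ p in I ×ˢ Ioo 1 2, (‖u (p + (h, 0)) - u p‖ₑ + ‖u (p + (h, 0)) ^ 2 - u p ^ 2‖ₑ)) +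
    ENNReal.ofReal C * ∫⁻ p in I ×ˢ Ioo 0 2, ‖u (p + (h, 0)) - u p‖ₑ

section
variable {u : ℝ × ℝ → ℝ} {S : Set ℝ} {U : ℝ → HalfLineL1}

theorem IsSolution.tendsto_interiorModulus (hu : IsSolution u) {a b : ℝ} (ha : 0 < a) (C : ℝ) :
    Tendsto (interiorModulus u (Icc a b) C) (𝓝 0) (𝓝 0) := by
  have hum := hu.measurable
  have h1 : ∀ J : Set ℝ, MeasurableSet J →
      Tendsto (fun h : ℝ => ∫⁻ p in Icc a b ×ˢ J, ‖u (p + (h, 0)) - u p‖ₑ) (𝓝 0) (𝓝 0) := by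
    intro J hJ
    refine tendsto_setLIntegral_translate (measurableSet_Icc.prod hJ)
      (measurableSet_Iio.prod MeasurableSet.univ) (hu.integrableOn_Iio (b + 1)) ?_
    filter_upwards [Iio_mem_nhds (zero_lt_one' ℝ)] with h hh p hp
    rw [mem_Iio] at hh
    exact ⟨by simp only [Prod.fst_add, mem_Iio]; linarith [hp.1.2], trivial⟩
  have hK : Icc (a / 2) (b + 1) ×ˢ Icc 1 2 ⊆ quadrant :=
    Set.prod_mono (fun x hx => (half_pos ha).trans_le hx.1) fun x hx => one_pos.trans_le hx.1
  have h2 : Tendsto (fun h : ℝ => ∫⁻ p in Icc a b ×ˢ Ioo 1 2, ‖u (p + (h, 0)) ^ 2 - u p ^ 2‖ₑ)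
      (𝓝 0) (𝓝 0) := by
    refine tendsto_setLIntegral_translate (F := fun p => u p ^ 2)
      (measurableSet_Icc.prod measurableSet_Ioo) (measurableSet_Icc.prod measurableSet_Icc)
      (hu.integrableOn_sq _ hK (isCompact_Icc.prod isCompact_Icc)) ?_
    filter_upwards [Iio_mem_nhds (zero_lt_one' ℝ),
      Ioi_mem_nhds (show -(a / 2) < 0 by linarith)] with h hh hh' p hp
    rw [mem_Iio] at hh
    rw [mem_Ioi] at hh'
    refine ⟨⟨?_, ?_⟩, ?_⟩
    · simp only [Prod.fst_add]; linarith [hp.1.1]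
    · simp only [Prod.fst_add]; linarith [hp.1.2]
    · simp only [Prod.snd_add, add_zero]; exact Ioo_subset_Icc_self hp.2
  have h3 : ∀ h, interiorModulus u (Icc a b) C h =
      ((∫⁻ p in Icc a b ×ˢ Ioo 1 2, ‖u (p + (h, 0)) - u p‖ₑ) +
        ∫⁻ p in Icc a b ×ˢ Ioo 1 2, ‖u (p + (h, 0)) ^ 2 - u p ^ 2‖ₑ) +
      ENNReal.ofReal C * ∫⁻ p in Icc a b ×ˢ Ioo 0 2, ‖u (p + (h, 0)) - u p‖ₑ := fun h => by
    rw [interiorModulus, lintegral_add_left (by fun_prop)]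
  simp only [funext h3]
  have h4 := ((h1 (Ioo 1 2) measurableSet_Ioo).add h2).add
    (ENNReal.Tendsto.const_mul (h1 (Ioo 0 2) measurableSet_Ioo)
      (Or.inr (ENNReal.ofReal_ne_top (r := C))))
  simpa using h4

/-- The part `drift * |u - v|` of the entropy flux, `v` being a time translate of `u`, is at most a
multiple of `x` in the mean over a bounded time interval. -/
theorem IsGoodPosition.drift_mul_integral_abs_sub_le {x : ℝ} (h : IsGoodPosition u U x)
    (hu0 : ∀ p, 0 ≤ u p) (hx : x ≤ 1) {α : ℝ → ℝ} {B d : ℝ} (hB : 0 ≤ B) (hd0 : 0 ≤ d)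
    (hd1 : d ≤ 1) (hα0 : ∀ t, 0 ≤ α t) (hα1 : ∀ t, α t ≤ 1) (hαB : ∀ t ∉ Ioc 0 B, α t = 0) :
    drift x * ∫ t, |u (t, x) - u (t + d, x)| * α t ≤
      8 * (dist (U 0) (U (B + 1)) + (B + 1)) * x := by
  have hi1 : IntegrableOn (fun t => u (t, x)) (Ioc 0 (B + 1)) := h.integrable _
  have hsub : Ioc 0 B ⊆ Ioc 0 (B + 1) := Ioc_subset_Ioc_right (by linarith)
  have hi2 : IntegrableOn (fun t => u (t + d, x)) (Ioc 0 B) := by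
    have e : Ioc 0 B = (fun t => t + d) ⁻¹' Ioc d (B + d) := by
      ext t; simp
    rw [e]
    exact ((measurePreserving_add_right volume d).integrableOn_comp_preimage
      (measurableEmbedding_addRight _)).2 (hi1.mono_set (Ioc_subset_Ioc hd0 (by linarith)))
  have e1 : ∫ t in Ioc 0 B, u (t + d, x) ≤ ∫ t in Ioc 0 (B + 1), u (t, x) := by
    rw [← intervalIntegral.integral_of_le hB,
      intervalIntegral.integral_comp_add_right (fun t => u (t, x)),
      intervalIntegral.integral_of_le (by linarith)]
    exact setIntegral_mono_set hi1 (Eventually.of_forall fun t => hu0 _)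
      (Ioc_subset_Ioc (by linarith) (by linarith)).eventuallyLE
  have e2 : ∫ t in Ioc 0 B, u (t, x) ≤ ∫ t in Ioc 0 (B + 1), u (t, x) :=
    setIntegral_mono_set hi1 (Eventually.of_forall fun t => hu0 _) hsub.eventuallyLE
  have e3 : ∫ t, |u (t, x) - u (t + d, x)| * α t ≤
      ∫ t in Ioc 0 B, (u (t, x) + u (t + d, x)) := by
    rw [← setIntegral_eq_integral_of_forall_compl_eq_zero (s := Ioc 0 B) fun t ht => by
      rw [hαB t ht, mul_zero]]
    refine integral_mono_of_nonneg
      (Eventually.of_forall fun t => mul_nonneg (abs_nonneg _) (hα0 t))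
      ((hi1.mono_set hsub).add hi2) (Eventually.of_forall fun t => ?_)
    refine (mul_le_of_le_one_right (abs_nonneg _) (hα1 t)).trans ((abs_sub _ _).trans_eq ?_)
    rw [abs_of_nonneg (hu0 _), abs_of_nonneg (hu0 _)]
  rw [integral_add (hi1.mono_set hsub) hi2] at e3
  have h1 := h.drift_mul_integral_le hx (T := B + 1) (by linarith)
  have h2 : ∫ t, |u (t, x) - u (t + d, x)| * α t ≤ 2 * ∫ t in Ioc 0 (B + 1), u (t, x) := by
    linarith
  have h3 := mul_le_mul_of_nonneg_left h2 (drift_nonneg h.pos.le (by linarith : x ≤ 2))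
  linarith

/-- By the contraction inequality between `u` and its time translates, the modulus of continuity
of `u ^ 2` in time, at a position `x` close to the boundary, is controlled by the moduli of
continuity inside the domain. -/
theorem IsVersion.ae_lintegral_sq_translate_le (hU : IsVersion u S U) (hu : IsSolution u)
    (hc : ContinuousOn U (Ici 0)) {τ T : ℝ} (hτ : 0 < τ) (hT : τ ≤ T) :
    ∃ C C' a b : ℝ, 0 < a ∧ ∀ h : ℝ, 0 ≤ h → h ≤ 1 → ∀ᵐ x, 0 < x → x < 1 →
      ∫⁻ t in Ioo τ T, ‖u (t + h, x) ^ 2 - u (t, x) ^ 2‖ₑ ≤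
        ENNReal.ofReal (C * x) + interiorModulus u (Icc a b) C' h := by
  have hum := hu.measurable
  set α : ℝ → ℝ := smoothStep (τ / 2) T (τ / 2) with hαdef
  have hτ2 : 0 < τ / 2 := half_pos hτ
  have hτT : τ / 2 ≤ T := by linarith
  have hα : IsTest α := isTest_smoothStep hτ2 hτT hτ2
  have hα0 : ∀ t, 0 ≤ α t := smoothStep_nonneg hτT hτ2
  have hα1 : ∀ t, α t ≤ 1 := smoothStep_le_one
  obtain ⟨C', -, hC'⟩ := hα.isCutoff_deriv.exists_bound
  set B := T + τ / 2 with hB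
  have hts : tsupport α ⊆ Icc (τ / 2) B := tsupport_smoothStep_subset hτT hτ2
  have hαI : ∀ t ∉ Icc (τ / 2) B, α t = 0 := fun t ht =>
    image_eq_zero_of_notMem_tsupport fun h => ht (hts h)
  have hαI' : ∀ t ∉ Icc (τ / 2) B, deriv α t = 0 := fun t ht =>
    image_eq_zero_of_notMem_tsupport fun h => ht (hts (tsupport_deriv_subset h))
  refine ⟨8 * (dist (U 0) (U (B + 1)) + (B + 1)), C', τ / 2, B, hτ2, fun h hh0 hh1 => ?_⟩
  set v : ℝ × ℝ → ℝ := fun p => u (p + (h, 0)) with hv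
  have hvK : IsKruzkovSolution v := hu.translate hh0
  have hvm := hvK.measurable
  obtain ⟨N, hN, hNle⟩ := hu.exists_ae_entropyFlux_le hvK hα hα0
  filter_upwards [hN, hU.ae_isGoodPosition hu hc,
    (hu.isLocInt_abs_sub hvK).ae_integrableOn_slice,
    ((hu.isLocInt_sq.sub hvK.isLocInt_sq).abs).ae_integrableOn_slice] with x hxN hxg hx1 hx2 hx0 hxlt
  have i1 : Integrable fun t => |u (t, x) - v (t, x)| * α t :=
    hα.isCutoff.integrable_mul_of_integrableOn (hx1 hx0)
  have i2 : Integrable fun t => |u (t, x) ^ 2 - v (t, x) ^ 2| * α t :=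
    hα.isCutoff.integrable_mul_of_integrableOn (hx2 hx0)
  have hsplit : ∫ t, |u (t, x) ^ 2 - v (t, x) ^ 2| * α t =
      drift x * (∫ t, |u (t, x) - v (t, x)| * α t) - ∫ t, entropyFlux u v (t, x) * α t := by
    rw [← integral_const_mul, ← integral_sub (i1.const_mul _)]
    · refine integral_congr_ae (Eventually.of_forall fun t => ?_)
      simp only [entropyFlux]; ring
    · refine ((i1.const_mul (drift x)).sub i2).congr (Eventually.of_forall fun t => ?_)
      simp only [entropyFlux, Pi.sub_apply]; ring
  have hdrift : drift x * ∫ t, |u (t, x) - v (t, x)| * α t ≤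
      8 * (dist (U 0) (U (B + 1)) + (B + 1)) * x := by
    have := (hxg hx0).drift_mul_integral_abs_sub_le hu.nonneg hxlt.le (α := α) (B := B) (d := h)
      (by linarith) hh0 hh1 hα0 hα1 fun t ht => hαI t fun h => ht ⟨hτ2.trans_le h.1, h.2⟩
    simpa [hv] using this
  have hL : ∫⁻ t in Ioo τ T, ‖u (t + h, x) ^ 2 - u (t, x) ^ 2‖ₑ ≤
      ENNReal.ofReal (∫ t, |u (t, x) ^ 2 - v (t, x) ^ 2| * α t) := by
    rw [ofReal_integral_eq_lintegral_ofReal i2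
      (Eventually.of_forall fun t => mul_nonneg (abs_nonneg _) (hα0 t))]
    refine le_trans (le_of_eq (setLIntegral_congr_fun measurableSet_Ioo fun t ht => ?_))
      (setLIntegral_le_lintegral (Ioo τ T) _)
    have : α t = 1 := smoothStep_eq_one hτ2 (by linarith [ht.1]) ht.2.le
    rw [this, mul_one, abs_sub_comm, Real.enorm_eq_ofReal_abs]
    simp [hv]
  have hk : ∀ y, x < y → y < 2 →
      ‖∫ z in x..y, ∫ t, |u (t, z) - v (t, z)| * deriv α t‖ₑ ≤
        ENNReal.ofReal C' * ∫⁻ p in Icc (τ / 2) B ×ˢ Ioo 0 2, ‖v p - u p‖ₑ := by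
    intro y hxy hy2
    rw [intervalIntegral.integral_of_le hxy.le, setLIntegral_prod_eq_iterated (by fun_prop),
      ← lintegral_const_mul' _ _ ENNReal.ofReal_ne_top]
    refine (enorm_integral_le_lintegral_enorm _).trans ((lintegral_mono fun z => ?_).trans
      (lintegral_mono_set fun z hz => ⟨hx0.trans hz.1, hz.2.trans_lt hy2⟩))
    refine (enorm_integral_mul_le hαI' hC').trans (le_of_eq ?_)
    rw [lintegral_const_mul' _ _ ENNReal.ofReal_ne_top]
    congr 1
    refine lintegral_congr fun t => ?_
    rw [Real.enorm_abs, ← enorm_neg, neg_sub]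
  have hE : ∀ y, 1 < y → y < 2 → ‖∫ t, entropyFlux u v (t, y) * α t‖ₑ ≤
      ∫⁻ t in Icc (τ / 2) B, (‖v (t, y) - u (t, y)‖ₑ + ‖v (t, y) ^ 2 - u (t, y) ^ 2‖ₑ) := by
    intro y hy1 hy2
    refine (enorm_integral_mul_le (C := 1) hαI fun t => ?_).trans (lintegral_mono fun t => ?_)
    · rw [abs_of_nonneg (hα0 t)]; exact hα1 t
    · rw [ENNReal.ofReal_one, one_mul, entropyFlux]
      refine (enorm_sub_le).trans (add_le_add ?_ ?_)
      · rw [← enorm_neg (v (t, y) - u (t, y)), neg_sub, enorm_mul, Real.enorm_abs]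
        refine mul_le_of_le_one_left' ?_
        rw [Real.enorm_eq_ofReal_abs, abs_of_nonneg (drift_nonneg (by linarith) hy2.le)]
        exact ENNReal.ofReal_le_one.2 (drift_le_one y)
      · rw [Real.enorm_abs, ← enorm_neg, neg_sub]
  -- The entropy flux at `x` is compared with that at a position `y` between `1` and `2`.
  have hy : ∀ᵐ y ∂(volume.restrict (Ioo (1 : ℝ) 2)),
      ∫⁻ t in Ioo τ T, ‖u (t + h, x) ^ 2 - u (t, x) ^ 2‖ₑ ≤
        ENNReal.ofReal (8 * (dist (U 0) (U (B + 1)) + (B + 1)) * x) +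
        ((∫⁻ t in Icc (τ / 2) B, (‖v (t, y) - u (t, y)‖ₑ + ‖v (t, y) ^ 2 - u (t, y) ^ 2‖ₑ)) +
        ENNReal.ofReal C' * ∫⁻ p in Icc (τ / 2) B ×ˢ Ioo 0 2, ‖v p - u p‖ₑ) := by
    filter_upwards [ae_restrict_mem measurableSet_Ioo, ae_restrict_of_ae hN] with y hy hyN
    have hxy : x < y := hxlt.trans hy.1
    have h1 := hNle x hxN y hyN hx0 hxy
    have h2 : ∫ t, |u (t, x) ^ 2 - v (t, x) ^ 2| * α t ≤
        8 * (dist (U 0) (U (B + 1)) + (B + 1)) * x +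
        (|∫ t, entropyFlux u v (t, y) * α t| +
          |∫ z in x..y, ∫ t, |u (t, z) - v (t, z)| * deriv α t|) := by
      rw [hsplit]
      linarith [neg_abs_le (∫ t, entropyFlux u v (t, y) * α t),
        le_abs_self (∫ z in x..y, ∫ t, |u (t, z) - v (t, z)| * deriv α t)]
    refine hL.trans ((ENNReal.ofReal_le_ofReal h2).trans ?_)
    refine ENNReal.ofReal_add_le.trans (add_le_add le_rfl (ENNReal.ofReal_add_le.trans
      (add_le_add ?_ ?_)))
    · rw [← Real.enorm_eq_ofReal_abs]; exact hE y hy.1 hy.2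
    · rw [← Real.enorm_eq_ofReal_abs]; exact hk y hxy hy.2
  -- Averaging over the positions between `1` and `2`.
  have hvol : (volume.restrict (Ioo (1 : ℝ) 2)) univ = 1 := by
    rw [Measure.restrict_apply_univ, Real.volume_Ioo]; norm_num
  have hint := lintegral_mono_ae hy
  rw [lintegral_const, hvol, mul_one, lintegral_add_left measurable_const,
    lintegral_add_right _ measurable_const, lintegral_const, lintegral_const, hvol, mul_one,
    mul_one] at hint
  rw [interiorModulus, setLIntegral_prod_eq_iterated (by fun_prop) _ (Ioo 1 2)]
  exact hint

end

/-! ### Convergence of the square at the boundary -/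

/-- A bound for the translations by less than `η` is also one for the distance to the average over
an interval of length `η`. -/
theorem lintegral_sub_average_le {f : ℝ → ℝ} (hfm : Measurable f)
    (hf : ∀ T, IntegrableOn f (Ioc 0 T)) {τ T η : ℝ} (hτ : 0 < τ) (hη : 0 < η) {c : ℝ≥0∞}
    (h : ∀ᵐ s, 0 < s → s < η → ∫⁻ t in Ioo τ T, ‖f (t + s) - f t‖ₑ ≤ c) :
    ∫⁻ t in Ioo τ T, ‖f t - (∫ r in t..t + η, f r) / η‖ₑ ≤ c := by
  have hpt : ∀ t ∈ Ioo τ T, ‖f t - (∫ r in t..t + η, f r) / η‖ₑ ≤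
      ENNReal.ofReal η⁻¹ * ∫⁻ s in Ioo 0 η, ‖f (t + s) - f t‖ₑ := by
    intro t ht
    have hi : IntegrableOn (fun s => f (t + s)) (Ioc 0 η) := by
      have e : Ioc 0 η = (fun s => t + s) ⁻¹' Ioc t (t + η) := by
        ext s; simp
      rw [e]
      exact ((measurePreserving_add_left volume t).integrableOn_comp_preimage
        (measurableEmbedding_addLeft _)).2 ((hf (t + η)).mono_set
          (Ioc_subset_Ioc_left (hτ.trans ht.1).le))
    have e1 : f t - (∫ r in t..t + η, f r) / η = -(η⁻¹ * ∫ s in Ioc 0 η, (f (t + s) - f t)) := by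
      rw [integral_sub hi (integrable_const _)]
      simp only [integral_const, MeasurableSet.univ, measureReal_restrict_apply, univ_inter,
        Real.volume_real_Ioc_of_le hη.le, smul_eq_mul, sub_zero]
      rw [← intervalIntegral.integral_of_le hη.le,
        intervalIntegral.integral_comp_add_left (fun r => f r), add_zero]
      field_simp
      ring
    rw [e1, enorm_neg, enorm_mul, Real.enorm_eq_ofReal_abs, abs_of_pos (inv_pos.2 hη)]
    gcongr
    rw [integral_Ioc_eq_integral_Ioo]
    exact enorm_integral_le_lintegral_enorm _
  calc ∫⁻ t in Ioo τ T, ‖f t - (∫ r in t..t + η, f r) / η‖ₑ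
      ≤ ∫⁻ t in Ioo τ T, ENNReal.ofReal η⁻¹ * ∫⁻ s in Ioo 0 η, ‖f (t + s) - f t‖ₑ :=
        setLIntegral_mono' measurableSet_Ioo hpt
    _ = ENNReal.ofReal η⁻¹ * ∫⁻ s in Ioo 0 η, ∫⁻ t in Ioo τ T, ‖f (t + s) - f t‖ₑ := by
        rw [lintegral_const_mul' _ _ ENNReal.ofReal_ne_top, lintegral_lintegral_swap]
        have : Measurable fun p : ℝ × ℝ => ‖f (p.1 + p.2) - f p.1‖ₑ := by fun_prop
        exact this.aemeasurable
    _ ≤ ENNReal.ofReal η⁻¹ * ∫⁻ _ in Ioo 0 η, c := by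
        refine mul_le_mul' le_rfl (lintegral_mono_ae ?_)
        filter_upwards [ae_restrict_mem measurableSet_Ioo, ae_restrict_of_ae h] with s hs hs'
        exact hs' hs.1 hs.2
    _ = c := by
        rw [lintegral_const, Measure.restrict_apply_univ, Real.volume_Ioo, sub_zero, mul_comm c,
          ← mul_assoc, ← ENNReal.ofReal_mul (inv_nonneg.2 hη.le), inv_mul_cancel₀ hη.ne',
          ENNReal.ofReal_one, one_mul]

instance nhdsGT_inf_ae_neBot : (𝓝[>] (0 : ℝ) ⊓ ae (volume : Measure ℝ)).NeBot := by
  refine inf_neBot_iff.2 fun {s} hs {t} ht => ?_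
  obtain ⟨δ, hδ, hδs⟩ := mem_nhdsGT_iff_exists_Ioo_subset.1 hs
  have hpos : (volume.restrict (Ioo 0 δ)) ≠ 0 := by
    rw [Ne, Measure.restrict_eq_zero]
    simpa using hδ
  have : (ae (volume.restrict (Ioo 0 δ))).NeBot := ae_neBot.2 hpos
  have h2 : ∀ᵐ r ∂(volume.restrict (Ioo 0 δ)), r ∈ t := ae_restrict_of_ae ht
  obtain ⟨r, hr, hr'⟩ := ((ae_restrict_mem measurableSet_Ioo).and h2).exists
  exact ⟨r, hδs hr, hr'⟩

theorem tail_le_tail_zero {w : HalfLineL1} (hw : 0 ≤ w) {x : ℝ} (hx : 0 ≤ x) :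
    tail w x ≤ tail w 0 :=
  setIntegral_mono_set (HalfLineL1.integrable w) ((Lp.coeFn_nonneg w).2 hw)
    (Ioi_subset_Ioi hx).eventuallyLE

section
variable {u : ℝ × ℝ → ℝ} {S : Set ℝ} {U : ℝ → HalfLineL1}

theorem continuous_tail_comp {V : ℝ → HalfLineL1} (hV : Continuous V) {x : ℝ} (hx : 0 ≤ x) :
    Continuous fun t => tail (V t) x := (continuous_tail hx).comp hV

/-- For times in a bounded interval, the mass in `(0, x)` tends to zero in mean. -/
theorem tendsto_integral_tail_sub {V : ℝ → HalfLineL1} (hV : Continuous V) (hV0 : ∀ t, 0 ≤ V t)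
    (τ T : ℝ) :
    Tendsto (fun x => ∫ t in Ioo τ T, (tail (V t) 0 - tail (V t) x)) (𝓝[>] 0) (𝓝 0) := by
  have h := tendsto_integral_filter_of_dominated_convergence (μ := volume.restrict (Ioo τ T))
    (l := 𝓝[>] (0 : ℝ)) (F := fun x t => tail (V t) 0 - tail (V t) x) (f := fun _ => 0)
    (fun t => tail (V t) 0) ?_ ?_ ?_ ?_
  · simpa using h
  · filter_upwards [self_mem_nhdsWithin] with x hx
    exact ((continuous_tail_comp hV le_rfl).sub
      (continuous_tail_comp hV (le_of_lt hx))).aestronglyMeasurable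
  · filter_upwards [self_mem_nhdsWithin] with x hx
    refine Eventually.of_forall fun t => ?_
    rw [Real.norm_eq_abs, abs_of_nonneg (sub_nonneg.2 (tail_le_tail_zero (hV0 t) (le_of_lt hx)))]
    linarith [tail_nonneg (hV0 t) (le_of_lt hx)]
  · exact (continuous_tail_comp hV le_rfl).integrableOn_Icc.mono_set Ioo_subset_Icc_self
  · refine Eventually.of_forall fun t => ?_
    have := (tendsto_tail_zero (V t)).const_sub (tail (V t) 0)
    rwa [sub_self] at this

/-- Uniformly for small `x`, the square `u(·, x)²` is close in `L¹(τ, T)` to its averages over short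
time intervals, since its modulus of continuity in time is controlled there. -/
theorem IsVersion.eventually_lintegral_sub_average_le (hU : IsVersion u S U) (hu : IsSolution u)
    (hc : ContinuousOn U (Ici 0)) {τ T ε : ℝ} (hτ : 0 < τ) (hT : τ ≤ T) (hε : 0 < ε) :
    ∃ η : ℝ, 0 < η ∧ ∀ᶠ x in 𝓝[>] 0 ⊓ ae volume,
      ∫⁻ t in Ioo τ T, ‖u (t, x) ^ 2 - (∫ r in t..t + η, u (r, x) ^ 2) / η‖ₑ ≤
        ENNReal.ofReal ε := by
  have hum := hu.measurable
  obtain ⟨C, C', a, b, ha, h⟩ := hU.ae_lintegral_sq_translate_le hu hc hτ hT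
  have hε2 : 0 < ENNReal.ofReal (ε / 2) := ENNReal.ofReal_pos.2 (by positivity)
  obtain ⟨δ, hδ, hball⟩ := Metric.eventually_nhds_iff.1
    (ENNReal.tendsto_nhds_zero.1 (hu.tendsto_interiorModulus (b := b) ha C') _ hε2)
  set η := min δ 1 with hη
  have hη0 : 0 < η := lt_min hδ one_pos
  refine ⟨η, hη0, ?_⟩
  have hae : ∀ᵐ x, ∀ᵐ s : ℝ, 0 < x → x < 1 → 0 < s → s < η →
      ∫⁻ t in Ioo τ T, ‖u (t + s, x) ^ 2 - u (t, x) ^ 2‖ₑ ≤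
        ENNReal.ofReal (C * x) + ENNReal.ofReal (ε / 2) := by
    have hms : MeasurableSet {z : ℝ × ℝ | 0 < z.2 → z.2 < 1 → 0 < z.1 → z.1 < η →
        ∫⁻ t in Ioo τ T, ‖u (t + z.1, z.2) ^ 2 - u (t, z.2) ^ 2‖ₑ ≤
          ENNReal.ofReal (C * z.2) + ENNReal.ofReal (ε / 2)} := by
      have a1 : MeasurableSet {z : ℝ × ℝ | 0 < z.2} := measurableSet_lt measurable_const
        measurable_snd
      have a2 : MeasurableSet {z : ℝ × ℝ | z.2 < 1} := measurableSet_lt measurable_snd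
        measurable_const
      have a3 : MeasurableSet {z : ℝ × ℝ | 0 < z.1} := measurableSet_lt measurable_const
        measurable_fst
      have a4 : MeasurableSet {z : ℝ × ℝ | z.1 < η} := measurableSet_lt measurable_fst
        measurable_const
      have hm : Measurable fun q : (ℝ × ℝ) × ℝ =>
          ‖u (q.2 + q.1.1, q.1.2) ^ 2 - u (q.2, q.1.2) ^ 2‖ₑ := by fun_prop
      have a5 : MeasurableSet {z : ℝ × ℝ |
          ∫⁻ t in Ioo τ T, ‖u (t + z.1, z.2) ^ 2 - u (t, z.2) ^ 2‖ₑ ≤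
          ENNReal.ofReal (C * z.2) + ENNReal.ofReal (ε / 2)} :=
        measurableSet_le hm.lintegral_prod_right' (by fun_prop)
      exact a1.imp (a2.imp (a3.imp (a4.imp a5)))
    refine (Measure.ae_ae_comm hms).1 (Eventually.of_forall fun s => ?_)
    by_cases hs : 0 < s ∧ s < η
    · filter_upwards [h s hs.1.le (hs.2.le.trans (min_le_right _ _))] with x hx h1 h2 _ _
      refine (hx h1 h2).trans (add_le_add le_rfl (hball ?_))
      rw [Real.dist_0_eq_abs, abs_of_pos hs.1]
      exact hs.2.trans_le (min_le_left _ _)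
    · exact Eventually.of_forall fun x _ _ h1 h2 => absurd ⟨h1, h2⟩ hs
  have hCx : ∀ᶠ x in 𝓝[>] (0 : ℝ), C * x < ε / 2 := by
    have : Tendsto (fun x : ℝ => C * x) (𝓝 0) (𝓝 (C * 0)) := (continuous_const_mul C).tendsto 0
    rw [mul_zero] at this
    exact (this.eventually_lt_const (half_pos hε)).filter_mono nhdsWithin_le_nhds
  filter_upwards [hCx.filter_mono inf_le_left, mem_inf_of_left (Ioo_mem_nhdsGT (zero_lt_one' ℝ)),
    mem_inf_of_right hae, mem_inf_of_right (hU.ae_isGoodPosition hu hc)] with x h1 h2 h3 h4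
  refine lintegral_sub_average_le (f := fun t => u (t, x) ^ 2) (by fun_prop)
    (h4 h2.1).integrable_sq hτ hη0 ?_
  filter_upwards [h3] with s hs hs0 hs1
  refine (hs h2.1 h2.2 hs0 hs1).trans ?_
  rw [← add_halves ε, ENNReal.ofReal_add (by positivity) (by positivity), add_halves ε]
  gcongr

end

section
variable {u : ℝ × ℝ → ℝ} {S : Set ℝ} {U : ℝ → HalfLineL1}

/-- By the balance law, averages of `u ^ 2` over a time interval converge as `x → 0`. -/
theorem IsVersion.eventually_lintegral_average_sub_le (hU : IsVersion u S U) (hu : IsSolution u)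
    (hc : ContinuousOn U (Ici 0)) {τ T η ε : ℝ} (hτ : 0 < τ) (hT : τ ≤ T) (hη : 0 < η)
    (hε : 0 < ε) : ∃ a : ℝ → ℝ, Measurable a ∧ ∀ᶠ x in 𝓝[>] 0 ⊓ ae volume,
      ∫⁻ t in Ioo τ T, ‖(∫ r in t..t + η, u (r, x) ^ 2) / η - a t‖ₑ ≤ ENNReal.ofReal ε := by
  set V : ℝ → HalfLineL1 := fun t => U (max t 0) with hV
  have hVc : Continuous V := hc.comp_continuous (by fun_prop) fun t => le_max_right t 0
  have hV0 : ∀ t, 0 ≤ V t := fun t => hU.nonneg_of_continuousOn hu hc (le_max_right t 0)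
  have hVU : ∀ t, 0 ≤ t → V t = U t := fun t ht => by rw [hV]; simp only [max_eq_left ht]
  have hVc' : Continuous fun t => V (t + η) := by fun_prop
  refine ⟨fun t => (tail (V t) 0 - tail (V (t + η)) 0) / η,
    (((continuous_tail_comp hVc le_rfl).sub
      (continuous_tail_comp hVc' le_rfl)).div_const η).measurable, ?_⟩
  set D : ℝ := 4 * (dist (U 0) (U (T + η)) + (T + η)) with hD
  have hDx : Tendsto (fun x : ℝ => (T - τ) * (D * x)) (𝓝[>] 0) (𝓝 0) := by
    have : Tendsto (fun x : ℝ => (T - τ) * (D * x)) (𝓝 0) (𝓝 ((T - τ) * (D * 0))) := by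
      have : Continuous fun x : ℝ => (T - τ) * (D * x) := by fun_prop
      exact this.tendsto 0
    rw [mul_zero, mul_zero] at this
    exact this.mono_left nhdsWithin_le_nhds
  have hlim := (((tendsto_integral_tail_sub hVc hV0 τ T).add
    (tendsto_integral_tail_sub hVc' (fun t => hV0 _) τ T)).add hDx).const_mul η⁻¹
  rw [add_zero, add_zero, mul_zero] at hlim
  filter_upwards [(hlim.eventually_lt_const hε).filter_mono inf_le_left,
    mem_inf_of_left (Ioo_mem_nhdsGT (zero_lt_one' ℝ)),
    mem_inf_of_right (hU.ae_isGoodPosition hu hc)] with x h1 h2 h3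
  have hx := h3 h2.1
  have hx0 : 0 ≤ x := hx.pos.le
  have hp : ∀ {W : ℝ → HalfLineL1}, Continuous W →
      IntegrableOn (fun t => tail (W t) 0 - tail (W t) x) (Ioo τ T) := fun hW =>
    ((continuous_tail_comp hW le_rfl).sub
      (continuous_tail_comp hW hx0)).integrableOn_Icc.mono_set Ioo_subset_Icc_self
  have hpt : ∀ t ∈ Ioo τ T, ‖(∫ r in t..t + η, u (r, x) ^ 2) / η -
      (tail (V t) 0 - tail (V (t + η)) 0) / η‖ₑ ≤
      ENNReal.ofReal (η⁻¹ * ((tail (V t) 0 - tail (V t) x) +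
        (tail (V (t + η)) 0 - tail (V (t + η)) x) + D * x)) := by
    intro t ht
    have ht0 : 0 ≤ t := (hτ.trans ht.1).le
    rw [hx.balance t (t + η) ht0 (by linarith), hVU t ht0, hVU (t + η) (by linarith),
      Real.enorm_eq_ofReal_abs]
    refine ENNReal.ofReal_le_ofReal ?_
    rw [← sub_div, abs_div, abs_of_pos hη, div_eq_inv_mul]
    refine mul_le_mul_of_nonneg_left ?_ (inv_nonneg.2 hη.le)
    have b0 := drift_nonneg hx0 (by linarith [h2.2] : x ≤ 2)
    have i0 : 0 ≤ ∫ r in t..t + η, u (r, x) :=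
      intervalIntegral.integral_nonneg (by linarith) fun r _ => hu.nonneg _
    have i1 : ∫ r in t..t + η, u (r, x) ≤ ∫ r in Ioc 0 (T + η), u (r, x) := by
      rw [intervalIntegral.integral_of_le (by linarith)]
      exact setIntegral_mono_set (hx.integrable _) (Eventually.of_forall fun r => hu.nonneg _)
        (Ioc_subset_Ioc ht0 (by linarith [ht.2])).eventuallyLE
    have i2 := hx.drift_mul_integral_le h2.2.le (T := T + η) (by linarith)
    have i3 := mul_le_mul_of_nonneg_left i1 b0
    have i4 := mul_nonneg b0 i0
    have p1 := tail_le_tail_zero (hVU t ht0 ▸ hV0 t) hx0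
    have p2 := tail_le_tail_zero (hVU (t + η) (by linarith) ▸ hV0 (t + η)) hx0
    rw [abs_le]
    constructor <;> linarith
  refine (setLIntegral_mono' measurableSet_Ioo hpt).trans ?_
  have hint : IntegrableOn (fun t => η⁻¹ * ((tail (V t) 0 - tail (V t) x) +
      (tail (V (t + η)) 0 - tail (V (t + η)) x) + D * x)) (Ioo τ T) :=
    (((hp hVc).add (hp hVc')).add (integrable_const (D * x))).const_mul η⁻¹
  have hD0 : 0 ≤ D * x := by
    have : 0 ≤ T + η := by linarith
    positivity
  rw [← ofReal_integral_eq_lintegral_ofReal hint (Eventually.of_forall fun t => mul_nonneg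
    (inv_nonneg.2 hη.le) (add_nonneg (add_nonneg (sub_nonneg.2 (tail_le_tail_zero (hV0 _) hx0))
      (sub_nonneg.2 (tail_le_tail_zero (hV0 _) hx0))) hD0))]
  refine ENNReal.ofReal_le_ofReal (le_trans (le_of_eq ?_) h1.le)
  have hpp : IntegrableOn (fun t => (tail (V t) 0 - tail (V t) x) +
      (tail (V (t + η)) 0 - tail (V (t + η)) x)) (Ioo τ T) := (hp hVc).add (hp hVc')
  rw [integral_const_mul, integral_add hpp (integrable_const _),
    integral_add (hp hVc) (hp hVc')]
  simp [measureReal_restrict_apply, Real.volume_real_Ioo_of_le hT]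

/-- Close to the boundary, `u ^ 2` is approximated in `L¹(0, T)` by a fixed function. -/
theorem IsVersion.exists_approx_sq (hU : IsVersion u S U) (hu : IsSolution u)
    (hc : ContinuousOn U (Ici 0)) {T ε : ℝ} (hT : 0 < T) (hε : 0 < ε) :
    ∃ a : ℝ → ℝ, Measurable a ∧ ∀ᶠ x in 𝓝[>] 0 ⊓ ae volume,
      ∫⁻ t in Ioo 0 T, ‖u (t, x) ^ 2 - a t‖ₑ ≤ ENNReal.ofReal ε := by
  have hum := hu.measurable
  have hε4 : 0 < ε / 4 := by positivity
  -- In a short initial time, `u ^ 2` is small in `L¹`, and is approximated by zero.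
  obtain ⟨τ, hτ, hτT, hdist⟩ : ∃ τ : ℝ, 0 < τ ∧ τ ≤ T ∧ 2 * dist (U 0) (U τ) < ε / 4 := by
    have h1 : Tendsto (fun t => 2 * dist (U 0) (U t)) (𝓝[>] 0) (𝓝 (2 * dist (U 0) (U 0))) :=
      ((tendsto_const_nhds.dist ((hc 0 self_mem_Ici).mono_left
        (nhdsWithin_mono _ Ioi_subset_Ici_self)))).const_mul 2
    rw [dist_self, mul_zero] at h1
    obtain ⟨τ, h2, h3⟩ := ((h1.eventually_lt_const hε4).and (Ioo_mem_nhdsGT hT)).exists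
    exact ⟨τ, h3.1, h3.2.le, h2⟩
  have hd : Tendsto (fun x => drift x ^ 2 * τ) (𝓝[>] 0) (𝓝 0) := by
    have : Tendsto (fun x => drift x ^ 2 * τ) (𝓝 0) (𝓝 (drift 0 ^ 2 * τ)) :=
      ((continuous_drift.pow 2).mul continuous_const).tendsto 0
    rw [show drift 0 = 0 by simp [drift], zero_pow two_ne_zero, zero_mul] at this
    exact this.mono_left nhdsWithin_le_nhds
  obtain ⟨η, hη, hav⟩ := hU.eventually_lintegral_sub_average_le hu hc hτ hτT hε4
  obtain ⟨a, ham, ha⟩ := hU.eventually_lintegral_average_sub_le hu hc hτ hτT hη hε4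
  refine ⟨(Ioi τ).indicator a, ham.indicator measurableSet_Ioi, ?_⟩
  filter_upwards [(hd.eventually_lt_const hε4).filter_mono inf_le_left, hav, ha,
    mem_inf_of_left self_mem_nhdsWithin, mem_inf_of_right (hU.ae_isGoodPosition hu hc)]
    with x h1 h2 h3 h4 h5
  have hx := h5 h4
  have e1 : ∫⁻ t in Ioc 0 τ, ‖u (t, x) ^ 2 - (Ioi τ).indicator a t‖ₑ ≤
      ENNReal.ofReal (ε / 4 + ε / 4) := by
    have e : ∫⁻ t in Ioc 0 τ, ‖u (t, x) ^ 2 - (Ioi τ).indicator a t‖ₑ =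
        ∫⁻ t in Ioc 0 τ, ENNReal.ofReal (u (t, x) ^ 2) := by
      refine setLIntegral_congr_fun measurableSet_Ioc fun t ht => ?_
      simp only [indicator_of_notMem (notMem_Ioi.2 ht.2), sub_zero]
      rw [Real.enorm_eq_ofReal_abs, abs_sq]
    rw [e, ← ofReal_integral_eq_lintegral_ofReal (hx.integrable_sq τ)
      (Eventually.of_forall fun t => sq_nonneg _)]
    refine ENNReal.ofReal_le_ofReal ?_
    have := hx.integral_sq_le hτ.le
    linarith
  have e2 : ∫⁻ t in Ioo τ T, ‖u (t, x) ^ 2 - (Ioi τ).indicator a t‖ₑ ≤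
      ENNReal.ofReal (ε / 4) + ENNReal.ofReal (ε / 4) := by
    refine le_trans ?_ (add_le_add h2 h3)
    rw [← lintegral_add_right' _ ?_]
    · refine setLIntegral_mono' measurableSet_Ioo fun t ht => ?_
      rw [indicator_of_mem (show t ∈ Ioi τ from ht.1)]
      refine le_trans (le_of_eq ?_) (enorm_add_le _ _)
      congr 1; ring
    · have hcont : ContinuousOn (fun t => ∫ r in t..t + η, u (r, x) ^ 2) (Ioo τ T) := by
        have hi : ∀ a b, 0 < a → IntegrableOn (fun r => u (r, x) ^ 2) (Icc a b) := fun a b ha =>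
          (hx.integrable_sq b).mono_set fun r hr => ⟨ha.trans_le hr.1, hr.2⟩
        have c1 := continuousOn_intervalIntegral hi one_pos
        have c2 : ContinuousOn (fun t => ∫ r in (1 : ℝ)..t + η, u (r, x) ^ 2) (Ioo τ T) :=
          c1.comp (by fun_prop) fun t ht => by
            rw [mem_Ioi]; linarith [ht.1]
        refine (c2.sub (c1.mono fun t ht => hτ.trans ht.1)).congr fun t ht => ?_
        have hii : ∀ {b : ℝ}, 0 < b →
            IntervalIntegrable (fun r => u (r, x) ^ 2) volume 1 b := by
          intro b hb
          refine IntegrableOn.intervalIntegrable ?_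
          exact hi _ _ (lt_min one_pos hb)
        have ht0 : 0 < t := hτ.trans ht.1
        exact (intervalIntegral.integral_interval_sub_left (hii (by linarith)) (hii ht0)).symm
      exact (((hcont.aemeasurable measurableSet_Ioo).div_const η).sub ham.aemeasurable).enorm
  have hsub : Ioo 0 T ⊆ Ioc 0 τ ∪ Ioo τ T := fun t ht => by
    rcases le_or_gt t τ with h | h
    · exact Or.inl ⟨ht.1, h⟩
    · exact Or.inr ⟨h, ht.2⟩
  refine ((lintegral_mono_set hsub).trans (lintegral_union_le _ _ _)).trans
    ((add_le_add e1 e2).trans (le_of_eq ?_))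
  rw [← ENNReal.ofReal_add hε4.le hε4.le, ← ENNReal.ofReal_add (by positivity) (by positivity)]
  congr 1; ring

end

/-! ### The boundary trace and the mass balance -/

/-- The square root is Hölder continuous of exponent `1 / 2`; in this form, with a free parameter
`δ`, the estimate can be integrated. -/
theorem abs_sub_sqrt_le {a b δ : ℝ} (ha : 0 ≤ a) (hδ : 0 < δ) :
    |a - √b| ≤ δ + δ⁻¹ * |a ^ 2 - b| := by
  have h1 : |a - √b| ^ 2 ≤ |a ^ 2 - b| := by
    rcases le_total b 0 with hb | hb
    · rw [Real.sqrt_eq_zero_of_nonpos hb, sub_zero, sq_abs, abs_of_nonneg (by nlinarith)]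
      linarith
    · have h2 : a ^ 2 - b = (a - √b) * (a + √b) := by
        nlinarith [Real.sq_sqrt hb]
      rw [h2, abs_mul, sq]
      refine mul_le_mul_of_nonneg_left ?_ (abs_nonneg _)
      rw [abs_of_nonneg (a := a + √b) (by positivity), abs_le]
      constructor <;> linarith [Real.sqrt_nonneg b]
  rcases le_or_gt |a - √b| δ with h | h
  · have : 0 ≤ δ⁻¹ * |a ^ 2 - b| := by positivity
    linarith
  · have h3 : δ * |a - √b| ≤ |a ^ 2 - b| := by nlinarith
    have h4 : |a - √b| ≤ δ⁻¹ * |a ^ 2 - b| := by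
      rw [← div_eq_inv_mul, le_div_iff₀ hδ]; linarith
    linarith

theorem abs_sq_sub_sq_sqrt_le (a b : ℝ) : |a ^ 2 - √b ^ 2| ≤ |a ^ 2 - b| := by
  rcases le_total b 0 with hb | hb
  · rw [Real.sqrt_eq_zero_of_nonpos hb, abs_of_nonneg (by nlinarith), abs_of_nonneg (by nlinarith)]
    linarith
  · rw [Real.sq_sqrt hb]

theorem tendsto_lintegral_sub_sqrt {ι : Type*} {l : Filter ι} {f : ι → ℝ → ℝ} {f₀ : ℝ → ℝ} {T : ℝ}
    (hf0 : ∀ x t, 0 ≤ f x t)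
    (h : Tendsto (fun x => ∫⁻ t in Ioo 0 T, ‖f x t ^ 2 - f₀ t‖ₑ) l (𝓝 0)) :
    Tendsto (fun x => ∫⁻ t in Ioo 0 T, ‖f x t - √(f₀ t)‖ₑ) l (𝓝 0) := by
  have hle : ∀ δ : ℝ, 0 < δ → ∀ x, ∫⁻ t in Ioo 0 T, ‖f x t - √(f₀ t)‖ₑ ≤
      ENNReal.ofReal δ * ENNReal.ofReal T +
        ENNReal.ofReal δ⁻¹ * ∫⁻ t in Ioo 0 T, ‖f x t ^ 2 - f₀ t‖ₑ := by
    intro δ hδ x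
    calc ∫⁻ t in Ioo 0 T, ‖f x t - √(f₀ t)‖ₑ
        ≤ ∫⁻ t in Ioo 0 T, (ENNReal.ofReal δ + ENNReal.ofReal δ⁻¹ * ‖f x t ^ 2 - f₀ t‖ₑ) := by
          refine lintegral_mono fun t => ?_
          rw [Real.enorm_eq_ofReal_abs, Real.enorm_eq_ofReal_abs,
            ← ENNReal.ofReal_mul (inv_nonneg.2 hδ.le)]
          exact (ENNReal.ofReal_le_ofReal (abs_sub_sqrt_le (hf0 x t) hδ)).trans
            ENNReal.ofReal_add_le
      _ = _ := by
          rw [lintegral_add_left measurable_const, lintegral_const_mul' _ _ ENNReal.ofReal_ne_top,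
            lintegral_const, Measure.restrict_apply_univ, Real.volume_Ioo, sub_zero]
  rw [ENNReal.tendsto_nhds_zero]
  intro ε hε
  have hε2 : 0 < ε / 2 := ENNReal.half_pos hε.ne'
  have h1 : Tendsto (fun δ : ℝ => ENNReal.ofReal δ * ENNReal.ofReal T) (𝓝[>] 0) (𝓝 0) := by
    have h2 : Tendsto (fun δ : ℝ => ENNReal.ofReal δ) (𝓝[>] 0) (𝓝 0) := by
      have := (ENNReal.continuous_ofReal.tendsto 0).mono_left
        (nhdsWithin_le_nhds (s := Ioi (0 : ℝ)))
      rwa [ENNReal.ofReal_zero] at this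
    simpa using ENNReal.Tendsto.mul_const h2 (Or.inr (ENNReal.ofReal_ne_top (r := T)))
  obtain ⟨δ, hδ1, hδ⟩ := ((ENNReal.tendsto_nhds_zero.1 h1 _ hε2).and
    (self_mem_nhdsWithin)).exists
  have h3 := ENNReal.Tendsto.const_mul h (Or.inr (ENNReal.ofReal_ne_top (r := δ⁻¹)))
  rw [mul_zero] at h3
  filter_upwards [ENNReal.tendsto_nhds_zero.1 h3 _ hε2] with x hx
  exact (hle δ hδ x).trans ((add_le_add hδ1 hx).trans_eq (ENNReal.add_halves ε))

section
variable {u : ℝ × ℝ → ℝ} {S : Set ℝ} {U : ℝ → HalfLineL1}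

/-- The trace is the square root of the limit of `u(·, x)²` in `L¹(0, T)`, and the mass balance is
the limit `x → 0` of the balance law on `(x, ∞)`. -/
theorem IsVersion.exists_trace (hU : IsVersion u S U) (hu : IsSolution u)
    (hc : ContinuousOn U (Ici 0)) : ∃ γ : ℝ → ℝ, Measurable γ ∧
      (∀ T, 0 < T →
        Tendsto (fun x => ∫⁻ t in Ioo 0 T, ‖u (t, x) - γ t‖ₑ) (𝓝[>] 0 ⊓ ae volume) (𝓝 0)) ∧
      ∀ T, 0 ≤ T → IntegrableOn (fun t => γ t ^ 2) (Ioc 0 T) ∧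
        tail (U T) 0 + ∫ t in Ioc 0 T, γ t ^ 2 = tail (U 0) 0 := by
  have hum := hu.measurable
  obtain ⟨f₀, hf₀m, hf₀⟩ := exists_tendsto_of_approx (l := 𝓝[>] (0 : ℝ) ⊓ ae volume)
    (f := fun x t => u (t, x) ^ 2) (fun x => by fun_prop)
    fun T ε hT hε => hU.exists_approx_sq hu hc hT hε
  have hγm : Measurable fun t => √(f₀ t) := hf₀m.sqrt
  refine ⟨fun t => √(f₀ t), hγm, fun T hT =>
    tendsto_lintegral_sub_sqrt (fun x t => hu.nonneg _) (hf₀ T hT), fun T hT => ?_⟩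
  rcases hT.eq_or_lt with rfl | hT
  · simp
  have hgood : ∀ᶠ x in 𝓝[>] (0 : ℝ) ⊓ ae volume, IsGoodPosition u U x := by
    filter_upwards [mem_inf_of_left self_mem_nhdsWithin,
      mem_inf_of_right (hU.ae_isGoodPosition hu hc)] with x h1 h2 using h2 h1
  have hsq : Tendsto (fun x => ∫⁻ t in Ioc 0 T, ‖u (t, x) ^ 2 - √(f₀ t) ^ 2‖ₑ)
      (𝓝[>] 0 ⊓ ae volume) (𝓝 0) := by
    refine tendsto_of_tendsto_of_tendsto_of_le_of_le tendsto_const_nhds (hf₀ T hT)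
      (fun _ => zero_le) fun x => ?_
    rw [setLIntegral_congr Ioo_ae_eq_Ioc.symm]
    refine lintegral_mono fun t => ?_
    rw [Real.enorm_eq_ofReal_abs, Real.enorm_eq_ofReal_abs]
    exact ENNReal.ofReal_le_ofReal (abs_sq_sub_sq_sqrt_le _ _)
  have hint : IntegrableOn (fun t => √(f₀ t) ^ 2) (Ioc 0 T) := by
    obtain ⟨x, hx1, hx2⟩ := (hgood.and (hsq.eventually_lt_const ENNReal.zero_lt_top)).exists
    have h1 : IntegrableOn (fun t => u (t, x) ^ 2 - √(f₀ t) ^ 2) (Ioc 0 T) :=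
      ⟨((hum.comp (by fun_prop)).pow_const 2 |>.sub (hγm.pow_const 2)).aestronglyMeasurable, hx2⟩
    refine ((hx1.integrable_sq T).sub h1).congr (Eventually.of_forall fun t => ?_)
    simp
  refine ⟨hint, ?_⟩
  have h1 : Tendsto (fun x => ∫ t in Ioc 0 T, u (t, x) ^ 2) (𝓝[>] 0 ⊓ ae volume)
      (𝓝 (∫ t in Ioc 0 T, √(f₀ t) ^ 2)) :=
    tendsto_integral_of_L1 _ hint.aestronglyMeasurable
      (hgood.mono fun x hx => hx.integrable_sq T) hsq
  have h2 : Tendsto (fun x => drift x * ∫ t in Ioc 0 T, u (t, x)) (𝓝[>] 0 ⊓ ae volume) (𝓝 0) := by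
    have h3 : Tendsto (fun x : ℝ => 4 * (dist (U 0) (U T) + T) * x) (𝓝[>] 0 ⊓ ae volume)
        (𝓝 0) := by
      have h4 : Tendsto (fun x : ℝ => 4 * (dist (U 0) (U T) + T) * x) (𝓝 0)
          (𝓝 (4 * (dist (U 0) (U T) + T) * 0)) := (continuous_const_mul _).tendsto 0
      rw [mul_zero] at h4
      exact (h4.mono_left nhdsWithin_le_nhds).mono_left inf_le_left
    refine tendsto_of_tendsto_of_tendsto_of_le_of_le' tendsto_const_nhds h3 ?_ ?_
    · filter_upwards [mem_inf_of_left (Ioo_mem_nhdsGT (zero_lt_one' ℝ))] with x hx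
      exact mul_nonneg (drift_nonneg hx.1.le (by linarith [hx.2]))
        (integral_nonneg fun t => hu.nonneg _)
    · filter_upwards [mem_inf_of_left (Ioo_mem_nhdsGT (zero_lt_one' ℝ)), hgood] with x hx hg
      exact hg.drift_mul_integral_le hx.2.le hT.le
  have h5 := (((tendsto_tail_zero (U 0)).sub (tendsto_tail_zero (U T))).mono_left
    (inf_le_left (b := ae volume))).add h2
  have h6 : ∫ t in Ioc 0 T, √(f₀ t) ^ 2 = tail (U 0) 0 - tail (U T) 0 + 0 := by
    refine tendsto_nhds_unique h1 (h5.congr' ?_)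
    filter_upwards [hgood] with x hx
    have := hx.balance 0 T le_rfl hT.le
    simp only [intervalIntegral.integral_of_le hT.le] at this
    exact this.symm
  rw [h6]; ring

end

theorem proposition2 (n : ℝ → ℝ → ℝ) (n₀ : ℝ → ℝ)
    (hn : IsEntropySolution n)
    (hn_nonneg : ∀ᵐ p ∂(volume.restrict (Ioi (0 : ℝ) ×ˢ Ioi (0 : ℝ))), 0 ≤ n p.1 p.2)
    (hn₀ : IntegrableOn n₀ (Ioi 0))
    (hn₀_supp : ∃ R : ℝ, ∀ᵐ x ∂(volume.restrict (Ioi 0)), R < x → n₀ x = 0)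
    (hinit : HasInitialData n n₀) :
    ∃ (γ : ℝ → ℝ) (u : ℝ → Lp ℝ 1 (volume.restrict (Ioi (0 : ℝ)))),
      IsTraceAtZero n γ ∧
      IsContinuousVersion n u ∧
      (u 0 : ℝ → ℝ) =ᵐ[volume.restrict (Ioi 0)] n₀ ∧
      ∀ T : ℝ, 0 ≤ T →
        IntegrableOn (fun t => γ t ^ 2) (Ioc 0 T) ∧
        photonNumber (u T) + ∫ t in Ioc 0 T, γ t ^ 2 = photonNumber n₀ := by
  obtain ⟨v, hv, hvn⟩ := hn.exists_isSolution hn_nonneg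
  have hslice_t := (ae_restrict_iff' measurableSet_Ioi).1 (ae_fst_of_ae_quadrant hvn)
  have hslice_x := (ae_restrict_iff' measurableSet_Ioi).1 (ae_snd_of_ae_quadrant hvn)
  set w : HalfLineL1 := (memLp_one_iff_integrable.2 hn₀).toLp with hw
  have hwn : w =ᵐ[volume.restrict (Ioi (0 : ℝ))] n₀ := MemLp.coeFn_toLp _
  have hvw : ∀ R : ℝ, 0 < R → Tendsto (fun t : ℝ => ∫⁻ x in Ioo 0 R, ‖v (t, x) - w x‖ₑ)
      (𝓝[>] 0 ⊓ ae volume) (𝓝 0) := by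
    intro R hR
    refine (hinit R hR).congr' ?_
    filter_upwards [mem_inf_of_left self_mem_nhdsWithin, mem_inf_of_right hslice_t] with t h1 h2
    refine lintegral_congr_ae (ae_mono (Measure.restrict_mono Ioo_subset_Ioi_self le_rfl) ?_)
    filter_upwards [h2 h1, hwn] with x a b
    rw [a, b]
  obtain ⟨S, U, hU, hUc, hU0⟩ := hv.exists_isVersion_initial hvw
  obtain ⟨γ, hγm, hγ, hbal⟩ := hU.exists_trace hv hUc
  refine ⟨γ, U, ⟨hγm.aestronglyMeasurable, fun T hT => ?_⟩, ⟨hUc, ?_⟩, hU0 ▸ hwn, fun T hT => ?_⟩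
  · refine (hγ T hT).congr' ?_
    filter_upwards [mem_inf_of_left self_mem_nhdsWithin, mem_inf_of_right hslice_x] with x h1 h2
    refine lintegral_congr_ae (ae_mono (Measure.restrict_mono Ioo_subset_Ioi_self le_rfl) ?_)
    filter_upwards [h2 h1] with t a
    rw [a]
  · rw [ae_restrict_iff' measurableSet_Ioi]
    filter_upwards [hU.full, hslice_t] with t h1 h2 h0
    filter_upwards [hU.eq t (h1 h0), h2 h0] with x a b
    rw [a, b]
  · refine ⟨(hbal T hT).1, (hbal T hT).2.trans ?_⟩
    rw [hU0]
    exact integral_congr_ae hwn
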